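/- **Setting.** Let $M\ge 1$ and $K\ge 2$ be integers and $N=KM$. A Gaussian two-armed bandit with parameter $\theta=(m_1,m_2)$ produces incomes $\xi_1,\dots,\xi_N$: given that action $y_n=\ell\in\{1,2\}$ is applied, $\xi_n$ is normal with mean $m_\ell$ and variance $1$, independently of the past. Strategies $\sigma$ may be randomized and use the whole history of actions and incomes, but they apply each chosen action to a whole packet of $M$ data (actions are chosen at the times $n=0,M,2M,\dots$). The loss is $L_N(\sigma,\theta)=N(m_1\vee m_2)-\mathbb E_{\sigma,\theta}\sum_{n=1}^N\xi_n$. Let $0<C<\infty$ and $\Theta=\{\theta:|m_1-m_2|\le 2C\}$. For a density $\lambda$ on $\Theta$ let $R^B_N(\lambda)=\inf_\sigma\int_\Theta L_N(\sigma,\theta)\lambda(\theta)\,d\theta$, and let $R^{B,(\ell)}_N(\lambda)$ be the same infimum over the strategies that apply action $\ell$ to the first packet. Let $\lambda(\cdot\mid X_1,n_1,X_2,n_2)$ be the posterior density after $n_1,n_2$ applications of the two actions with total incomes $X_1,X_2$. Write $m_1=m+v$, $m_2=m-v$. Let $\rho$ be a probability density on $|v|\le C$ with $\rho(-v)=\rho(v)$,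 let $\kappa_a$ be the uniform density on $|m|\le a$, and let $\nu_a(m,v)=\kappa_a(m)\rho(v)$ be the prior density in the coordinates $(m,v)$. Let $f_D(x)=(2\pi D)^{-1/2}e^{-x^2/(2D)}$, $n=n_1+n_2$, $U=(X_1n_2-X_2n_1)/n$, and define $$R_M(U,n_1,n_2)=\min_{\ell=1,2}R_M^{(\ell)}(U,n_1,n_2),$$ where $R_M^{(1)}=R_M^{(2)}=0$ if $n_1+n_2=N$ and, if $n_1+n_2<N$, $$R^{(1)}_M(U,n_1,n_2)=Mg^{(1)}(U,n_1,n_2)+\int_{-\infty}^\infty R_M(U-x,n_1+M,n_2)\,f_{Mn_2^2n^{-1}(n+M)^{-1}}(x)\,dx,$$ $$R^{(2)}_M(U,n_1,n_2)=Mg^{(2)}(U,n_1,n_2)+\int_{-\infty}^\infty R_M(U-x,n_1,n_2+M)\,f_{Mn_1^2n^{-1}(n+M)^{-1}}(x)\,dx,$$ $$g^{(\ell)}(U,n_1,n_2)=\int_0^C 2v\exp\bigl((-1)^\ell 2Uv-2v^2n_1n_2n^{-1}\bigr)\rho(v)\,dv .$$ **Theorem 1.** All the integrals above and below converge, and the following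 holds. 1. (Risk.) $$\lim_{a\to\infty}R^B_N(\nu_a)=4M\int_0^C v\rho(v)\,dv+\int_{-\infty}^\infty R_M(U,M,M)\,f_{0.5M}(U)\,dU .$$ 2. (Strategy.) There are strategies that apply the two actions turn-by-turn to the first two packets (one of them, chosen arbitrarily, to the first packet, and the other one to the second) and afterwards, in the state $(U,n_1,n_2)$, always choose an action with the smallest value of $R_M^{(\ell)}(U,n_1,n_2)$, $\ell=1,2$. Every such strategy $\sigma$ is asymptotically Bayesian: as $a\to\infty$ its expected loss with respect to $\nu_a$ tends to the limit in part 1. 3. (Initial stage, $n\le 2M$.) For the first packet both actions are optimal: $R^{B,(\ell)}_N(\nu_a)=R^B_N(\nu_a)$ for all $a>0$ and $\ell=1,2$. After one packet, processed with action $\ell$ and with any total income $X$, applying the other action next is asymptotically optimal: the Bayesian risk of the remaining $N-M$ steps for the posterior of $\nu_a$, with optimal control and with the other action applied next, have as $a\to\infty$ the same limit $2M\int_0^C v\rho(v)\,dv+\int_{-\infty}^\infty R_M(U,M,M)f_{0.5M}(U)\,dU$. 4. (Later stage.) Let $n_1,n_2\ge M$ be multiples of $M$ with $n=n_1+n_2<N$,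 let $X_1,X_2\in\mathbb R$ and $w=\int_{-C}^{C}\exp(2Uv-2v^2n_1n_2n^{-1})\rho(v)\,dv$. Then $w>0$ and, as $a\to\infty$, $R^{B}_{N-n}(\nu_a(\cdot\mid X_1,n_1,X_2,n_2))\to R_M(U,n_1,n_2)/w$ and $R^{B,(\ell)}_{N-n}(\nu_a(\cdot\mid X_1,n_1,X_2,n_2))\to R_M^{(\ell)}(U,n_1,n_2)/w$ for $\ell=1,2$. In particular, action $\ell$ is currently (asymptotically) optimal if and only if $R_M^{(\ell)}(U,n_1,n_2)$ is the smaller (or equal) of the two values. -/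

import Mathlib

open MeasureTheory ProbabilityTheory Filter Topology
open scoped NNReal

namespace BatchBandit

noncomputable section

/-- A history of `k` packets of size `M`: for every packet, the applied action (`0` is the first
action, `1` the second one) and the `M` incomes obtained in this packet. -/
abbrev Hist (M k : ℕ) : Type := Fin k → Fin 2 × (Fin M → ℝ)

/-- The history prolonged by one packet. -/
def Hist.snoc {M k : ℕ} (p : Hist M k × (Fin 2 × (Fin M → ℝ))) : Hist M (k + 1) :=
  Fin.snoc (α := fun _ => Fin 2 × (Fin M → ℝ)) p.1 p.2

/-- The expected one-step income `m_ℓ` of action `ℓ`, for the parameter `θ = (m₁, m₂)`. -/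
def mean (θ : ℝ × ℝ) (ℓ : Fin 2) : ℝ := if ℓ = 0 then θ.1 else θ.2

/-- The incomes of one packet: `M` independent normal incomes with mean `m_ℓ` and variance `1`. -/
def packetKernel (M : ℕ) (θ : ℝ × ℝ) : Kernel (Fin 2) (Fin M → ℝ) where
  toFun ℓ := Measure.pi fun _ => gaussianReal (mean θ ℓ) 1
  measurable' := measurable_of_countable _

/-- A (randomized, history-dependent) strategy which applies each chosen action to a whole packet
of `M` data: `policy k h` is the law of the action for packet number `k + 1`, given the history `h`
of the first `k` packets. -/
structure Strategy (M : ℕ) where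
  policy : (k : ℕ) → Kernel (Hist M k) (Fin 2)
  markov : ∀ k, IsMarkovKernel (policy k)

/-- The law of the history of the first `k` packets under the strategy `σ` and parameter `θ`. -/
def Strategy.law {M : ℕ} (σ : Strategy M) (θ : ℝ × ℝ) : (k : ℕ) → Measure (Hist M k)
  | 0 => Measure.dirac Fin.elim0
  | k + 1 => (σ.law θ k ⊗ₘ
      (σ.policy k ⊗ₖ Kernel.prodMkLeft (Hist M k) (packetKernel M θ))).map Hist.snoc

/-- The loss function with horizon `N = K M`:
`L_N(σ, θ) = N (m₁ ∨ m₂) - E_{σ,θ} (ξ₁ + ⋯ + ξ_N)`. -/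
def loss {M : ℕ} (K : ℕ) (σ : Strategy M) (θ : ℝ × ℝ) : ℝ :=
  ((K * M : ℕ) : ℝ) * max θ.1 θ.2 - ∫ h, ∑ j, ∑ i, (h j).2 i ∂(σ.law θ K)

/-- The set of parameters `|m₁ - m₂| ≤ 2 C`. -/
def paramSet (C : ℝ) : Set (ℝ × ℝ) := {θ | |θ.1 - θ.2| ≤ 2 * C}

/-- The loss of the strategy `σ` averaged over the prior density `lam` on the parameter set. -/
def avgLoss {M : ℕ} (K : ℕ) (C : ℝ) (σ : Strategy M) (lam : ℝ × ℝ → ℝ) : ℝ :=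
  ∫ θ in paramSet C, loss K σ θ * lam θ

/-- The Bayesian risk, with horizon `K M`, for the prior density `lam`. -/
def bayesRisk (M K : ℕ) (C : ℝ) (lam : ℝ × ℝ → ℝ) : ℝ :=
  ⨅ σ : Strategy M, avgLoss K C σ lam

/-- The Bayesian risk, with horizon `K M`, when the first packet is processed with action `ℓ`
(and the control is optimal afterwards). -/
def bayesRiskAction (M K : ℕ) (C : ℝ) (lam : ℝ × ℝ → ℝ) (ℓ : Fin 2) : ℝ :=
  ⨅ σ : {σ : Strategy M // ∀ h, σ.policy 0 h = Measure.dirac ℓ}, avgLoss K C σ.1 lam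

/-- `ρ` is a symmetric probability density on the interval `|v| ≤ C`. -/
structure IsSymmDensity (C : ℝ) (ρ : ℝ → ℝ) : Prop where
  measurable : Measurable ρ
  nonneg : ∀ v, 0 ≤ ρ v
  symm : ∀ v, ρ (-v) = ρ v
  eq_zero : ∀ v, C < |v| → ρ v = 0
  integral_eq_one : ∫ v, ρ v = 1

/-- The prior density `ν_a(m, v) = κ_a(m) ρ(v)`, where `κ_a` is the uniform density on
`|m| ≤ a`. -/
def nu (ρ : ℝ → ℝ) (a m v : ℝ) : ℝ :=
  (Set.Icc (-a) a).indicator (fun _ => (2 * a)⁻¹) m * ρ v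

/-- The density `ν_a` rewritten as a density in `(m₁, m₂) = (m + v, m - v)`; the Jacobian is `2`,
so that `ν_a(m, v) = 2 λ(m + v, m - v)`. -/
def prior (ρ : ℝ → ℝ) (a : ℝ) (θ : ℝ × ℝ) : ℝ :=
  nu ρ a ((θ.1 + θ.2) / 2) ((θ.1 - θ.2) / 2) / 2

/-- The density `f_n(X | n m)` of the total income `X` of `n` applications of an action with
mean `m`; it is `1` for `n = 0`. -/
def likelihood (n : ℕ) (X m : ℝ) : ℝ := if n = 0 then 1 else gaussianPDFReal (n * m) n X

/-- The posterior density of `θ` after `n₁`, `n₂` applications of the two actions with total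
incomes `X₁`, `X₂`. -/
def posterior (C : ℝ) (lam : ℝ × ℝ → ℝ) (X₁ : ℝ) (n₁ : ℕ) (X₂ : ℝ) (n₂ : ℕ) (θ : ℝ × ℝ) : ℝ :=
  likelihood n₁ X₁ θ.1 * likelihood n₂ X₂ θ.2 * lam θ /
    ∫ η in paramSet C, likelihood n₁ X₁ η.1 * likelihood n₂ X₂ η.2 * lam η

/-- The functions `g^{(1)}` (for `ℓ = 0`) and `g^{(2)}` (for `ℓ = 1`). -/
def g (C : ℝ) (ρ : ℝ → ℝ) (ℓ : Fin 2) (U : ℝ) (n₁ n₂ : ℕ) : ℝ :=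
  ∫ v in (0 : ℝ)..C, 2 * v *
    Real.exp ((-1) ^ ((ℓ : ℕ) + 1) * 2 * U * v - 2 * v ^ 2 * n₁ * n₂ / (n₁ + n₂)) * ρ v

/-- The variance `M n_o² n⁻¹ (n + M)⁻¹`, `n = n₁ + n₂`, in the recursive equation; `n_o` is the
number of applications of the action that is not chosen now. -/
def stepVar (M n n_o : ℕ) : ℝ≥0 := (M : ℝ≥0) * (n_o : ℝ≥0) ^ 2 / ((n : ℝ≥0) * (n + M : ℝ≥0))

/-- The solution `R_M(U, n₁, n₂)` of the recursive Bellman-type equation with horizon `N`. -/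
def R (M N : ℕ) (C : ℝ) (ρ : ℝ → ℝ) (U : ℝ) (n₁ n₂ : ℕ) : ℝ :=
  if _h : n₁ + n₂ < N ∧ 0 < M then
    min
      (M * g C ρ 0 U n₁ n₂ + ∫ x, R M N C ρ (U - x) (n₁ + M) n₂ *
        gaussianPDFReal 0 (stepVar M (n₁ + n₂) n₂) x)
      (M * g C ρ 1 U n₁ n₂ + ∫ x, R M N C ρ (U - x) n₁ (n₂ + M) *
        gaussianPDFReal 0 (stepVar M (n₁ + n₂) n₁) x)
  else 0
termination_by N - (n₁ + n₂)
decreasing_by all_goals omega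

/-- The functions `R_M^{(1)}` (for `ℓ = 0`) and `R_M^{(2)}` (for `ℓ = 1`). -/
def RAction (M N : ℕ) (C : ℝ) (ρ : ℝ → ℝ) (ℓ : Fin 2) (U : ℝ) (n₁ n₂ : ℕ) : ℝ :=
  if n₁ + n₂ < N then
    M * g C ρ ℓ U n₁ n₂ +
      if ℓ = 0 then
        ∫ x, R M N C ρ (U - x) (n₁ + M) n₂ * gaussianPDFReal 0 (stepVar M (n₁ + n₂) n₂) x
      else
        ∫ x, R M N C ρ (U - x) n₁ (n₂ + M) * gaussianPDFReal 0 (stepVar M (n₁ + n₂) n₁) x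
  else 0

/-- The Bellman-type equation `R_M = min (R_M^{(1)}, R_M^{(2)})`. -/
theorem R_eq_min {M : ℕ} (hM : 0 < M) (N : ℕ) (C : ℝ) (ρ : ℝ → ℝ) (U : ℝ) (n₁ n₂ : ℕ) :
    R M N C ρ U n₁ n₂ = min (RAction M N C ρ 0 U n₁ n₂) (RAction M N C ρ 1 U n₁ n₂) := by
  rw [R]
  by_cases h : n₁ + n₂ < N <;> simp [RAction, h, hM]

/-- The statistic `U = (X₁ n₂ - X₂ n₁) / n`. -/
def stat (X₁ : ℝ) (n₁ : ℕ) (X₂ : ℝ) (n₂ : ℕ) : ℝ := (X₁ * n₂ - X₂ * n₁) / (n₁ + n₂)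

/-- The number `n_ℓ` of data processed with action `ℓ` in the history `h`. -/
def Hist.count {M k : ℕ} (h : Hist M k) (ℓ : Fin 2) : ℕ := ∑ j, if (h j).1 = ℓ then M else 0

/-- The total income `X_ℓ` of action `ℓ` in the history `h`. -/
def Hist.income {M k : ℕ} (h : Hist M k) (ℓ : Fin 2) : ℝ :=
  ∑ j, if (h j).1 = ℓ then ∑ i, (h j).2 i else 0

/-- The statistic `U` of the history `h`. -/
def Hist.stat {M k : ℕ} (h : Hist M k) : ℝ :=
  BatchBandit.stat (h.income 0) (h.count 0) (h.income 1) (h.count 1)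

/-- The strategy applies the two actions turn-by-turn in the first two packets (in either order),
and then, as long as there are data, only actions `ℓ` for which `R_M^{(ℓ)}(U, n₁, n₂)` is
smallest (with an arbitrary choice if the two values are equal). -/
structure IsBellmanStrategy {M : ℕ} (K : ℕ) (C : ℝ) (ρ : ℝ → ℝ) (σ : Strategy M) : Prop where
  turn_by_turn : ∀ h : Hist M 1, σ.policy 1 h = Measure.dirac (1 - (h 0).1)
  smallest : ∀ k, 2 ≤ k → k < K → ∀ h : Hist M k, 0 < h.count 0 → 0 < h.count 1 → ∀ ℓ : Fin 2,
    RAction M (K * M) C ρ (1 - ℓ) h.stat (h.count 0) (h.count 1) <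
      RAction M (K * M) C ρ ℓ h.stat (h.count 0) (h.count 1) → σ.policy k h {ℓ} = 0

/-- The posterior normalization at the statistic `U` for the prior that is uniform in `m`, relative
to its value for `v = 0`. -/
def weight (C : ℝ) (ρ : ℝ → ℝ) (U : ℝ) (n₁ n₂ : ℕ) : ℝ :=
  ∫ v in (-C)..C, Real.exp (2 * U * v - 2 * v ^ 2 * n₁ * n₂ / (n₁ + n₂)) * ρ v

end

end BatchBandit

/-!
The Bayesian problem is turned into a dynamic program in which `θ` does not occur. All laws of the
histories are written as densities `lik θ` relative to the law for `θ = 0`, under which the incomes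
are centered normal variables. These densities only depend on the `State`, i.e. on the numbers of
applications of the two actions and on their total incomes. Averaging the regrets over a prior
density gives, for every state, the `cost` of each action, and the averaged loss of a strategy is
its `costToGo` (`lintegral_loss`). The Bayesian risks are therefore the optimal values `value` and
`actionValue` of this program (`bayesRisk_eq`, `bayesRiskAction_eq`). Passing to a posterior density
only moves the initial state and divides by the posterior mass (`bayesRisk_posterior`).

All costs are taken in `ℝ≥0∞`, so that the program also makes sense for the improper flat prior
`boxDensity ρ Set.univ`, uniform over all `m ∈ ℝ`. For this prior the integration over `m` can be
carried out: in every nonempty state the mass and the costs are `flatMass` times `weight` and `g`,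
at the statistic `U`. Weighted by `flatMass`, the statistic `U` performs a random walk with normal
increments, and the dynamic program becomes the recursive equation (`value_flat`,
`actionValue_flat`). After the first packet `U = 0` and both actions have equal expected regrets as
long as only one action has been applied. Since expected regrets are martingales, the order of two
successive packets does not matter, so that nothing is lost by switching the action at once
(`actionValue_le_of_last`, `value_flat_second`).

The prior `ν_a` is `(2 a)⁻¹` times the flat prior truncated to `|m| ≤ a`. After at least one packet
the truncated costs increase to the flat ones, by dominated convergence
(`tendsto_actionValue_box`), which gives the limits for the posterior. The initial stage is
different, as the flat prior has infinite mass there. By the symmetry of `ρ` the first action is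
arbitrary (`actionValue_prior_eq`). The total income `y` of the first packet is almost uniformly
distributed on `|y| ≤ M a`, and for most such `y` the box looks infinite: by translation in `m`, the
truncated problem after the income `y` dominates the problem after the income `0` for a narrower
box (`value_box_step_ge`), so that the average over `y` is asymptotically at least the flat value
(`exists_lower_bound`). Conversely, a strategy that obeys the rule of the recursive equation is
optimal for the flat prior from the second packet on (`costToGo_flat_second`), and its cost for the
truncated prior is not larger; only the incomes with `|y| > M a` have to be bounded separately, and
their probability tends to zero (`tendsto_tailMass`).
-/

open scoped ENNReal

namespace BatchBandit

/-! ### Changing the mean of a normal law -/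

lemma gaussianReal_eq_withDensity (m : ℝ) {v : ℝ≥0} (hv : v ≠ 0) :
    gaussianReal (v * m) v = (gaussianReal 0 v).withDensity
      (fun x => ENNReal.ofReal (Real.exp (m * x - v * m ^ 2 / 2))) := by
  rw [gaussianReal_of_var_ne_zero _ hv, gaussianReal_of_var_ne_zero _ hv,
    ← withDensity_mul _ (measurable_gaussianPDF _ _) (by fun_prop)]
  congr 1
  ext x
  have hv' : (v : ℝ) ≠ 0 := by exact_mod_cast hv
  simp only [Pi.mul_apply, gaussianPDF, gaussianPDFReal]
  rw [← ENNReal.ofReal_mul (by positivity), mul_assoc (√_)⁻¹ (Real.exp _) (Real.exp _),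
    ← Real.exp_add]
  congr 3
  field_simp
  ring

/-- Changing the mean of a normal law amounts to an exponential density. -/
lemma lintegral_exp_gaussianReal (m : ℝ) {v : ℝ≥0} (hv : v ≠ 0) {F : ℝ → ℝ≥0∞}
    (hF : Measurable F) :
    ∫⁻ x, ENNReal.ofReal (Real.exp (m * x - v * m ^ 2 / 2)) * F x ∂gaussianReal 0 v =
      ∫⁻ x, F (x + v * m) ∂gaussianReal 0 v := by
  rw [← lintegral_map (f := F) (g := fun x => x + v * m) hF (by fun_prop),
    gaussianReal_map_add_const, zero_add, gaussianReal_eq_withDensity m hv,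
    lintegral_withDensity_eq_lintegral_mul _ (by fun_prop) hF]
  rfl

lemma lintegral_pi_prod {ι : Type*} [Fintype ι] {X : Type*} [MeasurableSpace X]
    (μ : ι → Measure X) [∀ i, IsProbabilityMeasure (μ i)] {f : ι → X → ℝ≥0∞}
    (hf : ∀ i, Measurable (f i)) :
    ∫⁻ x, ∏ i, f i (x i) ∂Measure.pi μ = ∏ i, ∫⁻ x, f i x ∂μ i := by
  have hind : iIndepFun (fun i (x : ι → X) => f i (x i)) (Measure.pi μ) :=
    iIndepFun_pi (X := f) fun i => (hf i).aemeasurable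
  rw [lintegral_prod_eq_prod_lintegral_of_indepFun Finset.univ _ hind
    (fun i => (hf i).comp (measurable_pi_apply i))]
  refine Finset.prod_congr rfl fun i _ => ?_
  rw [← (measurePreserving_eval μ i).map_eq, lintegral_map (hf i) (measurable_pi_apply i)]

/-- The law of one packet relative to its law for incomes of mean zero. -/
lemma pi_gaussianReal_eq_withDensity (M : ℕ) (m : ℝ) :
    Measure.pi (fun _ : Fin M => gaussianReal m 1) =
      (Measure.pi fun _ : Fin M => gaussianReal 0 1).withDensity
        (fun x => ENNReal.ofReal (Real.exp (m * ∑ i, x i - M * m ^ 2 / 2))) := by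
  refine Measure.pi_eq fun s hs => ?_
  rw [withDensity_apply _ (MeasurableSet.univ_pi hs),
    ← lintegral_indicator (MeasurableSet.univ_pi hs)]
  have h1 : ∀ i, gaussianReal m 1 (s i) = ∫⁻ x, (s i).indicator
      (fun x => ENNReal.ofReal (Real.exp (m * x - m ^ 2 / 2))) x ∂gaussianReal 0 1 := by
    intro i
    have := gaussianReal_eq_withDensity m (one_ne_zero (α := ℝ≥0))
    simp only [NNReal.coe_one, one_mul] at this
    rw [lintegral_indicator (hs i), ← withDensity_apply _ (hs i), this]
  simp_rw [h1]
  rw [← lintegral_pi_prod (fun _ : Fin M => gaussianReal 0 1)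
    (f := fun i => (s i).indicator (fun x => ENNReal.ofReal (Real.exp (m * x - m ^ 2 / 2))))
    (fun i => Measurable.indicator (by fun_prop) (hs i))]
  refine lintegral_congr fun x => ?_
  by_cases hx : x ∈ Set.univ.pi s
  · rw [Set.indicator_of_mem hx]
    have : ∀ i, (s i).indicator (fun x => ENNReal.ofReal (Real.exp (m * x - m ^ 2 / 2))) (x i) =
        ENNReal.ofReal (Real.exp (m * x i - m ^ 2 / 2)) := fun i =>
      Set.indicator_of_mem (hx i trivial) _
    simp_rw [this]
    rw [← ENNReal.ofReal_prod_of_nonneg (fun _ _ => by positivity), ← Real.exp_sum]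
    congr 2
    rw [Finset.sum_sub_distrib, Finset.mul_sum]
    simp
    ring
  · rw [Set.indicator_of_notMem hx]
    simp only [Set.mem_pi, not_forall] at hx
    obtain ⟨i, -, hi⟩ := hx
    exact (Finset.prod_eq_zero (Finset.mem_univ i) (Set.indicator_of_notMem hi _)).symm

lemma pi_gaussianReal_map_sum (M : ℕ) :
    (Measure.pi fun _ : Fin M => gaussianReal 0 1).map (fun x => ∑ i, x i) =
      gaussianReal 0 M := by
  have : IsProbabilityMeasure ((Measure.pi fun _ : Fin M => gaussianReal 0 1).map
      (fun x => ∑ i, x i)) := Measure.isProbabilityMeasure_map (by fun_prop)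
  refine Measure.ext_of_charFun (funext fun t => ?_)
  rw [charFun_apply_real, integral_map (by fun_prop) (by fun_prop)]
  have h : ∀ x : Fin M → ℝ, Complex.exp (t * ((∑ i, x i : ℝ) : ℂ) * Complex.I) =
      ∏ i, Complex.exp (t * (x i : ℂ) * Complex.I) := by
    intro x
    rw [← Complex.exp_sum]
    push_cast
    rw [Finset.mul_sum, Finset.sum_mul]
  simp_rw [h]
  rw [integral_fintype_prod_eq_prod (μ := fun _ : Fin M => gaussianReal 0 1)
    (fun (_ : Fin M) (x : ℝ) => Complex.exp (t * (x : ℂ) * Complex.I))]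
  simp_rw [← charFun_apply_real, charFun_gaussianReal]
  rw [Finset.prod_const, ← Complex.exp_nat_mul]
  simp
  ring_nf

/-! ### States and the likelihood of a history -/

/-- The numbers of applications of the two actions, and their total incomes. -/
abbrev State : Type := (Fin 2 → ℕ) × (Fin 2 → ℝ)

/-- The state after one more packet of size `M`, processed with action `ℓ`, with total income
`x`. -/
def State.step (M : ℕ) (ℓ : Fin 2) (x : ℝ) (s : State) : State :=
  (s.1 + Pi.single ℓ M, s.2 + Pi.single ℓ x)

/-- The state reached by a history. -/
def Hist.state {M k : ℕ} (h : Hist M k) : State := (h.count, h.income)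

/-- The loss per income caused by action `ℓ`. -/
def regret (θ : ℝ × ℝ) (ℓ : Fin 2) : ℝ := max θ.1 θ.2 - mean θ ℓ

/-- The density, at any history with state `s`, of the law of the history for the parameter `θ`
relative to the parameter `0`. -/
noncomputable def lik (θ : ℝ × ℝ) (s : State) : ℝ :=
  Real.exp (∑ ℓ, (mean θ ℓ * s.2 ℓ - s.1 ℓ * mean θ ℓ ^ 2 / 2))

lemma regret_nonneg (θ : ℝ × ℝ) (ℓ : Fin 2) : 0 ≤ regret θ ℓ := by
  unfold regret mean
  split_ifs <;> simp

lemma lik_pos (θ : ℝ × ℝ) (s : State) : 0 < lik θ s := Real.exp_pos _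

@[simp] lemma lik_zero (θ : ℝ × ℝ) : lik θ 0 = 1 := by simp [lik]

lemma lik_step (θ : ℝ × ℝ) (s : State) (M : ℕ) (ℓ : Fin 2) (x : ℝ) :
    lik θ (s.step M ℓ x) = lik θ s * Real.exp (mean θ ℓ * x - M * mean θ ℓ ^ 2 / 2) := by
  rw [lik, lik, ← Real.exp_add]
  congr 1
  fin_cases ℓ <;> simp [State.step, Fin.sum_univ_two] <;> ring

lemma lik_add (θ : ℝ × ℝ) (s t : State) : lik θ (s + t) = lik θ s * lik θ t := by
  rw [lik, lik, lik, ← Real.exp_add, ← Finset.sum_add_distrib]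
  congr 1
  refine Finset.sum_congr rfl fun ℓ _ => ?_
  simp only [Prod.fst_add, Prod.snd_add, Pi.add_apply, Nat.cast_add]
  ring

@[fun_prop] lemma measurable_mean (ℓ : Fin 2) : Measurable fun θ => mean θ ℓ := by
  unfold mean
  split_ifs <;> fun_prop

@[fun_prop] lemma measurable_regret (ℓ : Fin 2) : Measurable fun θ => regret θ ℓ := by
  unfold regret
  fun_prop

@[fun_prop] lemma measurable_lik : Measurable fun p : (ℝ × ℝ) × State => lik p.1 p.2 := by
  unfold lik
  refine Real.measurable_exp.comp (Finset.measurable_sum _ fun ℓ _ => ?_)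
  have h1 : Measurable fun p : (ℝ × ℝ) × State => mean p.1 ℓ :=
    (measurable_mean ℓ).comp measurable_fst
  have h2 : Measurable fun p : (ℝ × ℝ) × State => ((p.2.1 ℓ : ℕ) : ℝ) :=
    (measurable_from_nat (f := fun n : ℕ => (n : ℝ))).comp
      ((measurable_pi_apply ℓ).comp (measurable_fst.comp measurable_snd))
  fun_prop

@[fun_prop] lemma measurable_lik_left (s : State) : Measurable fun θ => lik θ s :=
  Measurable.of_uncurry_right (f := lik) measurable_lik

@[fun_prop] lemma measurable_lik_right (θ : ℝ × ℝ) : Measurable fun s => lik θ s :=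
  Measurable.of_uncurry_left (f := lik) measurable_lik

@[fun_prop] lemma measurable_step (M : ℕ) (ℓ : Fin 2) :
    Measurable fun p : State × ℝ => p.1.step M ℓ p.2 := by
  have h1 : Measurable fun p : State × ℝ => p.1.1 + (Pi.single ℓ M : Fin 2 → ℕ) := by fun_prop
  have h2 : Measurable fun p : State × ℝ => p.1.2 + (Pi.single ℓ p.2 : Fin 2 → ℝ) := by
    refine measurable_pi_lambda _ fun i => ?_
    simp only [Pi.add_apply, Pi.single_apply]
    split_ifs <;> fun_prop
  exact h1.prodMk h2

lemma count_snoc {M k : ℕ} (h : Hist M k) (ℓ : Fin 2) (x : Fin M → ℝ) :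
    (Hist.snoc (h, (ℓ, x))).count = h.count + Pi.single ℓ M := by
  ext i
  simp [Hist.count, Hist.snoc, Fin.sum_univ_castSucc, Pi.single_apply, eq_comm]

lemma income_snoc {M k : ℕ} (h : Hist M k) (ℓ : Fin 2) (x : Fin M → ℝ) :
    (Hist.snoc (h, (ℓ, x))).income = h.income + Pi.single ℓ (∑ i, x i) := by
  ext i
  simp [Hist.income, Hist.snoc, Fin.sum_univ_castSucc, Pi.single_apply, eq_comm]

lemma state_snoc {M k : ℕ} (h : Hist M k) (ℓ : Fin 2) (x : Fin M → ℝ) :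
    (Hist.snoc (h, (ℓ, x))).state = h.state.step M ℓ (∑ i, x i) := by
  simp [Hist.state, State.step, count_snoc, income_snoc]

lemma state_of_isEmpty {M : ℕ} (h : Hist M 0) : h.state = 0 := by
  ext i <;> simp [Hist.state, Hist.count, Hist.income]

lemma measurable_snoc (M k : ℕ) : Measurable (Hist.snoc (M := M) (k := k)) := by
  unfold Hist.snoc
  refine measurable_pi_lambda _ fun i => ?_
  refine Fin.lastCases ?_ (fun j => ?_) i
  · simp only [Fin.snoc_last]; fun_prop
  · simp only [Fin.snoc_castSucc]; fun_prop

lemma measurable_fin_two_prod {α β : Type*} [MeasurableSpace α] [MeasurableSpace β]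
    {f : Fin 2 × α → β} (hf : ∀ ℓ, Measurable fun a => f (ℓ, a)) : Measurable f :=
  measurable_from_prod_countable_right hf

lemma measurable_state (M k : ℕ) : Measurable (Hist.state (M := M) (k := k)) := by
  have hset : ∀ (j : Fin k) (ℓ : Fin 2), MeasurableSet {h : Hist M k | (h j).1 = ℓ} := by
    intro j ℓ
    exact (measurable_fst.comp (measurable_pi_apply j)) (measurableSet_singleton ℓ)
  have h1 : Measurable (Hist.count (M := M) (k := k)) := by
    refine measurable_pi_lambda _ fun ℓ => Finset.measurable_sum _ fun j _ => ?_
    exact Measurable.ite (hset j ℓ) measurable_const measurable_const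
  have h2 : Measurable (Hist.income (M := M) (k := k)) := by
    refine measurable_pi_lambda _ fun ℓ => Finset.measurable_sum _ fun j _ => ?_
    exact Measurable.ite (hset j ℓ) (by fun_prop) measurable_const
  exact h1.prodMk h2

instance (M : ℕ) (θ : ℝ × ℝ) : IsMarkovKernel (packetKernel M θ) :=
  ⟨fun ℓ => by change IsProbabilityMeasure (Measure.pi fun _ => gaussianReal (mean θ ℓ) 1)
               infer_instance⟩

instance {M : ℕ} (σ : Strategy M) (k : ℕ) : IsMarkovKernel (σ.policy k) := σ.markov k

instance {M : ℕ} (σ : Strategy M) (θ : ℝ × ℝ) (k : ℕ) : IsProbabilityMeasure (σ.law θ k) := by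
  induction k with
  | zero => rw [Strategy.law]; infer_instance
  | succ k ih =>
    rw [Strategy.law]
    exact Measure.isProbabilityMeasure_map (measurable_snoc M k).aemeasurable

/-- One step of the expectation with respect to the law of the history. -/
lemma lintegral_law_succ {M : ℕ} (σ : Strategy M) (θ : ℝ × ℝ) (k : ℕ) {F : Hist M (k + 1) → ℝ≥0∞}
    (hF : Measurable F) :
    ∫⁻ h, F h ∂σ.law θ (k + 1) = ∫⁻ h, ∑ ℓ, σ.policy k h {ℓ} *
      ∫⁻ x, F (Hist.snoc (h, (ℓ, x))) ∂packetKernel M θ ℓ ∂σ.law θ k := by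
  have hF' : Measurable fun p => F (Hist.snoc p) := hF.comp (measurable_snoc M k)
  rw [Strategy.law, lintegral_map hF (measurable_snoc M k), Measure.lintegral_compProd hF']
  refine lintegral_congr fun h => ?_
  rw [Kernel.lintegral_compProd _ _ _ (f := fun b => F (Hist.snoc (h, b)))
    (hF'.comp measurable_prodMk_left), lintegral_fintype]
  refine Finset.sum_congr rfl fun ℓ _ => ?_
  rw [mul_comm]
  rfl

lemma lintegral_law_zero {M : ℕ} (σ : Strategy M) (θ : ℝ × ℝ) (F : Hist M 0 → ℝ≥0∞) :
    ∫⁻ h, F h ∂σ.law θ 0 = F Fin.elim0 := by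
  rw [Strategy.law, lintegral_dirac]

lemma measurable_policy {M : ℕ} (σ : Strategy M) (k : ℕ) (ℓ : Fin 2) :
    Measurable fun h => σ.policy k h {ℓ} :=
  Kernel.measurable_coe _ (measurableSet_singleton ℓ)

lemma sum_policy {M : ℕ} (σ : Strategy M) (k : ℕ) (h : Hist M k) :
    ∑ ℓ, σ.policy k h {ℓ} = 1 := by
  simp

lemma lintegral_packetKernel (M : ℕ) (θ : ℝ × ℝ) (ℓ : Fin 2) {F : (Fin M → ℝ) → ℝ≥0∞}
    (hF : Measurable F) :
    ∫⁻ x, F x ∂packetKernel M θ ℓ = ∫⁻ x,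
      ENNReal.ofReal (Real.exp (mean θ ℓ * ∑ i, x i - M * mean θ ℓ ^ 2 / 2)) * F x
        ∂packetKernel M 0 ℓ := by
  change ∫⁻ x, F x ∂Measure.pi (fun _ => gaussianReal (mean θ ℓ) 1) =
    ∫⁻ x, _ ∂Measure.pi (fun _ => gaussianReal (mean 0 ℓ) 1)
  have h0 : mean 0 ℓ = 0 := by simp [mean]
  rw [pi_gaussianReal_eq_withDensity, h0,
    lintegral_withDensity_eq_lintegral_mul _ (by fun_prop) hF]
  rfl

lemma lintegral_packetKernel_zero (M : ℕ) (ℓ : Fin 2) {F : ℝ → ℝ≥0∞} (hF : Measurable F) :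
    ∫⁻ x, F (∑ i, x i) ∂packetKernel M 0 ℓ = ∫⁻ y, F y ∂gaussianReal 0 M := by
  rw [← pi_gaussianReal_map_sum, lintegral_map hF (by fun_prop)]
  have h0 : mean 0 ℓ = 0 := by simp [mean]
  change ∫⁻ x, _ ∂Measure.pi (fun _ => gaussianReal (mean 0 ℓ) 1) = _
  rw [h0]

lemma measurable_lintegral_packetKernel {α : Type*} [MeasurableSpace α] (M : ℕ) (θ : ℝ × ℝ)
    (ℓ : Fin 2) {F : α → (Fin M → ℝ) → ℝ≥0∞} (hF : Measurable fun p : α × _ => F p.1 p.2) :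
    Measurable fun a => ∫⁻ x, F a x ∂packetKernel M θ ℓ :=
  Measurable.lintegral_prod_right' (f := fun p : α × _ => F p.1 p.2) hF

/-- The law of the history for the parameter `θ` has density `lik θ` relative to its law for the
parameter `0`. -/
lemma lintegral_law {M : ℕ} (σ : Strategy M) (θ : ℝ × ℝ) (k : ℕ) {F : Hist M k → ℝ≥0∞}
    (hF : Measurable F) :
    ∫⁻ h, F h ∂σ.law θ k = ∫⁻ h, ENNReal.ofReal (lik θ h.state) * F h ∂σ.law 0 k := by
  have hlik : ∀ k, Measurable fun h : Hist M k => ENNReal.ofReal (lik θ h.state) := by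
    intro k
    exact ((measurable_lik_right θ).comp (measurable_state M k)).ennreal_ofReal
  induction k with
  | zero => simp [lintegral_law_zero, state_of_isEmpty]
  | succ k ih =>
    have hs : ∀ ℓ : Fin 2, Measurable fun p : Hist M k × (Fin M → ℝ) =>
        F (Hist.snoc (p.1, (ℓ, p.2))) := fun ℓ =>
      hF.comp ((measurable_snoc M k).comp (by fun_prop))
    rw [lintegral_law_succ _ _ _ hF, lintegral_law_succ _ _ _
      (F := fun h => ENNReal.ofReal (lik θ h.state) * F h) ((hlik _).mul hF), ih]
    · refine lintegral_congr fun h => ?_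
      rw [Finset.mul_sum]
      refine Finset.sum_congr rfl fun ℓ _ => ?_
      rw [lintegral_packetKernel _ _ _ (F := fun x => F (Hist.snoc (h, (ℓ, x))))
        ((hs ℓ).comp measurable_prodMk_left), mul_left_comm,
        ← lintegral_const_mul' _ _ ENNReal.ofReal_ne_top]
      refine congrArg _ (lintegral_congr fun x => ?_)
      rw [state_snoc, lik_step, ENNReal.ofReal_mul (lik_pos _ _).le, mul_assoc]
    · exact Finset.measurable_sum _ fun ℓ _ => (measurable_policy σ k ℓ).mul
        (measurable_lintegral_packetKernel M θ ℓ (hs ℓ))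

/-! ### The averaged loss as a cost-to-go -/

/-- The centered total income of a packet. -/
noncomputable def packetNoise (M : ℕ) (θ : ℝ × ℝ) (p : Fin 2 × (Fin M → ℝ)) : ℝ :=
  ∑ i, (p.2 i - mean θ p.1)

lemma measurable_packetNoise (M : ℕ) (θ : ℝ × ℝ) : Measurable (packetNoise M θ) := by
  unfold packetNoise
  refine measurable_fin_two_prod fun ℓ => ?_
  fun_prop

lemma integrable_packetKernel_noise (M : ℕ) (θ : ℝ × ℝ) (ℓ : Fin 2) :
    Integrable (fun x => packetNoise M θ (ℓ, x)) (packetKernel M θ ℓ) ∧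
      ∫ x, packetNoise M θ (ℓ, x) ∂packetKernel M θ ℓ = 0 := by
  change Integrable _ (Measure.pi fun _ => gaussianReal (mean θ ℓ) 1) ∧
    ∫ x, _ ∂(Measure.pi fun _ => gaussianReal (mean θ ℓ) 1) = 0
  have h1 : Integrable (fun x : ℝ => x - mean θ ℓ) (gaussianReal (mean θ ℓ) 1) :=
    ((memLp_id_gaussianReal 1).integrable (by simp)).sub (integrable_const _)
  have h2 : ∀ i : Fin M, Integrable (fun x : Fin M → ℝ => x i - mean θ ℓ)
      (Measure.pi fun _ => gaussianReal (mean θ ℓ) 1) := fun i =>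
    integrable_comp_eval (μ := fun _ : Fin M => gaussianReal (mean θ ℓ) 1) (i := i) h1
  refine ⟨integrable_finsetSum _ fun i _ => h2 i, ?_⟩
  unfold packetNoise
  rw [integral_finsetSum _ fun i _ => h2 i]
  refine Finset.sum_eq_zero fun i _ => ?_
  rw [integral_comp_eval (μ := fun _ : Fin M => gaussianReal (mean θ ℓ) 1) (i := i)
    (f := fun x => x - mean θ ℓ) h1.aestronglyMeasurable,
    integral_sub (f := fun x => x) ((memLp_id_gaussianReal 1).integrable (by simp))
      (integrable_const _)]
  simp

lemma integrable_step_noise {M : ℕ} (σ : Strategy M) (θ : ℝ × ℝ) (k : ℕ) :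
    Integrable (fun p : Hist M k × (Fin 2 × (Fin M → ℝ)) => packetNoise M θ p.2) (σ.law θ k ⊗ₘ
      (σ.policy k ⊗ₖ Kernel.prodMkLeft (Hist M k) (packetKernel M θ))) ∧
    ∫ p, packetNoise M θ p.2 ∂(σ.law θ k ⊗ₘ
      (σ.policy k ⊗ₖ Kernel.prodMkLeft (Hist M k) (packetKernel M θ))) = 0 := by
  have hm := measurable_packetNoise M θ
  set c : ℝ≥0∞ := ∑ ℓ, ∫⁻ x, ‖packetNoise M θ (ℓ, x)‖ₑ ∂packetKernel M θ ℓ with hc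
  have hc_lt : c < ∞ := ENNReal.sum_lt_top.2 fun ℓ _ =>
    (integrable_packetKernel_noise M θ ℓ).1.hasFiniteIntegral
  have hle : ∀ h, ∫⁻ p, ‖packetNoise M θ p‖ₑ
      ∂((σ.policy k ⊗ₖ Kernel.prodMkLeft (Hist M k) (packetKernel M θ)) h) ≤ c := by
    intro h
    rw [Kernel.lintegral_compProd _ _ _ hm.enorm, lintegral_fintype]
    refine Finset.sum_le_sum fun ℓ _ => ?_
    calc _ ≤ (∫⁻ x, ‖packetNoise M θ (ℓ, x)‖ₑ ∂packetKernel M θ ℓ) * 1 :=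
          mul_le_mul_right prob_le_one _
      _ = _ := mul_one _
  have hint : ∀ h, Integrable (packetNoise M θ)
      ((σ.policy k ⊗ₖ Kernel.prodMkLeft (Hist M k) (packetKernel M θ)) h) := fun h =>
    ⟨hm.aestronglyMeasurable, (hle h).trans_lt hc_lt⟩
  have hI : Integrable (fun p : Hist M k × (Fin 2 × (Fin M → ℝ)) => packetNoise M θ p.2)
      (σ.law θ k ⊗ₘ (σ.policy k ⊗ₖ Kernel.prodMkLeft (Hist M k) (packetKernel M θ))) := by
    refine ⟨(hm.comp measurable_snd).aestronglyMeasurable, ?_⟩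
    rw [HasFiniteIntegral, Measure.lintegral_compProd
      (f := fun p => ‖packetNoise M θ p.2‖ₑ) (hm.comp measurable_snd).enorm]
    calc _ ≤ ∫⁻ _, c ∂σ.law θ k := lintegral_mono fun h => hle h
      _ < ∞ := by simpa using hc_lt
  refine ⟨hI, ?_⟩
  rw [Measure.integral_compProd hI]
  refine integral_eq_zero_of_ae (ae_of_all _ fun h => ?_)
  simp only [Pi.zero_apply]
  rw [ProbabilityTheory.integral_compProd (hint h)]
  refine integral_eq_zero_of_ae (ae_of_all _ fun ℓ => ?_)
  exact (integrable_packetKernel_noise M θ ℓ).2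

lemma measurable_sum_noise (M k : ℕ) (θ : ℝ × ℝ) :
    Measurable fun h : Hist M k => ∑ j, packetNoise M θ (h j) :=
  Finset.measurable_sum _ fun j _ => (measurable_packetNoise M θ).comp (measurable_pi_apply j)

/-- The incomes are integrable, and their total has the same expectation as the total of the means
of the applied actions. -/
lemma integral_law_noise {M : ℕ} (σ : Strategy M) (θ : ℝ × ℝ) (k : ℕ) :
    Integrable (fun h : Hist M k => ∑ j, packetNoise M θ (h j)) (σ.law θ k) ∧
      ∫ h, ∑ j, packetNoise M θ (h j) ∂σ.law θ k = 0 := by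
  induction k with
  | zero => simp
  | succ k ih =>
    have hm := (measurable_sum_noise M (k + 1) θ)
    have hs : ∀ p : Hist M k × (Fin 2 × (Fin M → ℝ)),
        ∑ j, packetNoise M θ (Hist.snoc p j) =
          ∑ j, packetNoise M θ (p.1 j) + packetNoise M θ p.2 := by
      intro p
      simp [Hist.snoc, Fin.sum_univ_castSucc]
    obtain ⟨i2, e2⟩ := integrable_step_noise σ θ k
    set κ := σ.policy k ⊗ₖ Kernel.prodMkLeft (Hist M k) (packetKernel M θ) with hκ
    have hfst : (σ.law θ k ⊗ₘ κ).map Prod.fst = σ.law θ k := Measure.fst_compProd _ _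
    have i1 : Integrable (fun p : Hist M k × (Fin 2 × (Fin M → ℝ)) =>
        ∑ j, packetNoise M θ (p.1 j)) (σ.law θ k ⊗ₘ κ) := by
      have := ih.1
      rw [← hfst] at this
      exact this.comp_measurable measurable_fst
    have e1 : ∫ p, ∑ j, packetNoise M θ (p.1 j) ∂(σ.law θ k ⊗ₘ κ) = 0 := by
      have := ih.2
      rw [← hfst, integral_map measurable_fst.aemeasurable
        (measurable_sum_noise M k θ).aestronglyMeasurable] at this
      exact this
    rw [Strategy.law, integrable_map_measure hm.aestronglyMeasurable
      (measurable_snoc M k).aemeasurable, integral_map (measurable_snoc M k).aemeasurable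
      hm.aestronglyMeasurable]
    simp only [Function.comp_def, hs]
    exact ⟨i1.add i2, by rw [integral_add i1 i2, e1, e2, add_zero]⟩

lemma integrable_sum_regret {M : ℕ} (K : ℕ) (σ : Strategy M) (θ : ℝ × ℝ) :
    Integrable (fun h : Hist M K => ∑ j, (M : ℝ) * regret θ (h j).1) (σ.law θ K) := by
  refine integrable_finsetSum _ fun j _ => ?_
  refine Integrable.of_bound ((measurable_of_countable (fun ℓ : Fin 2 => (M : ℝ) * regret θ ℓ)).comp
    (measurable_fst.comp (measurable_pi_apply j))).aestronglyMeasurable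
    (∑ ℓ, |(M : ℝ) * regret θ ℓ|) (ae_of_all _ fun h => ?_)
  exact Finset.single_le_sum (f := fun ℓ => |(M : ℝ) * regret θ ℓ|)
    (fun _ _ => abs_nonneg _) (Finset.mem_univ _)

/-- The loss is the expected total regret. -/
lemma loss_eq_integral_regret {M : ℕ} (K : ℕ) (σ : Strategy M) (θ : ℝ × ℝ) :
    loss K σ θ = ∫ h, ∑ j, M * regret θ (h j).1 ∂σ.law θ K := by
  obtain ⟨i1, e1⟩ := integral_law_noise σ θ K
  have hx : ∀ h : Hist M K, ∑ j, ∑ i, (h j).2 i = ((K * M : ℕ) : ℝ) * max θ.1 θ.2 +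
      ∑ j, packetNoise M θ (h j) - ∑ j, (M : ℝ) * regret θ (h j).1 := by
    intro h
    have hj : ∀ j, ∑ i, (h j).2 i =
        M * max θ.1 θ.2 + packetNoise M θ (h j) - M * regret θ (h j).1 := by
      intro j
      simp only [packetNoise, regret, Finset.sum_sub_distrib]
      simp
      ring
    simp_rw [hj, Finset.sum_sub_distrib, Finset.sum_add_distrib]
    simp
    ring
  rw [loss]
  simp_rw [hx]
  rw [integral_sub (f := fun h : Hist M K => ((K * M : ℕ) : ℝ) * max θ.1 θ.2 +
    ∑ j, packetNoise M θ (h j)) ((integrable_const _).add i1)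
    (integrable_sum_regret K σ θ), integral_add (integrable_const _) i1, e1]
  simp

lemma lintegral_sum_regret {M : ℕ} (K : ℕ) (σ : Strategy M) (θ : ℝ × ℝ) :
    ∫⁻ h, ∑ j, M * ENNReal.ofReal (regret θ (h j).1) ∂σ.law θ K =
      ∑ k ∈ Finset.range K, ∫⁻ h, ∑ ℓ, σ.policy k h {ℓ} * (M * ENNReal.ofReal (regret θ ℓ))
        ∂σ.law θ k := by
  induction K with
  | zero => simp
  | succ K ih =>
    have hmr : ∀ (K : ℕ) (j : Fin K), Measurable fun h : Hist M K =>
        (M : ℝ≥0∞) * ENNReal.ofReal (regret θ (h j).1) := fun K j =>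
      (measurable_of_countable (fun ℓ : Fin 2 => (M : ℝ≥0∞) * ENNReal.ofReal (regret θ ℓ))).comp
        (measurable_fst.comp (measurable_pi_apply j))
    rw [lintegral_law_succ _ _ _ (Finset.measurable_sum _ fun j _ => hmr (K + 1) j),
      Finset.sum_range_succ, ← ih,
      ← lintegral_add_left (Finset.measurable_sum _ fun j _ => hmr K j)]
    refine lintegral_congr fun h => ?_
    have hs : ∀ (ℓ : Fin 2) (x : Fin M → ℝ),
        ∑ j, (M : ℝ≥0∞) * ENNReal.ofReal (regret θ (Hist.snoc (h, (ℓ, x)) j).1) =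
          ∑ j, (M : ℝ≥0∞) * ENNReal.ofReal (regret θ (h j).1) +
            M * ENNReal.ofReal (regret θ ℓ) := by
      intro ℓ x
      simp [Hist.snoc, Fin.sum_univ_castSucc]
    simp_rw [hs]
    simp only [lintegral_const, measure_univ, mul_one, mul_add, Finset.sum_add_distrib]
    rw [← Finset.sum_mul, sum_policy, one_mul]

/-- The loss is the sum, over the packets, of the expected regrets of the applied actions. -/
lemma ofReal_loss {M : ℕ} (K : ℕ) (σ : Strategy M) (θ : ℝ × ℝ) :
    ENNReal.ofReal (loss K σ θ) =
      ∑ k ∈ Finset.range K, ∫⁻ h, ∑ ℓ, σ.policy k h {ℓ} * (M * ENNReal.ofReal (regret θ ℓ))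
        ∂σ.law θ k := by
  rw [← lintegral_sum_regret, loss_eq_integral_regret]
  have hnn : ∀ (h : Hist M K) (j : Fin K), 0 ≤ (M : ℝ) * regret θ (h j).1 := fun h j =>
    mul_nonneg (Nat.cast_nonneg _) (regret_nonneg _ _)
  rw [ofReal_integral_eq_lintegral_ofReal]
  · refine lintegral_congr fun h => ?_
    rw [ENNReal.ofReal_sum_of_nonneg fun j _ => hnn h j]
    refine Finset.sum_congr rfl fun j _ => ?_
    rw [ENNReal.ofReal_mul (Nat.cast_nonneg _), ENNReal.ofReal_natCast]
  · exact integrable_sum_regret K σ θ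
  · exact ae_of_all _ fun h => Finset.sum_nonneg fun j _ => hnn h j

lemma loss_nonneg {M : ℕ} (K : ℕ) (σ : Strategy M) (θ : ℝ × ℝ) : 0 ≤ loss K σ θ := by
  rw [loss_eq_integral_regret]
  exact integral_nonneg fun h => Finset.sum_nonneg fun j _ =>
    mul_nonneg (Nat.cast_nonneg _) (regret_nonneg _ _)

/-- The expected regret of action `ℓ` in the state `s`, for the prior density `lam`; it is not
normalized by the posterior mass. -/
noncomputable def cost (lam : ℝ × ℝ → ℝ≥0∞) (ℓ : Fin 2) (s : State) : ℝ≥0∞ :=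
  ∫⁻ θ, ENNReal.ofReal (regret θ ℓ) * ENNReal.ofReal (lik θ s) * lam θ

/-- The total mass of the posterior that is not normalized. -/
noncomputable def mass (lam : ℝ × ℝ → ℝ≥0∞) (s : State) : ℝ≥0∞ :=
  ∫⁻ θ, ENNReal.ofReal (lik θ s) * lam θ

lemma measurable_cost {lam : ℝ × ℝ → ℝ≥0∞} (hl : Measurable lam) (ℓ : Fin 2) :
    Measurable (cost lam ℓ) := by
  refine Measurable.lintegral_prod_left'
    (f := fun p : (ℝ × ℝ) × State => ENNReal.ofReal (regret p.1 ℓ) *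
      ENNReal.ofReal (lik p.1 p.2) * lam p.1) ?_
  exact (((measurable_regret ℓ).comp measurable_fst).ennreal_ofReal.mul
    measurable_lik.ennreal_ofReal).mul (hl.comp measurable_fst)

lemma measurable_mass {lam : ℝ × ℝ → ℝ≥0∞} (hl : Measurable lam) :
    Measurable (mass lam) := by
  refine Measurable.lintegral_prod_left'
    (f := fun p : (ℝ × ℝ) × State => ENNReal.ofReal (lik p.1 p.2) * lam p.1) ?_
  exact measurable_lik.ennreal_ofReal.mul (hl.comp measurable_fst)

/-- The expected total cost of the `r` packets after a history of `k` packets when the incomes have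
mean zero and an action `ℓ` in the state `s` costs `M * G ℓ s`. -/
noncomputable def costToGo {M : ℕ} (σ : Strategy M) (G : Fin 2 → State → ℝ≥0∞) :
    (r k : ℕ) → Hist M k → ℝ≥0∞
  | 0, _, _ => 0
  | r + 1, k, h => ∑ ℓ, σ.policy k h {ℓ} * (M * G ℓ h.state +
      ∫⁻ x, costToGo σ G r (k + 1) (Hist.snoc (h, (ℓ, x))) ∂packetKernel M 0 ℓ)

lemma measurable_comp_snoc {M k : ℕ} {F : Hist M (k + 1) → ℝ≥0∞} (hF : Measurable F) (ℓ : Fin 2) :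
    Measurable fun p : Hist M k × (Fin M → ℝ) => F (Hist.snoc (p.1, (ℓ, p.2))) :=
  hF.comp ((measurable_snoc M k).comp (by fun_prop))

lemma measurable_costToGo {M : ℕ} (σ : Strategy M) {G : Fin 2 → State → ℝ≥0∞}
    (hG : ∀ ℓ, Measurable (G ℓ)) (r k : ℕ) : Measurable (costToGo σ G r k) := by
  induction r generalizing k with
  | zero => exact measurable_const
  | succ r ih =>
    refine Finset.measurable_sum _ fun ℓ _ => (measurable_policy σ k ℓ).mul
      ((((hG ℓ).comp (measurable_state M k)).const_mul _).add ?_)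
    exact measurable_lintegral_packetKernel M 0 ℓ (measurable_comp_snoc (ih (k + 1)) ℓ)

lemma lintegral_costToGo {M : ℕ} (σ : Strategy M) {G : Fin 2 → State → ℝ≥0∞}
    (hG : ∀ ℓ, Measurable (G ℓ)) (r k : ℕ) :
    ∫⁻ h, costToGo σ G r k h ∂σ.law 0 k = ∑ i ∈ Finset.range r,
      ∫⁻ h, ∑ ℓ, σ.policy (k + i) h {ℓ} * (M * G ℓ h.state) ∂σ.law 0 (k + i) := by
  let c : ℕ → ℝ≥0∞ := fun n => ∫⁻ h, ∑ ℓ, σ.policy n h {ℓ} * (M * G ℓ h.state) ∂σ.law 0 n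
  change _ = ∑ i ∈ Finset.range r, c (k + i)
  induction r generalizing k with
  | zero => simp [costToGo]
  | succ r ih =>
    have hk : ∀ i, c (k + (i + 1)) = c (k + 1 + i) := fun i => congrArg c (by omega)
    rw [Finset.sum_range_succ', Finset.sum_congr rfl fun i _ => hk i,
      ← ih (k + 1), lintegral_law_succ _ _ _ (measurable_costToGo σ hG r (k + 1)),
      add_zero]
    have hm : Measurable fun h : Hist M k => ∑ ℓ, σ.policy k h {ℓ} * (M * G ℓ h.state) :=
      Finset.measurable_sum _ fun ℓ _ =>
        (measurable_policy σ _ ℓ).mul (((hG ℓ).comp (measurable_state M _)).const_mul _)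
    change _ = _ + ∫⁻ h, _ ∂_
    rw [← lintegral_add_right _ hm]
    refine lintegral_congr fun h => ?_
    simp only [costToGo, mul_add, Finset.sum_add_distrib]
    rw [add_comm]

/-- The averaged loss is the cost-to-go, from the empty history, for the expected regrets. -/
lemma lintegral_loss {M : ℕ} (K : ℕ) (σ : Strategy M) {lam : ℝ × ℝ → ℝ≥0∞} (hl : Measurable lam) :
    ∫⁻ θ, ENNReal.ofReal (loss K σ θ) * lam θ = costToGo σ (cost lam) K 0 Fin.elim0 := by
  rw [← lintegral_law_zero σ 0 (costToGo σ (cost lam) K 0),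
    lintegral_costToGo σ (measurable_cost hl)]
  have hmeas : ∀ k, Measurable fun p : (ℝ × ℝ) × Hist M k => ENNReal.ofReal (lik p.1 p.2.state) *
      (∑ ℓ, σ.policy k p.2 {ℓ} * (M * ENNReal.ofReal (regret p.1 ℓ))) * lam p.1 := by
    intro k
    refine Measurable.mul (Measurable.mul ?_ ?_) (hl.comp measurable_fst)
    · exact (measurable_lik.comp (measurable_fst.prodMk
        ((measurable_state M k).comp measurable_snd))).ennreal_ofReal
    · exact Finset.measurable_sum _ fun ℓ _ => ((measurable_policy σ k ℓ).comp measurable_snd).mul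
        (((measurable_regret ℓ).comp measurable_fst).ennreal_ofReal.const_mul _)
  have hpol : ∀ (k : ℕ) (θ : ℝ × ℝ), Measurable fun h => ENNReal.ofReal (lik θ (Hist.state h)) *
      (∑ ℓ, σ.policy k h {ℓ} * (M * ENNReal.ofReal (regret θ ℓ))) := by
    intro k θ
    exact ((measurable_lik_right θ).comp (measurable_state M k)).ennreal_ofReal.mul
      (Finset.measurable_sum _ fun ℓ _ => (measurable_policy σ k ℓ).mul_const _)
  have h1 : ∀ θ, ENNReal.ofReal (loss K σ θ) * lam θ = ∑ k ∈ Finset.range K,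
      ∫⁻ h, ENNReal.ofReal (lik θ h.state) *
        (∑ ℓ, σ.policy k h {ℓ} * (M * ENNReal.ofReal (regret θ ℓ))) * lam θ ∂σ.law 0 k := by
    intro θ
    rw [ofReal_loss, Finset.sum_mul]
    refine Finset.sum_congr rfl fun k _ => ?_
    rw [lintegral_law _ _ _ (Finset.measurable_sum _ fun ℓ _ =>
      (measurable_policy σ k ℓ).mul_const _), lintegral_mul_const _ (hpol k θ)]
  simp_rw [h1]
  rw [lintegral_finsetSum _ fun k _ => (hmeas k).lintegral_prod_right']
  refine Finset.sum_congr rfl fun k _ => ?_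
  rw [lintegral_lintegral_swap (hmeas k).aemeasurable, zero_add]
  refine lintegral_congr fun h => ?_
  have h2 : ∀ θ, ENNReal.ofReal (lik θ h.state) *
      (∑ ℓ, σ.policy k h {ℓ} * (M * ENNReal.ofReal (regret θ ℓ))) * lam θ =
      ∑ ℓ, σ.policy k h {ℓ} * (M * (ENNReal.ofReal (regret θ ℓ) * ENNReal.ofReal (lik θ h.state) *
        lam θ)) := by
    intro θ
    rw [Finset.mul_sum, Finset.sum_mul]
    refine Finset.sum_congr rfl fun ℓ _ => ?_
    ring
  have h3 : ∀ ℓ : Fin 2, Measurable fun θ => ENNReal.ofReal (regret θ ℓ) *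
      ENNReal.ofReal (lik θ h.state) * lam θ := fun ℓ =>
    ((measurable_regret ℓ).ennreal_ofReal.mul (measurable_lik_left _).ennreal_ofReal).mul hl
  simp_rw [h2]
  rw [lintegral_finsetSum _ fun ℓ _ => ((h3 ℓ).const_mul _).const_mul _]
  refine Finset.sum_congr rfl fun ℓ _ => ?_
  rw [lintegral_const_mul _ ((h3 ℓ).const_mul _), lintegral_const_mul _ (h3 ℓ)]
  rfl

/-! ### Dynamic programming -/

/-- The optimal cost of `r` more packets in the state `s`, when the incomes have mean zero and an
action `ℓ` in the state `s` costs `M * G ℓ s`. -/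
noncomputable def value (M : ℕ) (G : Fin 2 → State → ℝ≥0∞) : ℕ → State → ℝ≥0∞
  | 0, _ => 0
  | r + 1, s => min (M * G 0 s + ∫⁻ x, value M G r (s.step M 0 x) ∂gaussianReal 0 M)
      (M * G 1 s + ∫⁻ x, value M G r (s.step M 1 x) ∂gaussianReal 0 M)

/-- The cost of one packet processed with action `ℓ` in the state `s`, followed by optimal control
of `r` more packets. -/
noncomputable def actionValue (M : ℕ) (G : Fin 2 → State → ℝ≥0∞) (ℓ : Fin 2) (r : ℕ) (s : State) :
    ℝ≥0∞ :=
  M * G ℓ s + ∫⁻ x, value M G r (s.step M ℓ x) ∂gaussianReal 0 M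

lemma value_succ (M : ℕ) (G : Fin 2 → State → ℝ≥0∞) (r : ℕ) (s : State) :
    value M G (r + 1) s = min (actionValue M G 0 r s) (actionValue M G 1 r s) := rfl

lemma value_le_actionValue (M : ℕ) (G : Fin 2 → State → ℝ≥0∞) (ℓ : Fin 2) (r : ℕ) (s : State) :
    value M G (r + 1) s ≤ actionValue M G ℓ r s := by
  rw [value_succ]
  fin_cases ℓ
  · exact min_le_left _ _
  · exact min_le_right _ _

lemma value_eq_min_other (M : ℕ) (G : Fin 2 → State → ℝ≥0∞) (ℓ : Fin 2) (r : ℕ) (s : State) :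
    value M G (r + 1) s = min (actionValue M G ℓ r s) (actionValue M G (1 - ℓ) r s) := by
  rw [value_succ]
  fin_cases ℓ
  · rfl
  · exact min_comm _ _

lemma measurable_value {M : ℕ} {G : Fin 2 → State → ℝ≥0∞} (hG : ∀ ℓ, Measurable (G ℓ)) (r : ℕ) :
    Measurable (value M G r) := by
  induction r with
  | zero => exact measurable_const
  | succ r ih =>
    have h : ∀ ℓ, Measurable fun s : State =>
        ∫⁻ x, value M G r (s.step M ℓ x) ∂gaussianReal 0 M := fun ℓ =>
      Measurable.lintegral_prod_right' (f := fun p : State × ℝ => value M G r (p.1.step M ℓ p.2))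
        (ih.comp (measurable_step M ℓ))
    exact (((hG 0).const_mul _).add (h 0)).min (((hG 1).const_mul _).add (h 1))

lemma measurable_value_step {M : ℕ} {G : Fin 2 → State → ℝ≥0∞} (hG : ∀ ℓ, Measurable (G ℓ))
    (r : ℕ) (s : State) (ℓ : Fin 2) : Measurable fun x => value M G r (s.step M ℓ x) :=
  (measurable_value hG r).comp ((measurable_step M ℓ).comp (measurable_const.prodMk measurable_id))

lemma measurable_actionValue {M : ℕ} {G : Fin 2 → State → ℝ≥0∞} (hG : ∀ ℓ, Measurable (G ℓ))
    (ℓ : Fin 2) (r : ℕ) : Measurable (actionValue M G ℓ r) := by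
  refine ((hG ℓ).const_mul _).add ?_
  exact Measurable.lintegral_prod_right'
    (f := fun p : State × ℝ => value M G r (p.1.step M ℓ p.2))
    ((measurable_value hG r).comp (measurable_step M ℓ))

lemma lintegral_value_snoc {M : ℕ} {G : Fin 2 → State → ℝ≥0∞} (hG : ∀ ℓ, Measurable (G ℓ))
    (r : ℕ) {k : ℕ} (h : Hist M k) (ℓ : Fin 2) :
    ∫⁻ x, value M G r (Hist.snoc (h, (ℓ, x))).state ∂packetKernel M 0 ℓ =
      ∫⁻ x, value M G r (h.state.step M ℓ x) ∂gaussianReal 0 M := by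
  simp_rw [state_snoc]
  exact lintegral_packetKernel_zero M ℓ (measurable_value_step hG r h.state ℓ)

/-- The dynamic programming lower bound. -/
lemma value_le_costToGo {M : ℕ} (σ : Strategy M) {G : Fin 2 → State → ℝ≥0∞}
    (hG : ∀ ℓ, Measurable (G ℓ)) (r k : ℕ) (h : Hist M k) :
    value M G r h.state ≤ costToGo σ G r k h := by
  induction r generalizing k with
  | zero => exact le_rfl
  | succ r ih =>
    calc value M G (r + 1) h.state
        = ∑ ℓ, σ.policy k h {ℓ} * value M G (r + 1) h.state := by
          rw [← Finset.sum_mul, sum_policy, one_mul]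
      _ ≤ _ := by
          refine Finset.sum_le_sum fun ℓ _ => mul_le_mul_right ?_ _
          refine (value_le_actionValue M G ℓ r h.state).trans (add_le_add_right ?_ _)
          rw [← lintegral_value_snoc hG r h ℓ]
          exact lintegral_mono fun x => ih _ _

lemma actionValue_le_costToGo {M : ℕ} (σ : Strategy M) {G : Fin 2 → State → ℝ≥0∞}
    (hG : ∀ ℓ, Measurable (G ℓ)) (ℓ : Fin 2) (r k : ℕ) (h : Hist M k)
    (hσ : σ.policy k h = Measure.dirac ℓ) :
    actionValue M G ℓ r h.state ≤ costToGo σ G (r + 1) k h := by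
  have h1 : σ.policy k h {ℓ} = 1 := by simp [hσ]
  refine le_trans ?_ (Finset.single_le_sum (f := fun ℓ => σ.policy k h {ℓ} * (M * G ℓ h.state +
      ∫⁻ x, costToGo σ G r (k + 1) (Hist.snoc (h, (ℓ, x))) ∂packetKernel M 0 ℓ))
      (fun _ _ => zero_le) (Finset.mem_univ ℓ))
  simp only [h1, one_mul]
  refine add_le_add_right ?_ _
  rw [← lintegral_value_snoc hG r h ℓ]
  exact lintegral_mono fun x => value_le_costToGo σ hG _ _ _

/-- A strategy that only applies minimizing actions, on the histories with a property `P` that is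
preserved when the history is prolonged, attains the dynamic programming bound there. -/
lemma costToGo_eq_value {M : ℕ} (σ : Strategy M) {G : Fin 2 → State → ℝ≥0∞}
    (hG : ∀ ℓ, Measurable (G ℓ)) (K : ℕ) (P : ∀ k, Hist M k → Prop)
    (hP : ∀ k h ℓ x, P k h → P (k + 1) (Hist.snoc (h, (ℓ, x))))
    (hopt : ∀ k r h ℓ, k + (r + 1) = K → P k h →
      value M G (r + 1) h.state < actionValue M G ℓ r h.state → σ.policy k h {ℓ} = 0)
    (r k : ℕ) (h : Hist M k) (hk : k + r = K) (hPh : P k h) :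
    costToGo σ G r k h = value M G r h.state := by
  induction r generalizing k with
  | zero => rfl
  | succ r ih =>
    calc costToGo σ G (r + 1) k h
        = ∑ ℓ, σ.policy k h {ℓ} * actionValue M G ℓ r h.state := by
          refine Finset.sum_congr rfl fun ℓ _ => ?_
          rw [actionValue, ← lintegral_value_snoc hG r h ℓ]
          congr 2
          exact lintegral_congr fun x => ih _ _ (by omega) (hP _ _ _ _ hPh)
      _ = ∑ ℓ, σ.policy k h {ℓ} * value M G (r + 1) h.state := by
          refine Finset.sum_congr rfl fun ℓ _ => ?_
          rcases (value_le_actionValue M G ℓ r h.state).eq_or_lt with he | hlt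
          · rw [he]
          · rw [hopt k r h ℓ hk hPh hlt, zero_mul, zero_mul]
      _ = _ := by rw [← Finset.sum_mul, sum_policy, one_mul]

lemma sum_dirac_mul (ℓ : Fin 2) (F : Fin 2 → ℝ≥0∞) :
    ∑ i, Measure.dirac ℓ {i} * F i = F ℓ := by
  rw [Finset.sum_eq_single ℓ]
  · simp
  · intro i _ hi
    simp [hi.symm]
  · simp

/-- The strategy which applies the action `φ k h` after the history `h`. -/
noncomputable def Strategy.ofFun {M : ℕ} (φ : (k : ℕ) → Hist M k → Fin 2)
    (hφ : ∀ k, Measurable (φ k)) : Strategy M where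
  policy k := Kernel.deterministic (φ k) (hφ k)
  markov _ := inferInstance

lemma measurable_argmin {α : Type*} [MeasurableSpace α] {β : Type*} [MeasurableSpace β]
    [LinearOrder β] [TopologicalSpace β] [OrderClosedTopology β] [SecondCountableTopology β]
    [OpensMeasurableSpace β] {f₀ f₁ : α → β} (h₀ : Measurable f₀) (h₁ : Measurable f₁) :
    Measurable fun a => if f₀ a ≤ f₁ a then (0 : Fin 2) else 1 :=
  Measurable.ite (measurableSet_le h₀ h₁) measurable_const measurable_const

lemma exists_strategy_costToGo_eq {M : ℕ} {G : Fin 2 → State → ℝ≥0∞}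
    (hG : ∀ ℓ, Measurable (G ℓ)) (ℓ : Fin 2) (r : ℕ) :
    ∃ σ : Strategy M, (∀ h, σ.policy 0 h = Measure.dirac ℓ) ∧
      ∀ h, costToGo σ G (r + 1) 0 h = actionValue M G ℓ r 0 := by
  classical
  let φ : (k : ℕ) → Hist M k → Fin 2 := fun k h => if k = 0 then ℓ else
    if actionValue M G 0 (r - k) h.state ≤ actionValue M G 1 (r - k) h.state then 0 else 1
  have hφ : ∀ k, Measurable (φ k) := by
    intro k
    by_cases hk : k = 0
    · simp only [φ, hk, if_true]; exact measurable_const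
    · simp only [φ, hk, if_false]
      exact measurable_argmin ((measurable_actionValue hG 0 _).comp (measurable_state M k))
        ((measurable_actionValue hG 1 _).comp (measurable_state M k))
  have h0 : ∀ h, (Strategy.ofFun φ hφ).policy 0 h = Measure.dirac ℓ := fun h => by
    simp [Strategy.ofFun, Kernel.deterministic_apply, φ]
  refine ⟨Strategy.ofFun φ hφ, h0, fun h => ?_⟩
  have hv : ∀ x, costToGo (Strategy.ofFun φ hφ) G r 1 (Hist.snoc (h, (ℓ, x))) =
      value M G r (Hist.snoc (h, (ℓ, x))).state := by
    intro x
    refine costToGo_eq_value _ hG (r + 1) (fun k _ => 1 ≤ k) (fun k _ _ _ _ => by omega) ?_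
      r 1 _ (by omega) le_rfl
    intro k r' h' ℓ' hk hk1 hlt
    have hr : r - k = r' := by omega
    have hk0 : k ≠ 0 := by omega
    have hne : φ k h' ≠ ℓ' := by
      intro he
      rw [value_succ] at hlt
      simp only [φ, hk0, if_false, hr] at he
      split_ifs at he with hle
      · subst he
        rw [min_eq_left hle] at hlt
        exact lt_irrefl _ hlt
      · subst he
        rw [min_eq_right (not_le.1 hle).le] at hlt
        exact lt_irrefl _ hlt
    simp [Strategy.ofFun, Kernel.deterministic_apply, hne]
  rw [costToGo, h0, sum_dirac_mul]
  simp_rw [hv]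
  rw [lintegral_value_snoc hG, state_of_isEmpty]
  rfl

lemma costToGo_mono {M : ℕ} (σ : Strategy M) {G G' : Fin 2 → State → ℝ≥0∞}
    (h : ∀ ℓ s, G ℓ s ≤ G' ℓ s) (r k : ℕ) (x : Hist M k) :
    costToGo σ G r k x ≤ costToGo σ G' r k x := by
  induction r generalizing k with
  | zero => exact le_rfl
  | succ r ih =>
    refine Finset.sum_le_sum fun ℓ _ => mul_le_mul_right (add_le_add ?_ ?_) _
    · exact mul_le_mul_right (h _ _) _
    · exact lintegral_mono fun _ => ih _ _

/-- A bound of the cost-to-go by a martingale that dominates the costs of the actions. -/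
lemma costToGo_le_martingale {M : ℕ} (σ : Strategy M) {G : Fin 2 → State → ℝ≥0∞} {Z : State → ℝ≥0∞}
    (hZ : Measurable Z) (D : ℝ≥0∞) (hGZ : ∀ ℓ s, G ℓ s ≤ D * Z s)
    (hmart : ∀ ℓ s, ∫⁻ x, Z (s.step M ℓ x) ∂gaussianReal 0 M = Z s)
    (r k : ℕ) (h : Hist M k) : costToGo σ G r k h ≤ r * (M * D) * Z h.state := by
  induction r generalizing k with
  | zero => simp [costToGo]
  | succ r ih =>
    calc costToGo σ G (r + 1) k h
        ≤ ∑ ℓ, σ.policy k h {ℓ} * (M * (D * Z h.state) + r * (M * D) * Z h.state) := by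
          refine Finset.sum_le_sum fun ℓ _ => mul_le_mul_right (add_le_add ?_ ?_) _
          · exact mul_le_mul_right (hGZ _ _) _
          · have hm : Measurable fun x => Z (h.state.step M ℓ x) :=
              hZ.comp ((measurable_step M ℓ).comp (measurable_const.prodMk measurable_id))
            calc _ ≤ ∫⁻ x, r * (M * D) * Z (Hist.snoc (h, (ℓ, x))).state ∂packetKernel M 0 ℓ :=
                  lintegral_mono fun x => ih _ _
              _ = ∫⁻ x, r * (M * D) * Z (h.state.step M ℓ x) ∂gaussianReal 0 M := by
                  simp_rw [state_snoc]
                  exact lintegral_packetKernel_zero M ℓ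
                    (F := fun x => r * (M * D) * Z (h.state.step M ℓ x)) (hm.const_mul _)
              _ = _ := by rw [lintegral_const_mul _ hm, hmart]
      _ = _ := by
          rw [← Finset.sum_mul, sum_policy]
          push_cast
          ring

lemma lintegral_lik_step {M : ℕ} (hM : 0 < M) (θ : ℝ × ℝ) (ℓ : Fin 2) (s : State) :
    ∫⁻ x, ENNReal.ofReal (lik θ (s.step M ℓ x)) ∂gaussianReal 0 M = ENNReal.ofReal (lik θ s) := by
  simp_rw [lik_step, ENNReal.ofReal_mul (lik_pos θ s).le]
  rw [lintegral_const_mul _ (by fun_prop)]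
  have := lintegral_exp_gaussianReal (mean θ ℓ) (v := M) (by exact_mod_cast hM.ne')
    (F := fun _ => 1) measurable_const
  simp only [mul_one, lintegral_const, measure_univ, NNReal.coe_natCast] at this
  rw [this, mul_one]

/-- The posterior masses are martingales for the law of mean-zero incomes. -/
lemma lintegral_mass_step {M : ℕ} (hM : 0 < M) {lam : ℝ × ℝ → ℝ≥0∞} (hl : Measurable lam)
    (ℓ : Fin 2) (s : State) : ∫⁻ x, mass lam (s.step M ℓ x) ∂gaussianReal 0 M = mass lam s := by
  have hm : Measurable fun p : ℝ × (ℝ × ℝ) =>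
      ENNReal.ofReal (lik p.2 (s.step M ℓ p.1)) * lam p.2 :=
    (measurable_lik.comp (measurable_snd.prodMk ((measurable_step M ℓ).comp
      (measurable_const.prodMk measurable_fst)))).ennreal_ofReal.mul (hl.comp measurable_snd)
  unfold mass
  rw [lintegral_lintegral_swap hm.aemeasurable]
  refine lintegral_congr fun θ => ?_
  rw [lintegral_mul_const _ (Measurable.of_uncurry_right
    (f := fun x θ => ENNReal.ofReal (lik θ (s.step M ℓ x))) (measurable_lik.comp
      (measurable_snd.prodMk ((measurable_step M ℓ).comp
      (measurable_const.prodMk measurable_fst)))).ennreal_ofReal), lintegral_lik_step hM]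

lemma cost_eq_mass (lam : ℝ × ℝ → ℝ≥0∞) (ℓ : Fin 2) (s : State) :
    cost lam ℓ s = mass (fun θ => ENNReal.ofReal (regret θ ℓ) * lam θ) s :=
  lintegral_congr fun θ => by ring

/-- The expected regrets are martingales. -/
lemma lintegral_cost_step {M : ℕ} (hM : 0 < M) {lam : ℝ × ℝ → ℝ≥0∞} (hl : Measurable lam)
    (ℓ i : Fin 2) (s : State) :
    ∫⁻ x, cost lam i (s.step M ℓ x) ∂gaussianReal 0 M = cost lam i s := by
  simp_rw [cost_eq_mass]
  exact lintegral_mass_step hM ((measurable_regret i).ennreal_ofReal.mul hl) ℓ s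

lemma regret_le {C : ℝ} {θ : ℝ × ℝ} (h : θ ∈ paramSet C) (ℓ : Fin 2) : regret θ ℓ ≤ 2 * C := by
  have h' : |θ.1 - θ.2| ≤ 2 * C := h
  rw [abs_le] at h'
  unfold regret mean
  refine sub_le_iff_le_add.2 (max_le ?_ ?_) <;> split_ifs <;> linarith

lemma cost_le_mass {C : ℝ} {lam : ℝ × ℝ → ℝ≥0∞} (h : ∀ θ, θ ∉ paramSet C → lam θ = 0)
    (ℓ : Fin 2) (s : State) : cost lam ℓ s ≤ ENNReal.ofReal (2 * C) * mass lam s := by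
  rw [mass, ← lintegral_const_mul' _ _ ENNReal.ofReal_ne_top]
  refine lintegral_mono fun θ => ?_
  by_cases hθ : θ ∈ paramSet C
  · rw [mul_assoc]
    exact mul_le_mul_left (ENNReal.ofReal_le_ofReal (regret_le hθ ℓ)) _
  · simp [h θ hθ]

/-- A density on the parameter set with finite mass. -/
structure IsFiniteDensity (C : ℝ) (lam : ℝ × ℝ → ℝ) : Prop where
  measurable : Measurable lam
  nonneg : ∀ θ, 0 ≤ lam θ
  eq_zero : ∀ θ, θ ∉ paramSet C → lam θ = 0
  lintegral_ne_top : ∫⁻ θ, ENNReal.ofReal (lam θ) ≠ ∞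

lemma measurable_loss {M : ℕ} (K : ℕ) (σ : Strategy M) : Measurable fun θ => loss K σ θ := by
  have h : (fun θ => loss K σ θ) = fun θ => (∑ k ∈ Finset.range K, ∫⁻ h, ∑ ℓ, σ.policy k h {ℓ} *
      (M * ENNReal.ofReal (regret θ ℓ)) ∂σ.law θ k).toReal := by
    funext θ
    rw [← ofReal_loss, ENNReal.toReal_ofReal (loss_nonneg K σ θ)]
  rw [h]
  refine (Finset.measurable_sum _ fun k _ => ?_).ennreal_toReal
  have hpol : ∀ (θ : ℝ × ℝ), Measurable fun h : Hist M k =>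
      ∑ ℓ, σ.policy k h {ℓ} * (M * ENNReal.ofReal (regret θ ℓ)) := fun θ =>
    Finset.measurable_sum _ fun ℓ _ => (measurable_policy σ k ℓ).mul_const _
  simp_rw [lintegral_law σ _ k (hpol _)]
  refine Measurable.lintegral_prod_right' (f := fun p : (ℝ × ℝ) × Hist M k =>
    ENNReal.ofReal (lik p.1 p.2.state) *
      (∑ ℓ, σ.policy k p.2 {ℓ} * (M * ENNReal.ofReal (regret p.1 ℓ)))) (Measurable.mul ?_ ?_)
  · exact (measurable_lik.comp (measurable_fst.prodMk
      ((measurable_state M k).comp measurable_snd))).ennreal_ofReal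
  · exact Finset.measurable_sum _ fun ℓ _ => ((measurable_policy σ k ℓ).comp measurable_snd).mul
      (((measurable_regret ℓ).comp measurable_fst).ennreal_ofReal.const_mul _)

lemma avgLoss_eq {M : ℕ} {C : ℝ} {lam : ℝ × ℝ → ℝ} (hl : IsFiniteDensity C lam) (K : ℕ)
    (σ : Strategy M) : avgLoss K C σ lam =
      (costToGo σ (cost fun θ => ENNReal.ofReal (lam θ)) K 0 Fin.elim0).toReal := by
  rw [avgLoss, setIntegral_eq_integral_of_forall_compl_eq_zero
    (fun θ hθ => by rw [hl.eq_zero θ hθ, mul_zero]),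
    integral_eq_lintegral_of_nonneg_ae
      (ae_of_all _ fun θ => mul_nonneg (loss_nonneg K σ θ) (hl.nonneg θ))
      ((measurable_loss K σ).mul hl.measurable).aestronglyMeasurable,
    ← lintegral_loss K σ hl.measurable.ennreal_ofReal]
  simp_rw [ENNReal.ofReal_mul (loss_nonneg K σ _)]

lemma costToGo_ne_top {M : ℕ} (hM : 0 < M) {C : ℝ} {lam : ℝ × ℝ → ℝ} (hl : IsFiniteDensity C lam)
    (K : ℕ) (σ : Strategy M) :
    costToGo σ (cost fun θ => ENNReal.ofReal (lam θ)) K 0 Fin.elim0 ≠ ∞ := by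
  refine ne_top_of_le_ne_top ?_ (costToGo_le_martingale σ (measurable_mass
    hl.measurable.ennreal_ofReal) (ENNReal.ofReal (2 * C))
    (cost_le_mass fun θ hθ => by rw [hl.eq_zero θ hθ, ENNReal.ofReal_zero])
    (lintegral_mass_step hM hl.measurable.ennreal_ofReal) K 0 Fin.elim0)
  refine ENNReal.mul_ne_top (ENNReal.mul_ne_top (by simp)
    (ENNReal.mul_ne_top (by simp) ENNReal.ofReal_ne_top)) ?_
  rw [state_of_isEmpty]
  simpa [mass] using hl.lintegral_ne_top

theorem bayesRiskAction_eq {M : ℕ} (hM : 0 < M) {C : ℝ} {lam : ℝ × ℝ → ℝ}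
    (hl : IsFiniteDensity C lam) (r : ℕ) (ℓ : Fin 2) : bayesRiskAction M (r + 1) C lam ℓ =
      (actionValue M (cost fun θ => ENNReal.ofReal (lam θ)) ℓ r 0).toReal := by
  have hG := measurable_cost hl.measurable.ennreal_ofReal
  obtain ⟨σ, h0, hσ⟩ := exists_strategy_costToGo_eq (M := M) hG ℓ r
  have hle : ∀ τ : {σ : Strategy M // ∀ h, σ.policy 0 h = Measure.dirac ℓ},
      (actionValue M (cost fun θ => ENNReal.ofReal (lam θ)) ℓ r 0).toReal ≤
        avgLoss (r + 1) C τ.1 lam := by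
    intro τ
    rw [avgLoss_eq hl]
    refine ENNReal.toReal_mono (costToGo_ne_top hM hl _ _) ?_
    have := actionValue_le_costToGo τ.1 hG ℓ r 0 Fin.elim0 (τ.2 _)
    rwa [state_of_isEmpty] at this
  have : Nonempty {σ : Strategy M // ∀ h, σ.policy 0 h = Measure.dirac ℓ} := ⟨⟨σ, h0⟩⟩
  refine le_antisymm ?_ (le_ciInf hle)
  refine (ciInf_le ⟨_, Set.forall_mem_range.2 hle⟩ ⟨σ, h0⟩).trans_eq ?_
  rw [avgLoss_eq hl, hσ]

theorem bayesRisk_eq {M : ℕ} (hM : 0 < M) {C : ℝ} {lam : ℝ × ℝ → ℝ}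
    (hl : IsFiniteDensity C lam) (r : ℕ) : bayesRisk M (r + 1) C lam =
      (value M (cost fun θ => ENNReal.ofReal (lam θ)) (r + 1) 0).toReal := by
  have hG := measurable_cost hl.measurable.ennreal_ofReal
  obtain ⟨ℓ, hℓ⟩ : ∃ ℓ, value M (cost fun θ => ENNReal.ofReal (lam θ)) (r + 1) 0 =
      actionValue M (cost fun θ => ENNReal.ofReal (lam θ)) ℓ r 0 := by
    rw [value_succ]
    rcases min_choice (actionValue M (cost fun θ => ENNReal.ofReal (lam θ)) 0 r 0)
      (actionValue M (cost fun θ => ENNReal.ofReal (lam θ)) 1 r 0) with h | h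
    exacts [⟨0, h⟩, ⟨1, h⟩]
  obtain ⟨σ, h0, hσ⟩ := exists_strategy_costToGo_eq (M := M) hG ℓ r
  have hle : ∀ τ : Strategy M,
      (value M (cost fun θ => ENNReal.ofReal (lam θ)) (r + 1) 0).toReal ≤
        avgLoss (r + 1) C τ lam := by
    intro τ
    rw [avgLoss_eq hl]
    refine ENNReal.toReal_mono (costToGo_ne_top hM hl _ _) ?_
    have := value_le_costToGo τ hG (r + 1) 0 Fin.elim0
    rwa [state_of_isEmpty] at this
  have : Nonempty (Strategy M) := ⟨σ⟩
  refine le_antisymm ?_ (le_ciInf hle)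
  refine (ciInf_le ⟨_, Set.forall_mem_range.2 hle⟩ σ).trans_eq ?_
  rw [avgLoss_eq hl, hσ, hℓ]

/-! ### Comparison and symmetries of optimal costs -/

lemma value_mono {M : ℕ} {G G' : Fin 2 → State → ℝ≥0∞} (h : ∀ ℓ s, G ℓ s ≤ G' ℓ s) (r : ℕ)
    (s : State) : value M G r s ≤ value M G' r s := by
  induction r generalizing s with
  | zero => exact le_rfl
  | succ r ih =>
    exact min_le_min (add_le_add (mul_le_mul_right (h _ _) _) (lintegral_mono fun _ => ih _))
      (add_le_add (mul_le_mul_right (h _ _) _) (lintegral_mono fun _ => ih _))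

lemma actionValue_le_martingale {M : ℕ} {G : Fin 2 → State → ℝ≥0∞} {Z : State → ℝ≥0∞}
    (hZ : Measurable Z) (D : ℝ≥0∞) (hGZ : ∀ ℓ s, G ℓ s ≤ D * Z s)
    (hmart : ∀ ℓ s, ∫⁻ x, Z (s.step M ℓ x) ∂gaussianReal 0 M = Z s) (ℓ : Fin 2) (r : ℕ)
    (s : State) : actionValue M G ℓ r s ≤ (r + 1) * (M * D) * Z s := by
  have key : ∀ r, (∀ s, value M G r s ≤ r * (M * D) * Z s) → ∀ ℓ s,
      actionValue M G ℓ r s ≤ (r + 1) * (M * D) * Z s := by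
    intro r ih ℓ s
    have hm : Measurable fun x => Z (s.step M ℓ x) :=
      hZ.comp ((measurable_step M ℓ).comp (measurable_const.prodMk measurable_id))
    calc actionValue M G ℓ r s
        ≤ M * (D * Z s) + ∫⁻ x, r * (M * D) * Z (s.step M ℓ x) ∂gaussianReal 0 M :=
          add_le_add (mul_le_mul_right (hGZ _ _) _) (lintegral_mono fun x => ih _)
      _ = _ := by
          rw [lintegral_const_mul _ hm, hmart]
          ring
  refine key r ?_ ℓ s
  induction r with
  | zero => simp [value]
  | succ r ih =>
    intro s
    push_cast
    exact (value_le_actionValue M G 0 r s).trans (key r ih 0 s)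

/-- A transformation of the states which is compatible, up to a weight, with the costs and with
the transitions carries the optimal costs along. -/
lemma value_conj {M : ℕ} {G G' : Fin 2 → State → ℝ≥0∞} (hG : ∀ ℓ, Measurable (G ℓ))
    (π : Equiv.Perm (Fin 2)) (φ : State → State) (w : State → ℝ≥0∞)
    (hcost : ∀ ℓ s, G' ℓ s = w s * G (π ℓ) (φ s))
    (hstep : ∀ ℓ s (F : State → ℝ≥0∞), Measurable F →
      ∫⁻ x, w (s.step M ℓ x) * F (φ (s.step M ℓ x)) ∂gaussianReal 0 M =
        w s * ∫⁻ x, F ((φ s).step M (π ℓ) x) ∂gaussianReal 0 M) (r : ℕ) (s : State) :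
    value M G' r s = w s * value M G r (φ s) := by
  induction r generalizing s with
  | zero => simp [value]
  | succ r ih =>
    have h : ∀ ℓ, actionValue M G' ℓ r s = w s * actionValue M G (π ℓ) r (φ s) := by
      intro ℓ
      simp only [actionValue, hcost, ih]
      rw [hstep _ _ _ (measurable_value hG r)]
      ring
    have hπ : value M G (r + 1) (φ s) =
        min (actionValue M G (π 0) r (φ s)) (actionValue M G (π 1) r (φ s)) := by
      have h1 : π 1 = 1 - π 0 := by
        have : π 1 ≠ π 0 := fun h => by simpa using π.injective h
        revert this
        generalize π 1 = a
        generalize π 0 = b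
        revert a b
        decide
      rw [h1, ← value_eq_min_other]
    rw [hπ, value_succ, h, h, mul_min]

lemma actionValue_conj {M : ℕ} {G G' : Fin 2 → State → ℝ≥0∞} (hG : ∀ ℓ, Measurable (G ℓ))
    (π : Equiv.Perm (Fin 2)) (φ : State → State) (w : State → ℝ≥0∞)
    (hcost : ∀ ℓ s, G' ℓ s = w s * G (π ℓ) (φ s))
    (hstep : ∀ ℓ s (F : State → ℝ≥0∞), Measurable F →
      ∫⁻ x, w (s.step M ℓ x) * F (φ (s.step M ℓ x)) ∂gaussianReal 0 M =
        w s * ∫⁻ x, F ((φ s).step M (π ℓ) x) ∂gaussianReal 0 M)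
    (ℓ : Fin 2) (r : ℕ) (s : State) :
    actionValue M G' ℓ r s = w s * actionValue M G (π ℓ) r (φ s) := by
  simp only [actionValue, hcost, value_conj hG π φ w hcost hstep]
  rw [hstep _ _ _ (measurable_value hG r)]
  ring

lemma step_add (M : ℕ) (ℓ : Fin 2) (x : ℝ) (s t : State) :
    (s + t).step M ℓ x = s.step M ℓ x + t := by
  simp only [State.step, Prod.fst_add, Prod.snd_add]
  exact Prod.ext (add_right_comm _ _ _) (add_right_comm _ _ _)

lemma lintegral_translate_step {M : ℕ} (c : ℝ≥0∞) (t : State) (ℓ : Fin 2) (s : State)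
    (F : State → ℝ≥0∞) (hF : Measurable F) :
    ∫⁻ x, c * F (s.step M ℓ x + t) ∂gaussianReal 0 M =
      c * ∫⁻ x, F ((s + t).step M (Equiv.refl _ ℓ) x) ∂gaussianReal 0 M := by
  simp only [step_add, Equiv.refl_apply]
  rw [lintegral_const_mul]
  simp only [← step_add]
  exact hF.comp ((measurable_step M ℓ).comp (measurable_const.prodMk measurable_id))

/-- The optimal cost for a posterior density is the optimal cost in a later state. -/
lemma value_translate {M : ℕ} {G G' : Fin 2 → State → ℝ≥0∞} (hG : ∀ ℓ, Measurable (G ℓ))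
    (c : ℝ≥0∞) (t : State) (hcost : ∀ ℓ s, G' ℓ s = c * G ℓ (s + t)) (r : ℕ) :
    value M G' r 0 = c * value M G r t := by
  rw [value_conj hG (Equiv.refl _) (fun s => s + t) (fun _ => c) hcost
    (fun ℓ s F hF => lintegral_translate_step c t ℓ s F hF), zero_add]

lemma actionValue_translate {M : ℕ} {G G' : Fin 2 → State → ℝ≥0∞} (hG : ∀ ℓ, Measurable (G ℓ))
    (c : ℝ≥0∞) (t : State) (hcost : ∀ ℓ s, G' ℓ s = c * G ℓ (s + t)) (ℓ : Fin 2) (r : ℕ) :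
    actionValue M G' ℓ r 0 = c * actionValue M G ℓ r t := by
  rw [actionValue_conj hG (Equiv.refl _) (fun s => s + t) (fun _ => c) hcost
    (fun ℓ s F hF => lintegral_translate_step c t ℓ s F hF), zero_add, Equiv.refl_apply]

lemma value_smul {M : ℕ} {G G' : Fin 2 → State → ℝ≥0∞} (hG : ∀ ℓ, Measurable (G ℓ))
    (c : ℝ≥0∞) (hcost : ∀ ℓ s, G' ℓ s = c * G ℓ s) (r : ℕ) (s : State) :
    value M G' r s = c * value M G r s := by
  rw [value_conj hG (Equiv.refl _) id (fun _ => c) hcost]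
  · rfl
  intro ℓ s F hF
  simpa using lintegral_translate_step (M := M) c 0 ℓ s F hF

/-- The exchange of the two actions. -/
def State.swap (s : State) : State := (s.1 ∘ Equiv.swap 0 1, s.2 ∘ Equiv.swap 0 1)

lemma swap_step (M : ℕ) (ℓ : Fin 2) (x : ℝ) (s : State) :
    (s.step M ℓ x).swap = s.swap.step M (Equiv.swap 0 1 ℓ) x := by
  refine Prod.ext ?_ ?_ <;> ext i <;> fin_cases ℓ <;> fin_cases i <;>
    simp [State.step, State.swap]

/-- If exchanging the actions does not change the costs, both actions have the same optimal cost in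
the empty state. -/
lemma actionValue_zero_of_swap {M : ℕ} {G : Fin 2 → State → ℝ≥0∞} (hG : ∀ ℓ, Measurable (G ℓ))
    (hcost : ∀ ℓ s, G ℓ s = G (Equiv.swap 0 1 ℓ) s.swap) (r : ℕ) :
    actionValue M G 0 r 0 = actionValue M G 1 r 0 := by
  have h := actionValue_conj (M := M) (G' := G) hG (Equiv.swap 0 1) State.swap (fun _ => 1)
    (fun ℓ s => (hcost ℓ s).trans (one_mul _).symm)
    (fun ℓ s F _ => by simp only [one_mul, swap_step]) 0 r 0
  have h0 : State.swap 0 = 0 := rfl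
  rwa [one_mul, Equiv.swap_apply_left, h0] at h

/-- The state after adding `c` to all incomes. -/
def State.shift (c : ℝ) (s : State) : State := (s.1, fun ℓ => s.2 ℓ + s.1 ℓ * c)

lemma lik_sub_const (θ : ℝ × ℝ) (c : ℝ) (s : State) :
    lik (θ - (c, c)) s = lik (-c, -c) s * lik θ (s.shift c) := by
  simp only [lik, ← Real.exp_add, Fin.sum_univ_two, mean, State.shift]
  congr 1
  simp
  ring

lemma shift_step (M : ℕ) (ℓ : Fin 2) (x c : ℝ) (s : State) :
    (s.step M ℓ x).shift c = (s.shift c).step M ℓ (x + M * c) := by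
  refine Prod.ext rfl ?_
  ext i
  by_cases h : i = ℓ
  · subst h; simp [State.step, State.shift]; ring
  · simp [State.step, State.shift, h]

/-- The density `lam` translated by `-(c, c)`, that is, with both means decreased by `c`. -/
def shiftDensity (c : ℝ) (lam : ℝ × ℝ → ℝ≥0∞) (θ : ℝ × ℝ) : ℝ≥0∞ := lam (θ + (c, c))

lemma regret_sub_const (θ : ℝ × ℝ) (c : ℝ) (ℓ : Fin 2) : regret (θ - (c, c)) ℓ = regret θ ℓ := by
  have h : max (θ.1 - c) (θ.2 - c) = max θ.1 θ.2 - c := max_sub_sub_right _ _ _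
  fin_cases ℓ <;> simp [regret, mean, h]

lemma lintegral_shiftDensity (F : ℝ × ℝ → ℝ≥0∞) (c : ℝ) (lam : ℝ × ℝ → ℝ≥0∞) :
    ∫⁻ θ, F θ * shiftDensity c lam θ = ∫⁻ θ, F (θ - (c, c)) * lam θ := by
  rw [← lintegral_add_right_eq_self (fun θ => F (θ - (c, c)) * lam θ) (c, c)]
  simp [shiftDensity]

lemma mass_shiftDensity {lam : ℝ × ℝ → ℝ≥0∞} (c : ℝ) (s : State) :
    mass (shiftDensity c lam) s = ENNReal.ofReal (lik (-c, -c) s) * mass lam (s.shift c) := by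
  unfold mass
  rw [lintegral_shiftDensity, ← lintegral_const_mul' _ _ ENNReal.ofReal_ne_top]
  refine lintegral_congr fun θ => ?_
  rw [lik_sub_const, ENNReal.ofReal_mul (lik_pos _ _).le, mul_assoc]

lemma cost_shiftDensity {lam : ℝ × ℝ → ℝ≥0∞} (c : ℝ) (ℓ : Fin 2) (s : State) :
    cost (shiftDensity c lam) ℓ s =
      ENNReal.ofReal (lik (-c, -c) s) * cost lam ℓ (s.shift c) := by
  rw [cost_eq_mass, cost_eq_mass, ← mass_shiftDensity]
  refine lintegral_congr fun θ => ?_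
  have h := regret_sub_const (θ + (c, c)) c ℓ
  rw [add_sub_cancel_right] at h
  simp only [shiftDensity, h]

/-- Adding a constant to both means amounts to adding it to all incomes. -/
lemma value_shiftDensity {M : ℕ} (hM : 0 < M) {lam : ℝ × ℝ → ℝ≥0∞} (hl : Measurable lam) (c : ℝ)
    (r : ℕ) (s : State) : value M (cost (shiftDensity c lam)) r s =
      ENNReal.ofReal (lik (-c, -c) s) * value M (cost lam) r (s.shift c) := by
  refine value_conj (measurable_cost hl) (Equiv.refl _) (State.shift c)
    (fun s => ENNReal.ofReal (lik (-c, -c) s)) (fun ℓ s => cost_shiftDensity c ℓ s) ?_ r s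
  intro ℓ s F hF
  have hF' : Measurable fun x => F ((s.shift c).step M ℓ x) :=
    hF.comp ((measurable_step M ℓ).comp (measurable_const.prodMk measurable_id))
  have hm : mean (-c, -c) ℓ = -c := by simp [mean]
  have h := lintegral_exp_gaussianReal (-c) (v := M) (by exact_mod_cast hM.ne')
    (F := fun x => F ((s.shift c).step M ℓ (x + M * c))) (hF'.comp (measurable_id.add_const _))
  simp only [shift_step, lik_step, ENNReal.ofReal_mul (lik_pos _ s).le, mul_assoc, hm,
    Equiv.refl_apply]
  rw [lintegral_const_mul' _ _ ENNReal.ofReal_ne_top]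
  simp only [NNReal.coe_natCast] at h
  rw [h]
  congr 1
  refine lintegral_congr fun x => ?_
  ring_nf

/-- The optimal costs are continuous along dominated families of costs. -/
lemma tendsto_actionValue {M : ℕ} {ι : Type*} {l : Filter ι} [l.IsCountablyGenerated]
    {G : ι → Fin 2 → State → ℝ≥0∞} {G' : Fin 2 → State → ℝ≥0∞}
    (hG : ∀ i ℓ, Measurable (G i ℓ)) (hle : ∀ i ℓ s, G i ℓ s ≤ G' ℓ s) (S : Set State)
    (hS : ∀ s ∈ S, ∀ ℓ x, s.step M ℓ x ∈ S)
    (hlim : ∀ s ∈ S, ∀ ℓ, Tendsto (fun i => G i ℓ s) l (𝓝 (G' ℓ s)))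
    (hfin : ∀ s ∈ S, ∀ ℓ r, actionValue M G' ℓ r s ≠ ∞) (r : ℕ) :
    ∀ s ∈ S, ∀ ℓ, Tendsto (fun i => actionValue M (G i) ℓ r s) l (𝓝 (actionValue M G' ℓ r s)) := by
  have key : ∀ r, (∀ s ∈ S, Tendsto (fun i => value M (G i) r s) l (𝓝 (value M G' r s))) →
      ∀ s ∈ S, ∀ ℓ, Tendsto (fun i => actionValue M (G i) ℓ r s) l
        (𝓝 (actionValue M G' ℓ r s)) := by
    intro r ih s hs ℓ
    refine (ENNReal.Tendsto.const_mul (hlim s hs ℓ) (Or.inr (by simp))).add ?_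
    refine tendsto_lintegral_filter_of_dominated_convergence
      (fun x => value M G' r (s.step M ℓ x))
      (Eventually.of_forall fun i => measurable_value_step (hG i) r s ℓ)
      (Eventually.of_forall fun i => ae_of_all _ fun x => value_mono (hle i) r _) ?_
      (ae_of_all _ fun x => ih _ (hS s hs ℓ x))
    exact ne_top_of_le_ne_top (hfin s hs ℓ r) le_add_self
  refine key r ?_
  induction r with
  | zero => intro s _; exact tendsto_const_nhds
  | succ r ih =>
    intro s hs
    exact (key r ih s hs 0).min (key r ih s hs 1)

/-- Let `S` be a set of states that is stable under the action `ℓ`. If the other action is never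
more costly than `ℓ` on `S` for one packet, it is at least as good as `ℓ` for every horizon. For, by
induction, after `ℓ` it is optimal to apply the other action, and these two packets can be
exchanged: the expected regrets are martingales. -/
lemma actionValue_le_of_last {M : ℕ} (hM : 0 < M) {lam : ℝ × ℝ → ℝ≥0∞} (hl : Measurable lam)
    (ℓ : Fin 2) (S : Set State) (hS : ∀ s ∈ S, ∀ x, s.step M ℓ x ∈ S)
    (hlast : ∀ s ∈ S, cost lam (1 - ℓ) s ≤ cost lam ℓ s) (r : ℕ) :
    ∀ s ∈ S, actionValue M (cost lam) (1 - ℓ) r s ≤ actionValue M (cost lam) ℓ r s := by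
  have hG := measurable_cost hl
  induction r with
  | zero =>
    intro s hs
    simpa [actionValue, value] using mul_le_mul_right (hlast s hs) (M : ℝ≥0∞)
  | succ r ih =>
    intro s hs
    have hcomm : ∀ x y, (s.step M ℓ x).step M (1 - ℓ) y = (s.step M (1 - ℓ) y).step M ℓ x := by
      intro x y
      simp only [State.step]
      exact Prod.ext (add_right_comm _ _ _) (add_right_comm _ _ _)
    have hV : Measurable fun p : ℝ × ℝ =>
        value M (cost lam) r ((s.step M ℓ p.1).step M (1 - ℓ) p.2) := by
      refine (measurable_value hG r).comp ((measurable_step M (1 - ℓ)).comp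
        (Measurable.prodMk ?_ measurable_snd))
      exact (measurable_step M ℓ).comp (measurable_const.prodMk measurable_fst)
    have hc : ∀ i j, Measurable fun x => (M : ℝ≥0∞) * cost lam i (s.step M j x) := fun i j =>
      ((hG i).comp ((measurable_step M j).comp
        (measurable_const.prodMk measurable_id))).const_mul _
    have hc' : ∀ i j, Measurable fun x => cost lam i (s.step M j x) := fun i j =>
      (hG i).comp ((measurable_step M j).comp (measurable_const.prodMk measurable_id))
    -- after `1 - ℓ` continue with `ℓ`, exchange the two packets, and use the induction hypothesis:
    -- after `ℓ` the optimal continuation is `1 - ℓ`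
    calc actionValue M (cost lam) (1 - ℓ) (r + 1) s
        ≤ M * cost lam (1 - ℓ) s +
          ∫⁻ y, actionValue M (cost lam) ℓ r (s.step M (1 - ℓ) y) ∂gaussianReal 0 M :=
          add_le_add_right (lintegral_mono fun y => value_le_actionValue _ _ _ _ _) _
      _ = M * cost lam (1 - ℓ) s + (M * cost lam ℓ s + ∫⁻ y, ∫⁻ x,
          value M (cost lam) r ((s.step M ℓ x).step M (1 - ℓ) y)
            ∂gaussianReal 0 M ∂gaussianReal 0 M) := by
          simp only [actionValue, hcomm]
          rw [lintegral_add_left (hc _ _), lintegral_const_mul _ (hc' _ _),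
            lintegral_cost_step hM hl]
      _ = M * cost lam ℓ s + (M * cost lam (1 - ℓ) s + ∫⁻ x, ∫⁻ y,
          value M (cost lam) r ((s.step M ℓ x).step M (1 - ℓ) y)
            ∂gaussianReal 0 M ∂gaussianReal 0 M) := by
          rw [lintegral_lintegral_swap (f := fun y x =>
            value M (cost lam) r ((s.step M ℓ x).step M (1 - ℓ) y))
            (hV.comp measurable_swap).aemeasurable]
          exact add_left_comm _ _ _
      _ = M * cost lam ℓ s +
          ∫⁻ x, actionValue M (cost lam) (1 - ℓ) r (s.step M ℓ x) ∂gaussianReal 0 M := by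
          simp only [actionValue]
          rw [lintegral_add_left (hc _ _), lintegral_const_mul _ (hc' _ _),
            lintegral_cost_step hM hl]
      _ = actionValue M (cost lam) ℓ (r + 1) s := by
          rw [actionValue]
          congr 1
          refine lintegral_congr fun x => ?_
          rw [value_eq_min_other M _ ℓ, min_eq_right (ih _ (hS s hs x))]

/-! ### Exponential growth in the recursive equation -/

lemma integrable_mul_gaussianPDFReal_iff {f : ℝ → ℝ} (m : ℝ) {D : ℝ≥0} (hD : D ≠ 0) :
    Integrable (fun x => f x * gaussianPDFReal m D x) ↔ Integrable f (gaussianReal m D) := by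
  rw [gaussianReal_of_var_ne_zero _ hD, integrable_withDensity_iff (measurable_gaussianPDF m D)
    (ae_of_all _ fun _ => gaussianPDF_lt_top)]
  simp only [toReal_gaussianPDF]

lemma integrable_exp_abs_mul_gaussianPDFReal (c : ℝ) (D : ℝ≥0) :
    Integrable fun x => Real.exp (c * |x|) * gaussianPDFReal 0 D x := by
  -- the density with variance zero is the zero function
  rcases eq_or_ne D 0 with rfl | hD
  · simp
  · rw [integrable_mul_gaussianPDFReal_iff 0 hD]
    exact integrable_exp_mul_abs (integrable_exp_mul_gaussianReal c)
      (integrable_exp_mul_gaussianReal (-c))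

/-- Measurable nonnegative functions with at most exponential growth `exp (c |x|)`. The rate `c` is
kept by convolution with normal densities, and hence by the recursive equation. -/
structure IsExpBounded (c : ℝ) (f : ℝ → ℝ) : Prop where
  measurable : Measurable f
  nonneg : ∀ x, 0 ≤ f x
  le_exp : ∃ A, 0 ≤ A ∧ ∀ x, f x ≤ A * Real.exp (c * |x|)

namespace IsExpBounded

lemma le_exp_sub {c : ℝ} {f : ℝ → ℝ} (hc : 0 ≤ c) {A : ℝ} (hA : 0 ≤ A)
    (h : ∀ x, f x ≤ A * Real.exp (c * |x|))
    (U x : ℝ) : f (U - x) ≤ A * Real.exp (c * |U|) * Real.exp (c * |x|) := by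
  refine (h _).trans ?_
  rw [mul_assoc, ← Real.exp_add, ← mul_add]
  gcongr
  exact abs_sub _ _

lemma integrable {c : ℝ} {f : ℝ → ℝ} (hf : IsExpBounded c f) (hc : 0 ≤ c) (D : ℝ≥0) (U : ℝ) :
    Integrable fun x => f (U - x) * gaussianPDFReal 0 D x := by
  obtain ⟨A, hA, hle⟩ := hf.le_exp
  refine ((integrable_exp_abs_mul_gaussianPDFReal c D).const_mul (A * Real.exp (c * |U|))).mono'
    ((hf.measurable.comp (measurable_const.sub measurable_id)).mul
      (measurable_gaussianPDFReal 0 D)).aestronglyMeasurable (ae_of_all _ fun x => ?_)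
  rw [Real.norm_of_nonneg (mul_nonneg (hf.nonneg _) (gaussianPDFReal_nonneg _ _ _)), ← mul_assoc]
  exact mul_le_mul_of_nonneg_right (le_exp_sub hc hA hle U x) (gaussianPDFReal_nonneg _ _ _)

lemma convolution {c : ℝ} {f : ℝ → ℝ} (hf : IsExpBounded c f) (hc : 0 ≤ c) (D : ℝ≥0) :
    IsExpBounded c fun U => ∫ x, f (U - x) * gaussianPDFReal 0 D x := by
  refine ⟨?_, fun U => integral_nonneg fun x =>
    mul_nonneg (hf.nonneg _) (gaussianPDFReal_nonneg _ _ _), ?_⟩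
  · refine StronglyMeasurable.measurable (StronglyMeasurable.integral_prod_right'
      (f := fun p : ℝ × ℝ => f (p.1 - p.2) * gaussianPDFReal 0 D p.2) ?_)
    exact ((hf.measurable.comp (measurable_fst.sub measurable_snd)).mul
      ((measurable_gaussianPDFReal 0 D).comp measurable_snd)).stronglyMeasurable
  · obtain ⟨A, hA, hle⟩ := hf.le_exp
    have hI := integrable_exp_abs_mul_gaussianPDFReal c D
    refine ⟨A * ∫ x, Real.exp (c * |x|) * gaussianPDFReal 0 D x, mul_nonneg hA
      (integral_nonneg fun x => mul_nonneg (Real.exp_nonneg _) (gaussianPDFReal_nonneg _ _ _)),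
      fun U => ?_⟩
    calc _ ≤ ∫ x, A * Real.exp (c * |U|) * (Real.exp (c * |x|) * gaussianPDFReal 0 D x) := by
          refine integral_mono (hf.integrable hc D U) (hI.const_mul _) fun x => ?_
          simp only [← mul_assoc]
          exact mul_le_mul_of_nonneg_right (le_exp_sub hc hA hle U x)
            (gaussianPDFReal_nonneg _ _ _)
      _ = _ := by rw [integral_const_mul]; ring

lemma add {c : ℝ} {f f' : ℝ → ℝ} (hf : IsExpBounded c f) (hf' : IsExpBounded c f') :
    IsExpBounded c fun x => f x + f' x := by
  obtain ⟨A, hA, hle⟩ := hf.le_exp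
  obtain ⟨A', hA', hle'⟩ := hf'.le_exp
  refine ⟨hf.measurable.add hf'.measurable, fun x => add_nonneg (hf.nonneg x) (hf'.nonneg x),
    A + A', add_nonneg hA hA', fun x => ?_⟩
  rw [add_mul]
  exact add_le_add (hle x) (hle' x)

lemma const_mul {c : ℝ} {f : ℝ → ℝ} (hf : IsExpBounded c f) {a : ℝ} (ha : 0 ≤ a) :
    IsExpBounded c fun x => a * f x := by
  obtain ⟨A, hA, hle⟩ := hf.le_exp
  refine ⟨hf.measurable.const_mul a, fun x => mul_nonneg ha (hf.nonneg x), a * A, mul_nonneg ha hA,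
    fun x => ?_⟩
  rw [mul_assoc]
  exact mul_le_mul_of_nonneg_left (hle x) ha

lemma min {c : ℝ} {f f' : ℝ → ℝ} (hf : IsExpBounded c f) (hf' : IsExpBounded c f') :
    IsExpBounded c fun x => Min.min (f x) (f' x) := by
  obtain ⟨A, hA, hle⟩ := hf.le_exp
  exact ⟨hf.measurable.min hf'.measurable, fun x => le_min (hf.nonneg x) (hf'.nonneg x), A, hA,
    fun x => (min_le_left _ _).trans (hle x)⟩

lemma zero {c : ℝ} : IsExpBounded c fun _ => 0 :=
  ⟨measurable_const, fun _ => le_rfl, 0, le_rfl, fun x => by simp⟩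

/-- The convolution with a normal density, as a Lebesgue integral. -/
lemma ofReal_convolution {c : ℝ} {f : ℝ → ℝ}
    (hf : IsExpBounded c f) (hc : 0 ≤ c) {D : ℝ≥0} (hD : D ≠ 0) (U : ℝ) :
    ENNReal.ofReal (∫ x, f (U - x) * gaussianPDFReal 0 D x) =
      ∫⁻ x, ENNReal.ofReal (f (U - x)) ∂gaussianReal 0 D := by
  have hI := (integrable_mul_gaussianPDFReal_iff (f := fun x => f (U - x)) 0 hD).1
    (hf.integrable hc D U)
  rw [← ofReal_integral_eq_lintegral_ofReal hI (ae_of_all _ fun x => hf.nonneg _),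
    integral_gaussianReal_eq_integral_smul hD]
  simp_rw [smul_eq_mul, mul_comm]

end IsExpBounded

lemma IsSymmDensity.integrable {C : ℝ} {ρ : ℝ → ℝ} (hρ : IsSymmDensity C ρ) : Integrable ρ := by
  by_contra h
  have := hρ.integral_eq_one
  rw [integral_undef h] at this
  exact zero_ne_one this

/-- The exponential factor in `g`, `weight` and the likelihood, where `c` stands for
`2 n₁ n₂ / (n₁ + n₂)`. -/
lemma exp_le_of_mem {C U v c : ℝ} (hc : 0 ≤ c) (hv : |v| ≤ C) :
    Real.exp (2 * U * v - c * v ^ 2) ≤ Real.exp (2 * C * |U|) := by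
  refine Real.exp_le_exp.2 ?_
  have h1 : U * v ≤ |U| * C := (le_abs_self _).trans (by rw [abs_mul]; gcongr)
  have h2 : 0 ≤ c * v ^ 2 := by positivity
  linarith

/-- The integrand of `g`. -/
noncomputable def gIntegrand (ρ : ℝ → ℝ) (ℓ : Fin 2) (n₁ n₂ : ℕ) (U v : ℝ) : ℝ :=
  2 * v * Real.exp ((-1) ^ ((ℓ : ℕ) + 1) * 2 * U * v - 2 * v ^ 2 * n₁ * n₂ / (n₁ + n₂)) * ρ v

lemma g_eq_setIntegral {C : ℝ} (hC : 0 < C) (ρ : ℝ → ℝ) (ℓ : Fin 2) (U : ℝ) (n₁ n₂ : ℕ) :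
    g C ρ ℓ U n₁ n₂ = ∫ v in Set.Ioc 0 C, gIntegrand ρ ℓ n₁ n₂ U v := by
  rw [g, intervalIntegral.integral_of_le hC.le]
  rfl

lemma gIntegrand_nonneg {C : ℝ} {ρ : ℝ → ℝ} (hρ : IsSymmDensity C ρ) (ℓ : Fin 2) (n₁ n₂ : ℕ)
    (U : ℝ) {v : ℝ} (hv : 0 < v) : 0 ≤ gIntegrand ρ ℓ n₁ n₂ U v :=
  mul_nonneg (by positivity) (hρ.nonneg v)

lemma gIntegrand_le {C : ℝ} {ρ : ℝ → ℝ} (hρ : IsSymmDensity C ρ) (ℓ : Fin 2) (n₁ n₂ : ℕ) (U : ℝ)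
    {v : ℝ} (hv : v ∈ Set.Ioc 0 C) :
    gIntegrand ρ ℓ n₁ n₂ U v ≤ 2 * C * Real.exp (2 * C * |U|) * ρ v := by
  have hC : 0 < C := hv.1.trans_le hv.2
  refine mul_le_mul_of_nonneg_right ?_ (hρ.nonneg v)
  have h := exp_le_of_mem (C := C) (U := (-1) ^ ((ℓ : ℕ) + 1) * U) (v := v)
    (c := 2 * n₁ * n₂ / (n₁ + n₂)) (by positivity) (by rw [abs_of_pos hv.1]; exact hv.2)
  rw [abs_mul, abs_pow, abs_neg, abs_one, one_pow, one_mul] at h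
  refine mul_le_mul (by linarith [hv.2]) (le_trans (le_of_eq ?_) h) (by positivity)
    (by positivity)
  congr 1
  ring

lemma measurable_gIntegrand {ρ : ℝ → ℝ} (hρ : Measurable ρ) (ℓ : Fin 2) (n₁ n₂ : ℕ) :
    Measurable fun p : ℝ × ℝ => gIntegrand ρ ℓ n₁ n₂ p.1 p.2 :=
  Measurable.mul (by fun_prop) (hρ.comp measurable_snd)

lemma integrableOn_gIntegrand {C : ℝ} {ρ : ℝ → ℝ} (hρ : IsSymmDensity C ρ) (ℓ : Fin 2)
    (n₁ n₂ : ℕ) (U : ℝ) : IntegrableOn (gIntegrand ρ ℓ n₁ n₂ U) (Set.Ioc 0 C) := by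
  refine Integrable.mono' (hρ.integrable.const_mul (2 * C * Real.exp (2 * C * |U|))).integrableOn
    (Measurable.of_uncurry_left (f := gIntegrand ρ ℓ n₁ n₂)
      (measurable_gIntegrand hρ.measurable ℓ n₁ n₂)).aestronglyMeasurable ?_
  filter_upwards [ae_restrict_mem measurableSet_Ioc] with v hv
  exact (Real.norm_of_nonneg (gIntegrand_nonneg hρ _ _ _ U hv.1)).trans_le
    (gIntegrand_le hρ _ _ _ U hv)

lemma isExpBounded_g {C : ℝ} {ρ : ℝ → ℝ} (hC : 0 < C) (hρ : IsSymmDensity C ρ) (ℓ : Fin 2)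
    (n₁ n₂ : ℕ) : IsExpBounded (2 * C) fun U => g C ρ ℓ U n₁ n₂ := by
  simp only [g_eq_setIntegral hC]
  refine ⟨?_, fun U => ?_, 2 * C, by positivity, fun U => ?_⟩
  · exact (StronglyMeasurable.integral_prod_right' (ν := volume.restrict (Set.Ioc 0 C))
      (measurable_gIntegrand hρ.measurable ℓ n₁ n₂).stronglyMeasurable).measurable
  · exact setIntegral_nonneg measurableSet_Ioc fun v hv => gIntegrand_nonneg hρ _ _ _ U hv.1
  · have hI : Integrable fun v => 2 * C * Real.exp (2 * C * |U|) * ρ v := hρ.integrable.const_mul _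
    calc _ ≤ ∫ v in Set.Ioc 0 C, 2 * C * Real.exp (2 * C * |U|) * ρ v :=
          setIntegral_mono_on (integrableOn_gIntegrand hρ ℓ n₁ n₂ U) hI.integrableOn
            measurableSet_Ioc fun v hv => gIntegrand_le hρ _ _ _ U hv
      _ ≤ ∫ v, 2 * C * Real.exp (2 * C * |U|) * ρ v :=
          setIntegral_le_integral hI (ae_of_all _ fun v => mul_nonneg (by positivity) (hρ.nonneg v))
      _ = _ := by rw [integral_const_mul, hρ.integral_eq_one, mul_one]

/-- The functions of the recursive equation are measurable, nonnegative and of exponential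
growth. -/
lemma isExpBounded_R_and_RAction {M N : ℕ} {C : ℝ} {ρ : ℝ → ℝ} (hM : 0 < M) (hC : 0 < C)
    (hρ : IsSymmDensity C ρ) (d n₁ n₂ : ℕ) (hd : N ≤ n₁ + n₂ + d) :
    (∀ ℓ, IsExpBounded (2 * C) fun U => RAction M N C ρ ℓ U n₁ n₂) ∧
      IsExpBounded (2 * C) fun U => R M N C ρ U n₁ n₂ := by
  have key : ∀ n₁ n₂, (∀ ℓ, IsExpBounded (2 * C) fun U => RAction M N C ρ ℓ U n₁ n₂) →
      IsExpBounded (2 * C) fun U => R M N C ρ U n₁ n₂ := by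
    intro n₁ n₂ h
    simp only [R_eq_min hM]
    exact (h 0).min (h 1)
  induction d generalizing n₁ n₂ with
  | zero =>
    have h : ∀ ℓ, IsExpBounded (2 * C) fun U => RAction M N C ρ ℓ U n₁ n₂ := by
      intro ℓ
      have : ¬ n₁ + n₂ < N := by omega
      simp only [RAction, this, if_false]
      exact IsExpBounded.zero
    exact ⟨h, key _ _ h⟩
  | succ d ih =>
    have h : ∀ ℓ, IsExpBounded (2 * C) fun U => RAction M N C ρ ℓ U n₁ n₂ := by
      intro ℓ
      by_cases hN : n₁ + n₂ < N
      · simp only [RAction, hN, if_true]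
        refine ((isExpBounded_g hC hρ ℓ n₁ n₂).const_mul (Nat.cast_nonneg M)).add ?_
        have h1 := (ih (n₁ + M) n₂ (by omega)).2.convolution (by positivity)
          (stepVar M (n₁ + n₂) n₂)
        have h2 := (ih n₁ (n₂ + M) (by omega)).2.convolution (by positivity)
          (stepVar M (n₁ + n₂) n₁)
        by_cases hℓ : ℓ = 0
        · simpa only [hℓ, if_true] using h1
        · simpa only [hℓ, if_false] using h2
      · simp only [RAction, hN, if_false]
        exact IsExpBounded.zero
    exact ⟨h, key _ _ h⟩

lemma isExpBounded_R {M : ℕ} {C : ℝ} {ρ : ℝ → ℝ} (hM : 0 < M) (hC : 0 < C)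
    (hρ : IsSymmDensity C ρ) (N n₁ n₂ : ℕ) :
    IsExpBounded (2 * C) fun U => R M N C ρ U n₁ n₂ :=
  (isExpBounded_R_and_RAction hM hC hρ N n₁ n₂ (by omega)).2

lemma isExpBounded_RAction {M : ℕ} {C : ℝ} {ρ : ℝ → ℝ} (hM : 0 < M) (hC : 0 < C)
    (hρ : IsSymmDensity C ρ) (N : ℕ) (ℓ : Fin 2) (n₁ n₂ : ℕ) :
    IsExpBounded (2 * C) fun U => RAction M N C ρ ℓ U n₁ n₂ :=
  (isExpBounded_R_and_RAction hM hC hρ N n₁ n₂ (by omega)).1 ℓ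

/-! ### The flat prior -/

lemma lintegral_comp_two_mul (f : ℝ → ℝ≥0∞) (hf : Measurable f) :
    ∫⁻ x, f x = ∫⁻ v, 2 * f (2 * v) := by
  have h := Real.map_volume_mul_left (two_ne_zero (α := ℝ))
  have h2 : ∫⁻ v, f (2 * v) = ENNReal.ofReal |2⁻¹| * ∫⁻ x, f x := by
    rw [← lintegral_map hf (by fun_prop), h, lintegral_smul_measure, smul_eq_mul]
  rw [lintegral_const_mul _ (f := fun v => f (2 * v)) (hf.comp (by fun_prop)), h2, ← mul_assoc]
  have : (2 : ℝ≥0∞) * ENNReal.ofReal |2⁻¹| = 1 := by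
    rw [abs_of_pos (by norm_num), ENNReal.ofReal_inv_of_pos (by norm_num)]
    norm_num
    exact ENNReal.mul_inv_cancel (by norm_num) (by norm_num)
  rw [this, one_mul]

/-- The change of variables `θ = (m + v, m - v)`. -/
lemma lintegral_mean_diff {F : ℝ × ℝ → ℝ≥0∞} (hF : Measurable F) :
    ∫⁻ θ, F θ = ∫⁻ v, ∫⁻ m, 2 * F (m + v, m - v) := by
  have h1 : ∀ y, ∫⁻ x, F (x, y) = ∫⁻ v, 2 * F (y + 2 * v, y) := by
    intro y
    rw [← lintegral_add_left_eq_self (fun x => F (x, y)) y]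
    exact lintegral_comp_two_mul (fun x => F (y + x, y)) (by fun_prop)
  rw [Measure.volume_eq_prod, lintegral_prod_symm _ hF.aemeasurable]
  simp_rw [h1]
  rw [lintegral_lintegral_swap (by fun_prop)]
  refine lintegral_congr fun v => ?_
  rw [← lintegral_sub_right_eq_self (fun y => 2 * F (y + 2 * v, y)) v]
  refine lintegral_congr fun m => ?_
  ring_nf

/-- The prior that is uniform, with density one, for the values `m ∈ B` of the half-sum of the means
and has the density `ρ` for their half-difference, as a density in the two means. The improper flat
prior is `B = Set.univ`. -/
noncomputable def boxDensity (ρ : ℝ → ℝ) (B : Set ℝ) (θ : ℝ × ℝ) : ℝ≥0∞ :=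
  B.indicator 1 ((θ.1 + θ.2) / 2) * ENNReal.ofReal (ρ ((θ.1 - θ.2) / 2) / 2)

lemma measurable_boxDensity {ρ : ℝ → ℝ} (hρ : Measurable ρ) {B : Set ℝ} (hB : MeasurableSet B) :
    Measurable (boxDensity ρ B) := by
  refine Measurable.mul ?_ ?_
  · exact (measurable_one.indicator hB).comp (by fun_prop)
  · exact ((hρ.comp (by fun_prop)).div_const 2).ennreal_ofReal

lemma boxDensity_mono (ρ : ℝ → ℝ) {B B' : Set ℝ} (h : B ⊆ B') (θ : ℝ × ℝ) :
    boxDensity ρ B θ ≤ boxDensity ρ B' θ :=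
  mul_le_mul_left (Set.indicator_le_indicator_of_subset h (fun _ => zero_le) _) _

lemma boxDensity_eq_zero {C : ℝ} {ρ : ℝ → ℝ} (hρ : IsSymmDensity C ρ) (B : Set ℝ) {θ : ℝ × ℝ}
    (hθ : θ ∉ paramSet C) : boxDensity ρ B θ = 0 := by
  have h : C < |(θ.1 - θ.2) / 2| := by
    have : ¬ |θ.1 - θ.2| ≤ 2 * C := hθ
    rw [abs_div, abs_two]
    linarith
  simp [boxDensity, hρ.eq_zero _ h]

lemma lintegral_boxDensity {ρ : ℝ → ℝ} (hρ : Measurable ρ) {B : Set ℝ} (hB : MeasurableSet B)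
    {F : ℝ × ℝ → ℝ≥0∞} (hF : Measurable F) :
    ∫⁻ θ, F θ * boxDensity ρ B θ =
      ∫⁻ v, (∫⁻ m in B, F (m + v, m - v)) * ENNReal.ofReal (ρ v) := by
  rw [lintegral_mean_diff (F := fun θ => F θ * boxDensity ρ B θ)
    (hF.mul (measurable_boxDensity hρ hB))]
  refine lintegral_congr fun v => ?_
  rw [← lintegral_indicator hB, ← lintegral_mul_const _ (Measurable.indicator (by fun_prop) hB)]
  refine lintegral_congr fun m => ?_
  have h1 : (m + v + (m - v)) / 2 = m := by ring
  have h2 : (m + v - (m - v)) / 2 = v := by ring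
  have h3 : 2 * ENNReal.ofReal (ρ v / 2) = ENNReal.ofReal (ρ v) := by
    rw [ENNReal.ofReal_div_of_pos two_pos, ENNReal.ofReal_ofNat]
    exact ENNReal.mul_div_cancel (by norm_num) (by norm_num)
  simp only [boxDensity, h1, h2]
  by_cases hm : m ∈ B
  · simp only [Set.indicator_of_mem hm, Pi.one_apply, one_mul]
    rw [mul_left_comm, h3]
  · simp [Set.indicator_of_notMem hm]

/-- The statistic `U` of a state. -/
noncomputable def State.stat (s : State) : ℝ := BatchBandit.stat (s.2 0) (s.1 0) (s.2 1) (s.1 1)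

/-- The integral of `lik (m, m)` over all `m`: the posterior mass, not normalized, of the flat prior
if `ρ` is concentrated at `v = 0`. It is junk in the empty state, where this integral diverges. -/
noncomputable def flatMass (s : State) : ℝ :=
  √(2 * Real.pi / (s.1 0 + s.1 1)) * Real.exp ((s.2 0 + s.2 1) ^ 2 / (2 * (s.1 0 + s.1 1)))

lemma flatMass_pos {s : State} (hs : 0 < s.1 0 + s.1 1) : 0 < flatMass s := by
  have : (0 : ℝ) < s.1 0 + s.1 1 := by exact_mod_cast hs
  unfold flatMass
  positivity

/-- Completing the square in `m`. -/
lemma lik_eq_gaussianPDFReal {s : State} (hs : 0 < s.1 0 + s.1 1) (m v : ℝ) :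
    lik (m + v, m - v) s = flatMass s *
      Real.exp (2 * s.stat * v - 2 * v ^ 2 * s.1 0 * s.1 1 / (s.1 0 + s.1 1)) *
      gaussianPDFReal ((s.2 0 + s.2 1 - (s.1 0 - s.1 1) * v) / (s.1 0 + s.1 1))
        ((s.1 0 + s.1 1 : ℝ≥0)⁻¹) m := by
  have hn : (0 : ℝ) < s.1 0 + s.1 1 := by exact_mod_cast hs
  simp only [lik, flatMass, gaussianPDFReal, State.stat, BatchBandit.stat, Fin.sum_univ_two, mean]
  push_cast
  have h1 : √(2 * Real.pi / (s.1 0 + s.1 1 : ℝ)) * (√(2 * Real.pi * (s.1 0 + s.1 1 : ℝ)⁻¹))⁻¹ =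
      1 := by
    rw [← div_eq_mul_inv]
    exact mul_inv_cancel₀ (by positivity)
  rw [show ∀ a b c d e : ℝ, a * b * c * (d * e) = (a * d) * (b * c * e) by intros; ring, h1,
    one_mul, ← Real.exp_add, ← Real.exp_add]
  congr 1
  field_simp
  ring

lemma lintegral_lik {s : State} (hs : 0 < s.1 0 + s.1 1) (v : ℝ) :
    ∫⁻ m, ENNReal.ofReal (lik (m + v, m - v) s) = ENNReal.ofReal (flatMass s) *
      ENNReal.ofReal (Real.exp (2 * s.stat * v - 2 * v ^ 2 * s.1 0 * s.1 1 / (s.1 0 + s.1 1))) := by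
  have hD : ((s.1 0 + s.1 1 : ℝ≥0)⁻¹) ≠ 0 := by
    have : (0 : ℝ≥0) < s.1 0 + s.1 1 := by exact_mod_cast hs
    positivity
  simp_rw [lik_eq_gaussianPDFReal hs]
  have h0 := (flatMass_pos hs).le
  simp_rw [ENNReal.ofReal_mul (mul_nonneg h0 (Real.exp_nonneg _))]
  rw [lintegral_const_mul _ (measurable_gaussianPDFReal _ _).ennreal_ofReal,
    lintegral_gaussianPDFReal_eq_one _ hD, mul_one, ENNReal.ofReal_mul h0]

lemma ofReal_weight {C : ℝ} {ρ : ℝ → ℝ} (hC : 0 < C) (hρ : IsSymmDensity C ρ) (U : ℝ) (n₁ n₂ : ℕ) :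
    ENNReal.ofReal (weight C ρ U n₁ n₂) = ∫⁻ v,
      ENNReal.ofReal (Real.exp (2 * U * v - 2 * v ^ 2 * n₁ * n₂ / (n₁ + n₂))) *
        ENNReal.ofReal (ρ v) := by
  have hsupp : ∀ v, v ∉ Set.Icc (-C) C →
      Real.exp (2 * U * v - 2 * v ^ 2 * n₁ * n₂ / (n₁ + n₂)) * ρ v = 0 := by
    intro v hv
    rw [hρ.eq_zero v (not_le.1 fun h => hv (abs_le.1 h)), mul_zero]
  have hI : Integrable fun v => Real.exp (2 * U * v - 2 * v ^ 2 * n₁ * n₂ / (n₁ + n₂)) * ρ v := by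
    refine (hρ.integrable.const_mul (Real.exp (2 * C * |U|))).mono'
      (Measurable.mul (by fun_prop) hρ.measurable).aestronglyMeasurable (ae_of_all _ fun v => ?_)
    rw [Real.norm_of_nonneg (mul_nonneg (Real.exp_nonneg _) (hρ.nonneg v))]
    by_cases hv : |v| ≤ C
    · refine mul_le_mul_of_nonneg_right (le_trans (le_of_eq ?_) (exp_le_of_mem
        (c := 2 * n₁ * n₂ / (n₁ + n₂)) (by positivity) hv)) (hρ.nonneg v)
      congr 1
      ring
    · rw [hρ.eq_zero v (not_le.1 hv), mul_zero, mul_zero]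
  rw [weight, intervalIntegral.integral_of_le (by linarith), ← integral_Icc_eq_integral_Ioc,
    setIntegral_eq_integral_of_forall_compl_eq_zero hsupp, ofReal_integral_eq_lintegral_ofReal hI
      (ae_of_all _ fun v => mul_nonneg (Real.exp_nonneg _) (hρ.nonneg v))]
  simp_rw [ENNReal.ofReal_mul (Real.exp_nonneg _)]

lemma weight_pos {C : ℝ} {ρ : ℝ → ℝ} (hC : 0 < C) (hρ : IsSymmDensity C ρ) (U : ℝ) (n₁ n₂ : ℕ) :
    0 < weight C ρ U n₁ n₂ := by
  rw [← ENNReal.ofReal_pos, ofReal_weight hC hρ]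
  rw [lintegral_pos_iff_support (f := fun v => ENNReal.ofReal (Real.exp (2 * U * v -
      2 * v ^ 2 * n₁ * n₂ / (n₁ + n₂))) * ENNReal.ofReal (ρ v))
    (Measurable.mul (by fun_prop) hρ.measurable.ennreal_ofReal)]
  have h : (Function.support fun v => ENNReal.ofReal (Real.exp (2 * U * v -
      2 * v ^ 2 * n₁ * n₂ / (n₁ + n₂))) * ENNReal.ofReal (ρ v)) =
      Function.support fun v => ENNReal.ofReal (ρ v) := by
    ext v
    simp [Real.exp_pos]
  rw [h, ← lintegral_pos_iff_support hρ.measurable.ennreal_ofReal,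
    ← ofReal_integral_eq_lintegral_ofReal hρ.integrable (ae_of_all _ hρ.nonneg),
    hρ.integral_eq_one]
  simp

lemma regret_mean_diff (m v : ℝ) (ℓ : Fin 2) :
    regret (m + v, m - v) ℓ = max 0 (2 * ((-1) ^ ((ℓ : ℕ) + 1) * v)) := by
  fin_cases ℓ <;> simp only [regret, mean] <;> rcases le_total 0 v with h | h
  · rw [max_eq_left (by linarith), max_eq_left (by simp; linarith)]; simp
  · rw [max_eq_right (by linarith), max_eq_right (by simp; linarith)]; simp; ring
  · rw [max_eq_left (by linarith), max_eq_right (by simp; linarith)]; simp; ring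
  · rw [max_eq_right (by linarith), max_eq_left (by simp; linarith)]; simp

lemma ofReal_g {C : ℝ} {ρ : ℝ → ℝ} (hC : 0 < C) (hρ : IsSymmDensity C ρ) (ℓ : Fin 2) (U : ℝ)
    (n₁ n₂ : ℕ) :
    ENNReal.ofReal (g C ρ ℓ U n₁ n₂) = ∫⁻ v,
      ENNReal.ofReal (max 0 (2 * ((-1) ^ ((ℓ : ℕ) + 1) * v))) *
      ENNReal.ofReal (Real.exp (2 * U * v - 2 * v ^ 2 * n₁ * n₂ / (n₁ + n₂))) *
        ENNReal.ofReal (ρ v) := by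
  have hsq : ((-1 : ℝ) ^ ((ℓ : ℕ) + 1)) * (-1) ^ ((ℓ : ℕ) + 1) = 1 := by
    rw [← mul_pow]; simp
  -- the substitution `v ↦ (-1) ^ (ℓ + 1) v`, which preserves `ρ`
  have hsub : ∀ f : ℝ → ℝ≥0∞, ∫⁻ v, f ((-1) ^ ((ℓ : ℕ) + 1) * v) = ∫⁻ v, f v := by
    intro f
    fin_cases ℓ
    · simpa using (lintegral_neg_eq_self f)
    · simp
  have hρs : ∀ v, ρ ((-1) ^ ((ℓ : ℕ) + 1) * v) = ρ v := by
    intro v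
    fin_cases ℓ
    · simpa using hρ.symm v
    · simp
  rw [← hsub, g_eq_setIntegral hC, ofReal_integral_eq_lintegral_ofReal
    (integrableOn_gIntegrand hρ ℓ n₁ n₂ U) ?_, ← lintegral_indicator measurableSet_Ioc]
  swap
  · filter_upwards [ae_restrict_mem measurableSet_Ioc] with v hv
    exact gIntegrand_nonneg hρ _ _ _ U hv.1
  refine lintegral_congr fun v => ?_
  simp only [hρs]
  rw [← mul_assoc ((-1 : ℝ) ^ _) _ v, hsq, one_mul]
  by_cases hv : v ∈ Set.Ioc 0 C
  · rw [Set.indicator_of_mem hv, max_eq_right (by linarith [hv.1]), gIntegrand,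
      ENNReal.ofReal_mul (mul_nonneg (by linarith [hv.1]) (Real.exp_nonneg _)),
      ENNReal.ofReal_mul (by linarith [hv.1])]
    congr 4
    rw [mul_pow, sq ((-1 : ℝ) ^ _), hsq]
    ring
  · rw [Set.indicator_of_notMem hv]
    rcases le_or_gt v 0 with h | h
    · rw [max_eq_left (by linarith)]; simp
    · have : C < v := not_le.1 fun h' => hv ⟨h, h'⟩
      rw [hρ.eq_zero v (this.trans_le (le_abs_self v))]; simp

/-- The posterior mass for the flat prior: it is given by `weight`. -/
lemma mass_flat {C : ℝ} {ρ : ℝ → ℝ} (hC : 0 < C) (hρ : IsSymmDensity C ρ) {s : State}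
    (hs : 0 < s.1 0 + s.1 1) : mass (boxDensity ρ Set.univ) s =
      ENNReal.ofReal (flatMass s) * ENNReal.ofReal (weight C ρ s.stat (s.1 0) (s.1 1)) := by
  rw [mass, lintegral_boxDensity hρ.measurable MeasurableSet.univ
    (measurable_lik_left s).ennreal_ofReal, ofReal_weight hC hρ,
    ← lintegral_const_mul' _ _ ENNReal.ofReal_ne_top]
  simp only [Measure.restrict_univ, lintegral_lik hs, mul_assoc]

/-- The expected regrets for the flat prior: they are given by `g`. -/
lemma cost_flat {C : ℝ} {ρ : ℝ → ℝ} (hC : 0 < C) (hρ : IsSymmDensity C ρ) (ℓ : Fin 2) {s : State}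
    (hs : 0 < s.1 0 + s.1 1) : cost (boxDensity ρ Set.univ) ℓ s =
      ENNReal.ofReal (flatMass s) * ENNReal.ofReal (g C ρ ℓ s.stat (s.1 0) (s.1 1)) := by
  rw [cost, lintegral_boxDensity (F := fun θ => ENNReal.ofReal (regret θ ℓ) *
    ENNReal.ofReal (lik θ s)) hρ.measurable MeasurableSet.univ
    ((measurable_regret ℓ).ennreal_ofReal.mul (measurable_lik_left s).ennreal_ofReal),
    ofReal_g hC hρ, ← lintegral_const_mul' _ _ ENNReal.ofReal_ne_top]
  refine lintegral_congr fun v => ?_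
  simp only [regret_mean_diff, Measure.restrict_univ]
  rw [lintegral_const_mul' _ _ ENNReal.ofReal_ne_top, lintegral_lik hs]
  ring

/-- The expected regret of one income in the prior. -/
lemma cost_boxDensity_zero {C : ℝ} {ρ : ℝ → ℝ} (hC : 0 < C) (hρ : IsSymmDensity C ρ) (ℓ : Fin 2)
    {B : Set ℝ} (hB : MeasurableSet B) : cost (boxDensity ρ B) ℓ 0 =
      volume B * ENNReal.ofReal (g C ρ ℓ 0 0 0) := by
  rw [cost, lintegral_boxDensity (F := fun θ => ENNReal.ofReal (regret θ ℓ) *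
    ENNReal.ofReal (lik θ 0)) hρ.measurable hB
    ((measurable_regret ℓ).ennreal_ofReal.mul (measurable_lik_left 0).ennreal_ofReal),
    ofReal_g hC hρ, ← lintegral_const_mul _ ?_]
  · refine lintegral_congr fun v => ?_
    simp [regret_mean_diff]
    ring
  · exact ((by fun_prop : Measurable fun v : ℝ => ENNReal.ofReal
      (max 0 (2 * ((-1) ^ ((ℓ : ℕ) + 1) * v)))).mul (by fun_prop)).mul
      hρ.measurable.ennreal_ofReal

lemma mass_boxDensity_zero {C : ℝ} {ρ : ℝ → ℝ} (hρ : IsSymmDensity C ρ)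
    {B : Set ℝ} (hB : MeasurableSet B) : mass (boxDensity ρ B) 0 = volume B := by
  rw [mass, lintegral_boxDensity hρ.measurable hB (measurable_lik_left 0).ennreal_ofReal]
  have h : ∫⁻ v, ENNReal.ofReal (ρ v) = 1 := by
    rw [← ofReal_integral_eq_lintegral_ofReal hρ.integrable (ae_of_all _ hρ.nonneg),
      hρ.integral_eq_one, ENNReal.ofReal_one]
  simp only [lik_zero, ENNReal.ofReal_one, lintegral_const, one_mul, Measure.restrict_apply_univ]
  rw [lintegral_const_mul _ hρ.measurable.ennreal_ofReal, h, mul_one]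

/-! ### Optimal costs for the flat prior -/

lemma lintegral_gaussianReal (m : ℝ) {D : ℝ≥0} (hD : D ≠ 0) {F : ℝ → ℝ≥0∞} (hF : Measurable F) :
    ∫⁻ x, F x ∂gaussianReal m D = ∫⁻ x, ENNReal.ofReal (gaussianPDFReal m D x) * F x := by
  rw [gaussianReal_of_var_ne_zero _ hD,
    lintegral_withDensity_eq_lintegral_mul _ (measurable_gaussianPDF m D) hF]
  rfl

lemma step_count_sum (M : ℕ) (ℓ : Fin 2) (x : ℝ) (s : State) :
    (s.step M ℓ x).1 0 + (s.step M ℓ x).1 1 = s.1 0 + s.1 1 + M := by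
  fin_cases ℓ <;> simp [State.step] <;> omega

lemma step_income_sum (M : ℕ) (ℓ : Fin 2) (x : ℝ) (s : State) :
    (s.step M ℓ x).2 0 + (s.step M ℓ x).2 1 = s.2 0 + s.2 1 + x := by
  fin_cases ℓ <;> simp [State.step] <;> ring

/-- For the flat prior and `v = 0`, the total income of the next packet is normal, with the
posterior mean of `m` per income. -/
lemma flatMass_step {M : ℕ} (hM : 0 < M) {s : State} (hs : 0 < s.1 0 + s.1 1) (ℓ : Fin 2) (x : ℝ) :
    flatMass (s.step M ℓ x) * gaussianPDFReal 0 M x = flatMass s *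
      gaussianPDFReal (M * (s.2 0 + s.2 1) / (s.1 0 + s.1 1))
        (M * (s.1 0 + s.1 1 + M) / (s.1 0 + s.1 1)) x := by
  have hn : (0 : ℝ) < s.1 0 + s.1 1 := by exact_mod_cast hs
  have hM' : (0 : ℝ) < M := by exact_mod_cast hM
  have h1 : ((s.step M ℓ x).1 0 + (s.step M ℓ x).1 1 : ℝ) = s.1 0 + s.1 1 + M := by
    exact_mod_cast step_count_sum M ℓ x s
  simp only [flatMass, gaussianPDFReal, h1, step_income_sum]
  push_cast
  generalize s.2 0 + s.2 1 = X
  generalize (s.1 0 + s.1 1 : ℝ) = n at *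
  have h2 : √(2 * Real.pi / (n + M)) * (√(2 * Real.pi * M))⁻¹ =
      √(2 * Real.pi / n) * (√(2 * Real.pi * (M * (n + M) / n)))⁻¹ := by
    rw [← div_eq_mul_inv, ← div_eq_mul_inv, ← Real.sqrt_div (by positivity),
      ← Real.sqrt_div (by positivity)]
    congr 1
    field_simp
  rw [show ∀ a b c d : ℝ, a * b * (c * d) = (a * c) * (b * d) by intros; ring, h2,
    ← Real.exp_add, show ∀ a b c d : ℝ, a * b * (c * d) = (a * c) * (b * d) by intros; ring,
    ← Real.exp_add]
  congr 2
  field_simp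
  ring

/-- For the flat prior and `v = 0`, the statistic `U` performs a random walk with normal increments.
Their variance `stepVar` is that of the recursive equation. -/
lemma lintegral_flatMass_step {M : ℕ} (hM : 0 < M) {s : State} (hs : 0 < s.1 0 + s.1 1) (ℓ : Fin 2)
    {F : ℝ → ℝ≥0∞} (hF : Measurable F) :
    ∫⁻ x, ENNReal.ofReal (flatMass (s.step M ℓ x)) * F (s.step M ℓ x).stat ∂gaussianReal 0 M =
      ENNReal.ofReal (flatMass s) *
        ∫⁻ u, F (s.stat - u) ∂gaussianReal 0 (stepVar M (s.1 0 + s.1 1) (s.1 (1 - ℓ))) := by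
  have hn : (0 : ℝ) < s.1 0 + s.1 1 := by exact_mod_cast hs
  have hn' : (0 : ℝ≥0) < s.1 0 + s.1 1 := by exact_mod_cast hs
  have hM' : (0 : ℝ) < M := by exact_mod_cast hM
  have hM'' : (M : ℝ≥0) ≠ 0 := by exact_mod_cast hM.ne'
  set D : ℝ≥0 := M * (s.1 0 + s.1 1 + M) / (s.1 0 + s.1 1) with hD
  have hD0 : D ≠ 0 := by positivity
  set μ : ℝ := M * (s.2 0 + s.2 1) / (s.1 0 + s.1 1) with hμ
  set c : ℝ := (-1) ^ ((ℓ : ℕ) + 1) * s.1 (1 - ℓ) / (s.1 0 + s.1 1 + M) with hc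
  have hstat : ∀ x, (s.step M ℓ x).stat = s.stat - c * (x - μ) := by
    intro x
    fin_cases ℓ <;>
      simp [State.stat, BatchBandit.stat, State.step, hc, hμ] <;> field_simp <;> ring
  have hmap : (gaussianReal μ D).map (fun x => c * (x - μ)) =
      gaussianReal 0 (stepVar M (s.1 0 + s.1 1) (s.1 (1 - ℓ))) := by
    have h1 : (fun x => c * (x - μ)) = (fun x => c * x) ∘ (fun x => x - μ) := rfl
    rw [h1, ← Measure.map_map (by fun_prop) (by fun_prop), gaussianReal_map_sub_const,
      gaussianReal_map_const_mul, sub_self, mul_zero]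
    congr 1
    refine NNReal.coe_injective ?_
    rw [stepVar]
    push_cast
    have hsq : ((-1 : ℝ) ^ ((ℓ : ℕ) + 1)) ^ 2 = 1 := by rw [← pow_mul, pow_mul']; simp
    rw [hc, hD]
    push_cast
    rw [div_pow, mul_pow, hsq]
    field_simp
  have hF' : Measurable fun x => F (s.stat - c * (x - μ)) := hF.comp (by fun_prop)
  rw [← hmap, lintegral_map (f := fun u => F (s.stat - u)) (hF.comp (by fun_prop)) (by fun_prop),
    lintegral_gaussianReal μ hD0 hF']
  simp only [hstat]
  have hfm : Measurable fun x => flatMass (s.step M ℓ x) := by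
    simp only [flatMass, step_income_sum]
    have h1 : ∀ x, ((s.step M ℓ x).1 0 + (s.step M ℓ x).1 1 : ℝ) = s.1 0 + s.1 1 + M := fun x => by
      exact_mod_cast step_count_sum M ℓ x s
    simp only [h1]
    fun_prop
  rw [lintegral_gaussianReal 0 hM''
    (F := fun x => ENNReal.ofReal (flatMass (s.step M ℓ x)) * F (s.stat - c * (x - μ)))
    (hfm.ennreal_ofReal.mul hF'), ← lintegral_const_mul' _ _ ENNReal.ofReal_ne_top]
  refine lintegral_congr fun x => ?_
  rw [← mul_assoc, ← mul_assoc, ← ENNReal.ofReal_mul (gaussianPDFReal_nonneg _ _ _),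
    ← ENNReal.ofReal_mul (flatMass_pos hs).le, mul_comm (gaussianPDFReal 0 _ x),
    flatMass_step hM hs]

lemma stepVar_ne_zero {M n n_o : ℕ} (hM : 0 < M) (hn : 0 < n) (ho : 0 < n_o) :
    stepVar M n n_o ≠ 0 := by
  have h1 : (0 : ℝ≥0) < M := by exact_mod_cast hM
  have h2 : (0 : ℝ≥0) < n := by exact_mod_cast hn
  have h3 : (0 : ℝ≥0) < n_o := by exact_mod_cast ho
  unfold stepVar
  positivity

lemma step_count (M : ℕ) (ℓ : Fin 2) (x : ℝ) (s : State) :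
    (s.step M ℓ x).1 = s.1 + Pi.single ℓ M := rfl

/-- One step of the recursive equation. Only the other action has to be present in the state: the
variance of the step of `U` then does not vanish. -/
lemma actionValue_flat_of_value {M : ℕ} (hM : 0 < M) {C : ℝ} (hC : 0 < C) {ρ : ℝ → ℝ}
    (hρ : IsSymmDensity C ρ) (N r : ℕ) (ℓ : Fin 2) {s : State} (hs : 0 < s.1 (1 - ℓ))
    (hN : s.1 0 + s.1 1 < N)
    (hval : ∀ x, value M (cost (boxDensity ρ Set.univ)) r (s.step M ℓ x) =
      ENNReal.ofReal (flatMass (s.step M ℓ x)) * ENNReal.ofReal (R M N C ρ (s.step M ℓ x).stat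
        ((s.step M ℓ x).1 0) ((s.step M ℓ x).1 1))) :
    actionValue M (cost (boxDensity ρ Set.univ)) ℓ r s = ENNReal.ofReal (flatMass s) *
      ENNReal.ofReal (RAction M N C ρ ℓ s.stat (s.1 0) (s.1 1)) := by
  have hn : 0 < s.1 0 + s.1 1 := by
    fin_cases ℓ <;> simp at hs <;> omega
  have hC2 : (0 : ℝ) ≤ 2 * C := by positivity
  have hR := isExpBounded_R hM hC hρ N ((s.1 + Pi.single ℓ M : Fin 2 → ℕ) 0)
    ((s.1 + Pi.single ℓ M : Fin 2 → ℕ) 1)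
  rw [actionValue, cost_flat hC hρ ℓ hn]
  simp only [hval, step_count]
  rw [lintegral_flatMass_step hM hn ℓ hR.measurable.ennreal_ofReal,
    mul_left_comm, ← mul_add]
  congr 1
  rw [← hR.ofReal_convolution hC2 (stepVar_ne_zero hM hn hs), ← ENNReal.ofReal_natCast,
    ← ENNReal.ofReal_mul (Nat.cast_nonneg M), ← ENNReal.ofReal_add
    (mul_nonneg (Nat.cast_nonneg M) ((isExpBounded_g hC hρ _ _ _).nonneg _))
    ((hR.convolution hC2 _).nonneg _), RAction, if_pos hN]
  congr 2
  fin_cases ℓ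
  · simp
  · simp

/-- The optimal costs for the flat prior solve the recursive equation. -/
lemma value_flat {M : ℕ} (hM : 0 < M) {C : ℝ} (hC : 0 < C) {ρ : ℝ → ℝ}
    (hρ : IsSymmDensity C ρ) (N r : ℕ) (s : State) (h0 : 0 < s.1 0) (h1 : 0 < s.1 1)
    (hN : s.1 0 + s.1 1 + r * M = N) :
    value M (cost (boxDensity ρ Set.univ)) r s = ENNReal.ofReal (flatMass s) *
      ENNReal.ofReal (R M N C ρ s.stat (s.1 0) (s.1 1)) := by
  induction r generalizing s with
  | zero =>
    have : ¬ (s.1 0 + s.1 1 < N ∧ 0 < M) := by omega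
    rw [R, dif_neg this, ENNReal.ofReal_zero, mul_zero]
    rfl
  | succ r ih =>
    have hlt : s.1 0 + s.1 1 < N := by
      have : 0 < (r + 1) * M := by positivity
      omega
    have hℓ : ∀ ℓ, actionValue M (cost (boxDensity ρ Set.univ)) ℓ r s =
        ENNReal.ofReal (flatMass s) *
          ENNReal.ofReal (RAction M N C ρ ℓ s.stat (s.1 0) (s.1 1)) := by
      intro ℓ
      refine actionValue_flat_of_value hM hC hρ N r ℓ ?_ hlt fun x => ih _ ?_ ?_ ?_
      · fin_cases ℓ
        exacts [h1, h0]
      · exact h0.trans_le (by simp [step_count])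
      · exact h1.trans_le (by simp [step_count])
      · rw [step_count_sum, ← hN]
        ring
    rw [value_succ, hℓ, hℓ, ← mul_min, ← (ENNReal.ofReal_mono).map_min, ← R_eq_min hM]

lemma actionValue_flat {M : ℕ} (hM : 0 < M) {C : ℝ} (hC : 0 < C) {ρ : ℝ → ℝ}
    (hρ : IsSymmDensity C ρ) (N r : ℕ) (ℓ : Fin 2) (s : State) (h0 : 0 < s.1 0) (h1 : 0 < s.1 1)
    (hN : s.1 0 + s.1 1 + (r + 1) * M = N) :
    actionValue M (cost (boxDensity ρ Set.univ)) ℓ r s = ENNReal.ofReal (flatMass s) *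
      ENNReal.ofReal (RAction M N C ρ ℓ s.stat (s.1 0) (s.1 1)) := by
  have hlt : s.1 0 + s.1 1 < N := by
    have : 0 < (r + 1) * M := by positivity
    omega
  refine actionValue_flat_of_value hM hC hρ N r ℓ ?_ hlt fun x =>
    value_flat hM hC hρ N r _ ?_ ?_ ?_
  · fin_cases ℓ
    exacts [h1, h0]
  · exact h0.trans_le (by simp [step_count])
  · exact h1.trans_le (by simp [step_count])
  · rw [step_count_sum, ← hN]
    ring

/-! ### The second packet -/

lemma g_zero_of_mul_eq_zero (C : ℝ) (ρ : ℝ → ℝ) (ℓ : Fin 2) {n₁ n₂ : ℕ} (h : n₁ * n₂ = 0) :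
    g C ρ ℓ 0 n₁ n₂ = 2 * ∫ v in (0 : ℝ)..C, v * ρ v := by
  have h' : (n₁ : ℝ) * n₂ = 0 := by exact_mod_cast h
  rw [g, ← intervalIntegral.integral_const_mul]
  refine intervalIntegral.integral_congr fun v _ => ?_
  simp only [mul_assoc, h']
  simp

/-- The limiting Bayesian risk of the `K - 1` packets after the first one. -/
noncomputable def secondRisk (M K : ℕ) (C : ℝ) (ρ : ℝ → ℝ) : ℝ :=
  2 * M * (∫ v in (0 : ℝ)..C, v * ρ v) +
    ∫ U, R M (K * M) C ρ U M M * gaussianPDFReal 0 ((M : ℝ≥0) / 2) U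

lemma stepVar_self {M : ℕ} (hM : 0 < M) : stepVar M M M = (M : ℝ≥0) / 2 := by
  have : (M : ℝ≥0) ≠ 0 := by exact_mod_cast hM.ne'
  unfold stepVar
  field_simp
  ring

/-- The recursive equation is also meaningful for the other action after one packet, where `U = 0`
and the statistic makes its first step, with variance `M / 2`. -/
lemma RAction_other_eq_secondRisk {M K : ℕ} (hM : 0 < M) (hK : 2 ≤ K) (C : ℝ) (ρ : ℝ → ℝ)
    (ℓ : Fin 2) : RAction M (K * M) C ρ (1 - ℓ) 0 ((Pi.single ℓ M : Fin 2 → ℕ) 0)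
      ((Pi.single ℓ M : Fin 2 → ℕ) 1) = secondRisk M K C ρ := by
  have hlt : M < K * M := by nlinarith
  have hint : ∫ x, R M (K * M) C ρ (0 - x) M M * gaussianPDFReal 0 ((M : ℝ≥0) / 2) x =
      ∫ U, R M (K * M) C ρ U M M * gaussianPDFReal 0 ((M : ℝ≥0) / 2) U := by
    rw [← integral_neg_eq_self]
    refine integral_congr_ae (ae_of_all _ fun x => ?_)
    simp [gaussianPDFReal]
  rw [secondRisk, ← hint]
  fin_cases ℓ
  · simp [RAction, hlt, g_zero_of_mul_eq_zero, stepVar_self hM]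
    ring
  · simp [RAction, hlt, g_zero_of_mul_eq_zero, stepVar_self hM]
    ring

lemma step_zero (M : ℕ) (ℓ : Fin 2) (x : ℝ) :
    State.step M ℓ x 0 = (Pi.single ℓ M, Pi.single ℓ x) := by
  simp [State.step]

lemma stat_step_zero (M : ℕ) (ℓ : Fin 2) (x : ℝ) : (State.step M ℓ x 0).stat = 0 := by
  fin_cases ℓ <;> simp [step_zero, State.stat, BatchBandit.stat]

/-- After one packet it is optimal, for the flat prior, to apply the other action: as long as only
one action has been applied, both actions have the same expected regret. -/
lemma actionValue_flat_other_le {M : ℕ} (hM : 0 < M) {C : ℝ} (hC : 0 < C) {ρ : ℝ → ℝ}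
    (hρ : IsSymmDensity C ρ) (ℓ : Fin 2) (r : ℕ) (x : ℝ) :
    actionValue M (cost (boxDensity ρ Set.univ)) (1 - ℓ) r (State.step M ℓ x 0) ≤
      actionValue M (cost (boxDensity ρ Set.univ)) ℓ r (State.step M ℓ x 0) := by
  have hne : (1 - ℓ) ≠ ℓ := by revert ℓ; decide
  refine actionValue_le_of_last hM (measurable_boxDensity hρ.measurable MeasurableSet.univ) ℓ
    {s | 0 < s.1 ℓ ∧ s.1 (1 - ℓ) = 0 ∧ s.2 (1 - ℓ) = 0} ?_ ?_ r _ ?_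
  · rintro s ⟨h1, h2, h3⟩ x
    refine ⟨?_, ?_, ?_⟩
    · simp [State.step, h1]
    · simp [State.step, h2, hne]
    · simp [State.step, h3, hne]
  · rintro s ⟨h1, h2, h3⟩
    have hn : 0 < s.1 0 + s.1 1 := by fin_cases ℓ <;> simp at h1 <;> omega
    have hU : s.stat = 0 := by
      fin_cases ℓ <;> simp at h2 h3 <;> simp [State.stat, BatchBandit.stat, h2, h3]
    have h0 : s.1 0 * s.1 1 = 0 := by
      fin_cases ℓ <;> simp at h2 <;> simp [h2]
    rw [cost_flat hC hρ _ hn, cost_flat hC hρ _ hn, hU, g_zero_of_mul_eq_zero C ρ _ h0,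
      g_zero_of_mul_eq_zero C ρ _ h0]
  · simp [step_zero, hM, hne]

lemma actionValue_flat_second {M r : ℕ} (hM : 0 < M) {C : ℝ} (hC : 0 < C) {ρ : ℝ → ℝ}
    (hρ : IsSymmDensity C ρ) (ℓ : Fin 2) (x : ℝ) :
    actionValue M (cost (boxDensity ρ Set.univ)) (1 - ℓ) r (State.step M ℓ x 0) =
      ENNReal.ofReal (flatMass (State.step M ℓ x 0)) *
        ENNReal.ofReal (secondRisk M (r + 2) C ρ) := by
  have h1 : (1 - (1 - ℓ)) = ℓ := by revert ℓ; decide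
  have hlt : M < (r + 2) * M := by nlinarith
  have hsum := step_count_sum M ℓ x 0
  simp only [Prod.fst_zero, Pi.zero_apply, zero_add] at hsum
  rw [actionValue_flat_of_value hM hC hρ ((r + 2) * M) r (1 - ℓ) (by simp [h1, step_zero, hM])
    (by rw [hsum]; exact hlt), stat_step_zero, step_zero,
    RAction_other_eq_secondRisk hM (by omega) C ρ ℓ]
  intro y
  refine value_flat hM hC hρ _ r _ ?_ ?_ ?_
  · fin_cases ℓ <;> simp [State.step, hM]
  · fin_cases ℓ <;> simp [State.step, hM]
  · rw [step_count_sum, hsum]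
    ring

lemma value_flat_second {M r : ℕ} (hM : 0 < M) {C : ℝ} (hC : 0 < C) {ρ : ℝ → ℝ}
    (hρ : IsSymmDensity C ρ) (ℓ : Fin 2) (x : ℝ) :
    value M (cost (boxDensity ρ Set.univ)) (r + 1) (State.step M ℓ x 0) =
      ENNReal.ofReal (flatMass (State.step M ℓ x 0)) *
        ENNReal.ofReal (secondRisk M (r + 2) C ρ) := by
  rw [value_eq_min_other M _ ℓ, min_eq_right (actionValue_flat_other_le hM hC hρ ℓ r x),
    actionValue_flat_second hM hC hρ]

/-! ### Truncation of the flat prior -/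

lemma tendsto_lintegral_boxDensity {ρ : ℝ → ℝ} (hρ : Measurable ρ) {F : ℝ × ℝ → ℝ≥0∞}
    (hF : Measurable F) (hfin : ∫⁻ θ, F θ * boxDensity ρ Set.univ θ ≠ ∞) :
    Tendsto (fun a => ∫⁻ θ, F θ * boxDensity ρ (Set.Icc (-a) a) θ) atTop
      (𝓝 (∫⁻ θ, F θ * boxDensity ρ Set.univ θ)) := by
  refine tendsto_lintegral_filter_of_dominated_convergence
    (fun θ => F θ * boxDensity ρ Set.univ θ)
    (Eventually.of_forall fun a => hF.mul (measurable_boxDensity hρ measurableSet_Icc))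
    (Eventually.of_forall fun a => ae_of_all _ fun θ =>
      mul_le_mul_right (boxDensity_mono ρ (Set.subset_univ _) θ) _) hfin
    (ae_of_all _ fun θ => ?_)
  refine tendsto_const_nhds.congr' ?_
  filter_upwards [eventually_ge_atTop |(θ.1 + θ.2) / 2|] with a ha
  simp only [boxDensity]
  rw [Set.indicator_of_mem (Set.mem_univ _),
    Set.indicator_of_mem (show (θ.1 + θ.2) / 2 ∈ Set.Icc (-a) a from abs_le.1 ha)]

lemma mass_mono {lam lam' : ℝ × ℝ → ℝ≥0∞} (h : ∀ θ, lam θ ≤ lam' θ) (s : State) :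
    mass lam s ≤ mass lam' s :=
  lintegral_mono fun θ => mul_le_mul_right (h θ) _

lemma cost_mono {lam lam' : ℝ × ℝ → ℝ≥0∞} (h : ∀ θ, lam θ ≤ lam' θ) (ℓ : Fin 2) (s : State) :
    cost lam ℓ s ≤ cost lam' ℓ s :=
  lintegral_mono fun θ => mul_le_mul_right (h θ) _

lemma mass_flat_ne_top {C : ℝ} {ρ : ℝ → ℝ} (hC : 0 < C) (hρ : IsSymmDensity C ρ) {s : State}
    (hs : 0 < s.1 0 + s.1 1) : mass (boxDensity ρ Set.univ) s ≠ ∞ := by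
  rw [mass_flat hC hρ hs]
  exact ENNReal.mul_ne_top ENNReal.ofReal_ne_top ENNReal.ofReal_ne_top

lemma tendsto_mass_box {C : ℝ} {ρ : ℝ → ℝ} (hC : 0 < C) (hρ : IsSymmDensity C ρ) {s : State}
    (hs : 0 < s.1 0 + s.1 1) : Tendsto (fun a => mass (boxDensity ρ (Set.Icc (-a) a)) s) atTop
      (𝓝 (mass (boxDensity ρ Set.univ) s)) :=
  tendsto_lintegral_boxDensity hρ.measurable (measurable_lik_left s).ennreal_ofReal
    (mass_flat_ne_top hC hρ hs)

lemma actionValue_flat_ne_top {M : ℕ} (hM : 0 < M) {C : ℝ} (hC : 0 < C) {ρ : ℝ → ℝ}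
    (hρ : IsSymmDensity C ρ) (ℓ : Fin 2) (r : ℕ) {s : State} (hs : 0 < s.1 0 + s.1 1) :
    actionValue M (cost (boxDensity ρ Set.univ)) ℓ r s ≠ ∞ := by
  have hm := measurable_boxDensity hρ.measurable MeasurableSet.univ
  refine ne_top_of_le_ne_top ?_ (actionValue_le_martingale (measurable_mass hm)
    (ENNReal.ofReal (2 * C)) (cost_le_mass fun θ hθ => boxDensity_eq_zero hρ _ hθ)
    (lintegral_mass_step hM hm) ℓ r s)
  refine ENNReal.mul_ne_top (ENNReal.mul_ne_top (by simp)
    (ENNReal.mul_ne_top (by simp) ENNReal.ofReal_ne_top)) (mass_flat_ne_top hC hρ hs)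

lemma tendsto_cost_box {C : ℝ} {ρ : ℝ → ℝ} (hC : 0 < C) (hρ : IsSymmDensity C ρ) {s : State}
    (hs : 0 < s.1 0 + s.1 1) (ℓ : Fin 2) :
    Tendsto (fun a => cost (boxDensity ρ (Set.Icc (-a) a)) ℓ s) atTop
      (𝓝 (cost (boxDensity ρ Set.univ) ℓ s)) := by
  refine tendsto_lintegral_boxDensity hρ.measurable
    ((measurable_regret ℓ).ennreal_ofReal.mul (measurable_lik_left s).ennreal_ofReal) ?_
  refine ne_top_of_le_ne_top ?_ (cost_le_mass (fun θ hθ => boxDensity_eq_zero hρ _ hθ) ℓ s)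
  exact ENNReal.mul_ne_top ENNReal.ofReal_ne_top (mass_flat_ne_top hC hρ hs)

/-- The optimal costs for the truncated flat prior converge to those for the flat prior. -/
lemma tendsto_actionValue_box {M : ℕ} (hM : 0 < M) {C : ℝ} (hC : 0 < C) {ρ : ℝ → ℝ}
    (hρ : IsSymmDensity C ρ) (ℓ : Fin 2) (r : ℕ) {s : State} (hs : 0 < s.1 0 + s.1 1) :
    Tendsto (fun a => actionValue M (cost (boxDensity ρ (Set.Icc (-a) a))) ℓ r s) atTop
      (𝓝 (actionValue M (cost (boxDensity ρ Set.univ)) ℓ r s)) :=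
  tendsto_actionValue
    (fun a ℓ => measurable_cost (measurable_boxDensity hρ.measurable measurableSet_Icc) ℓ)
    (fun a ℓ s => cost_mono (boxDensity_mono ρ (Set.subset_univ _)) ℓ s)
    {s | 0 < s.1 0 + s.1 1}
    (fun s hs ℓ x => by
      have h : 0 < s.1 0 + s.1 1 := hs
      rw [Set.mem_ofPred_eq, step_count_sum]
      omega)
    (fun s hs ℓ => tendsto_cost_box hC hρ hs ℓ)
    (fun s hs ℓ r => actionValue_flat_ne_top hM hC hρ ℓ r hs) r s hs ℓ

lemma tendsto_value_box {M : ℕ} (hM : 0 < M) {C : ℝ} (hC : 0 < C) {ρ : ℝ → ℝ}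
    (hρ : IsSymmDensity C ρ) (r : ℕ) {s : State} (hs : 0 < s.1 0 + s.1 1) :
    Tendsto (fun a => value M (cost (boxDensity ρ (Set.Icc (-a) a))) (r + 1) s) atTop
      (𝓝 (value M (cost (boxDensity ρ Set.univ)) (r + 1) s)) :=
  (tendsto_actionValue_box hM hC hρ 0 r hs).min (tendsto_actionValue_box hM hC hρ 1 r hs)

lemma value_flat_ne_top {M : ℕ} (hM : 0 < M) {C : ℝ} (hC : 0 < C) {ρ : ℝ → ℝ}
    (hρ : IsSymmDensity C ρ) (r : ℕ) {s : State} (hs : 0 < s.1 0 + s.1 1) :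
    value M (cost (boxDensity ρ Set.univ)) (r + 1) s ≠ ∞ :=
  ne_top_of_le_ne_top (actionValue_flat_ne_top hM hC hρ 0 r hs) (value_le_actionValue _ _ _ _ _)

/-! ### Bayesian risks for the posterior -/

lemma ofReal_prior (ρ : ℝ → ℝ) {a : ℝ} (ha : 0 < a) (θ : ℝ × ℝ) :
    ENNReal.ofReal (prior ρ a θ) =
      ENNReal.ofReal (2 * a)⁻¹ * boxDensity ρ (Set.Icc (-a) a) θ := by
  rw [prior, nu, boxDensity]
  by_cases h : (θ.1 + θ.2) / 2 ∈ Set.Icc (-a) a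
  · rw [Set.indicator_of_mem h, Set.indicator_of_mem h, mul_div_assoc,
      ENNReal.ofReal_mul (by positivity), Pi.one_apply, one_mul]
  · rw [Set.indicator_of_notMem h, Set.indicator_of_notMem h]
    simp

lemma isFiniteDensity_prior {C : ℝ} {ρ : ℝ → ℝ} (hρ : IsSymmDensity C ρ) {a : ℝ} (ha : 0 < a) :
    IsFiniteDensity C (prior ρ a) where
  measurable := by
    unfold prior nu
    refine (Measurable.mul ?_ (hρ.measurable.comp (by fun_prop))).div_const 2
    exact (measurable_const.indicator measurableSet_Icc).comp (by fun_prop)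
  nonneg θ := by
    unfold prior nu
    refine div_nonneg (mul_nonneg (Set.indicator_nonneg (fun _ _ => by positivity) _)
      (hρ.nonneg _)) two_pos.le
  eq_zero θ hθ := by
    have h : C < |(θ.1 - θ.2) / 2| := by
      have : ¬ |θ.1 - θ.2| ≤ 2 * C := hθ
      rw [abs_div, abs_two]
      linarith
    simp [prior, nu, hρ.eq_zero _ h]
  lintegral_ne_top := by
    have h := mass_boxDensity_zero hρ (measurableSet_Icc (a := -a) (b := a))
    simp only [mass, lik_zero, ENNReal.ofReal_one, one_mul] at h
    simp_rw [ofReal_prior ρ ha]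
    rw [lintegral_const_mul' _ _ ENNReal.ofReal_ne_top, h, Real.volume_Icc]
    exact ENNReal.mul_ne_top ENNReal.ofReal_ne_top ENNReal.ofReal_ne_top

/-- The likelihood is, up to a factor that does not depend on the mean, the density `lik`. -/
lemma exists_likelihood_eq (n : ℕ) (X : ℝ) (h : n = 0 → X = 0) :
    ∃ k, 0 < k ∧ ∀ m, likelihood n X m = k * Real.exp (m * X - n * m ^ 2 / 2) := by
  rcases Nat.eq_zero_or_pos n with hn | hn
  · exact ⟨1, one_pos, fun m => by simp [likelihood, hn, h hn]⟩
  · have hn' : (0 : ℝ) < n := by exact_mod_cast hn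
    refine ⟨(√(2 * Real.pi * n))⁻¹ * Real.exp (-(X ^ 2 / (2 * n))), by positivity, fun m => ?_⟩
    rw [likelihood, if_neg hn.ne', gaussianPDFReal, mul_assoc _ (Real.exp _), ← Real.exp_add]
    simp only [NNReal.coe_natCast]
    congr 2
    field_simp
    ring

lemma posterior_eq {C : ℝ} {ρ : ℝ → ℝ} (hρ : IsSymmDensity C ρ) {a : ℝ} (ha : 0 < a)
    {X₁ X₂ : ℝ} {n₁ n₂ : ℕ} (h₁ : n₁ = 0 → X₁ = 0) (h₂ : n₂ = 0 → X₂ = 0) (θ : ℝ × ℝ) :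
    posterior C (prior ρ a) X₁ n₁ X₂ n₂ θ =
      (mass (boxDensity ρ (Set.Icc (-a) a)) (![n₁, n₂], ![X₁, X₂])).toReal⁻¹ *
        (lik θ (![n₁, n₂], ![X₁, X₂]) * (2 * a * prior ρ a θ)) := by
  obtain ⟨k₁, hk₁, hl₁⟩ := exists_likelihood_eq n₁ X₁ h₁
  obtain ⟨k₂, hk₂, hl₂⟩ := exists_likelihood_eq n₂ X₂ h₂
  have hp := isFiniteDensity_prior hρ ha
  have hL : ∀ θ : ℝ × ℝ, likelihood n₁ X₁ θ.1 * likelihood n₂ X₂ θ.2 =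
      k₁ * k₂ * lik θ (![n₁, n₂], ![X₁, X₂]) := by
    intro θ
    rw [hl₁, hl₂, lik, Fin.sum_univ_two, Real.exp_add]
    simp [mean]
    ring
  have hint : ∫ η in paramSet C, likelihood n₁ X₁ η.1 * likelihood n₂ X₂ η.2 * prior ρ a η =
      k₁ * k₂ * ((2 * a)⁻¹ *
        (mass (boxDensity ρ (Set.Icc (-a) a)) (![n₁, n₂], ![X₁, X₂])).toReal) := by
    rw [setIntegral_eq_integral_of_forall_compl_eq_zero
      (fun θ hθ => by rw [hp.eq_zero θ hθ, mul_zero])]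
    simp_rw [hL, mul_assoc (k₁ * k₂)]
    rw [integral_const_mul]
    congr 1
    rw [integral_eq_lintegral_of_nonneg_ae
      (ae_of_all _ fun θ => mul_nonneg (lik_pos _ _).le (hp.nonneg θ))
      ((measurable_lik_left _).mul hp.measurable).aestronglyMeasurable]
    simp_rw [ENNReal.ofReal_mul (lik_pos _ _).le, ofReal_prior ρ ha, mul_left_comm _
      (ENNReal.ofReal (2 * a)⁻¹)]
    rw [lintegral_const_mul' _ _ ENNReal.ofReal_ne_top, ENNReal.toReal_mul,
      ENNReal.toReal_ofReal (by positivity)]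
    rfl
  rw [posterior, hint, hL]
  have hk : k₁ * k₂ ≠ 0 := by positivity
  rw [mul_assoc (k₁ * k₂), mul_div_mul_left _ _ hk, div_eq_mul_inv, mul_inv, inv_inv]
  ring

lemma ofReal_posterior {C : ℝ} {ρ : ℝ → ℝ} (hρ : IsSymmDensity C ρ) {a : ℝ} (ha : 0 < a)
    {X₁ X₂ : ℝ} {n₁ n₂ : ℕ} (h₁ : n₁ = 0 → X₁ = 0) (h₂ : n₂ = 0 → X₂ = 0) (θ : ℝ × ℝ) :
    ENNReal.ofReal (posterior C (prior ρ a) X₁ n₁ X₂ n₂ θ) =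
      ENNReal.ofReal (mass (boxDensity ρ (Set.Icc (-a) a)) (![n₁, n₂], ![X₁, X₂])).toReal⁻¹ *
        (ENNReal.ofReal (lik θ (![n₁, n₂], ![X₁, X₂])) * boxDensity ρ (Set.Icc (-a) a) θ) := by
  rw [posterior_eq hρ ha h₁ h₂, ENNReal.ofReal_mul (inv_nonneg.2 ENNReal.toReal_nonneg),
    ENNReal.ofReal_mul (lik_pos _ _).le, ENNReal.ofReal_mul (by positivity), ofReal_prior ρ ha,
    ← mul_assoc (ENNReal.ofReal (2 * a)), ← ENNReal.ofReal_mul (by positivity),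
    mul_inv_cancel₀ (by positivity), ENNReal.ofReal_one, one_mul]

lemma isFiniteDensity_posterior {C : ℝ} (hC : 0 < C) {ρ : ℝ → ℝ} (hρ : IsSymmDensity C ρ) {a : ℝ}
    (ha : 0 < a) {X₁ X₂ : ℝ} {n₁ n₂ : ℕ} (h₁ : n₁ = 0 → X₁ = 0) (h₂ : n₂ = 0 → X₂ = 0)
    (hn : 0 < n₁ + n₂) : IsFiniteDensity C (posterior C (prior ρ a) X₁ n₁ X₂ n₂) := by
  have hp := isFiniteDensity_prior hρ ha
  refine ⟨?_, fun θ => ?_, fun θ hθ => ?_, ?_⟩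
  · simp_rw [funext (posterior_eq hρ ha h₁ h₂)]
    exact ((measurable_lik_left _).mul (hp.measurable.const_mul _)).const_mul _
  · rw [posterior_eq hρ ha h₁ h₂]
    have := hp.nonneg θ
    have := (lik_pos θ (![n₁, n₂], ![X₁, X₂])).le
    positivity
  · rw [posterior_eq hρ ha h₁ h₂, hp.eq_zero θ hθ]
    simp
  · simp_rw [ofReal_posterior hρ ha h₁ h₂]
    rw [lintegral_const_mul' _ _ ENNReal.ofReal_ne_top]
    refine ENNReal.mul_ne_top ENNReal.ofReal_ne_top ?_
    exact ne_top_of_le_ne_top (mass_flat_ne_top hC hρ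
      (s := (![n₁, n₂], ![X₁, X₂])) (by simpa using hn))
      (mass_mono (boxDensity_mono ρ (Set.subset_univ _)) _)

lemma cost_posterior {C : ℝ} {ρ : ℝ → ℝ} (hρ : IsSymmDensity C ρ) {a : ℝ} (ha : 0 < a)
    {X₁ X₂ : ℝ} {n₁ n₂ : ℕ} (h₁ : n₁ = 0 → X₁ = 0) (h₂ : n₂ = 0 → X₂ = 0) (ℓ : Fin 2) (s : State) :
    cost (fun θ => ENNReal.ofReal (posterior C (prior ρ a) X₁ n₁ X₂ n₂ θ)) ℓ s =
      ENNReal.ofReal (mass (boxDensity ρ (Set.Icc (-a) a)) (![n₁, n₂], ![X₁, X₂])).toReal⁻¹ *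
        cost (boxDensity ρ (Set.Icc (-a) a)) ℓ (s + (![n₁, n₂], ![X₁, X₂])) := by
  simp_rw [cost, ofReal_posterior hρ ha h₁ h₂]
  rw [← lintegral_const_mul' _ _ ENNReal.ofReal_ne_top]
  refine lintegral_congr fun θ => ?_
  rw [lik_add, ENNReal.ofReal_mul (lik_pos _ _).le]
  ring

/-- The Bayesian risk for the posterior is a quotient of the optimal cost and the mass of the
posterior that is not normalized. -/
lemma bayesRiskAction_posterior {M : ℕ} (hM : 0 < M) {C : ℝ} (hC : 0 < C) {ρ : ℝ → ℝ}
    (hρ : IsSymmDensity C ρ) {a : ℝ} (ha : 0 < a) {X₁ X₂ : ℝ} {n₁ n₂ : ℕ} (h₁ : n₁ = 0 → X₁ = 0)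
    (h₂ : n₂ = 0 → X₂ = 0) (hn : 0 < n₁ + n₂) (r : ℕ) (ℓ : Fin 2) :
    bayesRiskAction M (r + 1) C (posterior C (prior ρ a) X₁ n₁ X₂ n₂) ℓ =
      (actionValue M (cost (boxDensity ρ (Set.Icc (-a) a))) ℓ r (![n₁, n₂], ![X₁, X₂])).toReal /
        (mass (boxDensity ρ (Set.Icc (-a) a)) (![n₁, n₂], ![X₁, X₂])).toReal := by
  rw [bayesRiskAction_eq hM (isFiniteDensity_posterior hC hρ ha h₁ h₂ hn),
    actionValue_translate (measurable_cost (measurable_boxDensity hρ.measurable measurableSet_Icc))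
      _ _ (cost_posterior hρ ha h₁ h₂), ENNReal.toReal_mul,
    ENNReal.toReal_ofReal (inv_nonneg.2 ENNReal.toReal_nonneg), div_eq_inv_mul]

lemma bayesRisk_posterior {M : ℕ} (hM : 0 < M) {C : ℝ} (hC : 0 < C) {ρ : ℝ → ℝ}
    (hρ : IsSymmDensity C ρ) {a : ℝ} (ha : 0 < a) {X₁ X₂ : ℝ} {n₁ n₂ : ℕ} (h₁ : n₁ = 0 → X₁ = 0)
    (h₂ : n₂ = 0 → X₂ = 0) (hn : 0 < n₁ + n₂) (r : ℕ) :
    bayesRisk M (r + 1) C (posterior C (prior ρ a) X₁ n₁ X₂ n₂) =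
      (value M (cost (boxDensity ρ (Set.Icc (-a) a))) (r + 1) (![n₁, n₂], ![X₁, X₂])).toReal /
        (mass (boxDensity ρ (Set.Icc (-a) a)) (![n₁, n₂], ![X₁, X₂])).toReal := by
  rw [bayesRisk_eq hM (isFiniteDensity_posterior hC hρ ha h₁ h₂ hn),
    value_translate (measurable_cost (measurable_boxDensity hρ.measurable measurableSet_Icc))
      _ _ (cost_posterior hρ ha h₁ h₂), ENNReal.toReal_mul,
    ENNReal.toReal_ofReal (inv_nonneg.2 ENNReal.toReal_nonneg), div_eq_inv_mul]

lemma toReal_mul_div_toReal_mul {f x w : ℝ} (hf : 0 < f) (hx : 0 ≤ x) (hw : 0 ≤ w) :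
    (ENNReal.ofReal f * ENNReal.ofReal x).toReal / (ENNReal.ofReal f * ENNReal.ofReal w).toReal =
      x / w := by
  rw [ENNReal.toReal_mul, ENNReal.toReal_mul, ENNReal.toReal_ofReal hf.le,
    ENNReal.toReal_ofReal hx, ENNReal.toReal_ofReal hw, mul_div_mul_left _ _ hf.ne']

/-- The factor `flatMass` cancels between the optimal cost and the mass, and `weight` remains. -/
lemma tendsto_bayesRiskAction_posterior {M : ℕ} (hM : 0 < M) {C : ℝ} (hC : 0 < C) {ρ : ℝ → ℝ}
    (hρ : IsSymmDensity C ρ) {X₁ X₂ : ℝ} {n₁ n₂ : ℕ} (h₁ : n₁ = 0 → X₁ = 0)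
    (h₂ : n₂ = 0 → X₂ = 0) (hn : 0 < n₁ + n₂) (r : ℕ) (ℓ : Fin 2) {x : ℝ} (hx : 0 ≤ x)
    (hv : actionValue M (cost (boxDensity ρ Set.univ)) ℓ r (![n₁, n₂], ![X₁, X₂]) =
      ENNReal.ofReal (flatMass (![n₁, n₂], ![X₁, X₂])) * ENNReal.ofReal x) :
    Tendsto (fun a => bayesRiskAction M (r + 1) C (posterior C (prior ρ a) X₁ n₁ X₂ n₂) ℓ) atTop
      (𝓝 (x / weight C ρ (BatchBandit.stat X₁ n₁ X₂ n₂) n₁ n₂)) := by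
  set t : State := (![n₁, n₂], ![X₁, X₂]) with ht
  have hs : 0 < t.1 0 + t.1 1 := by simpa [ht] using hn
  have hw := weight_pos hC hρ t.stat (t.1 0) (t.1 1)
  have hlim := ((ENNReal.tendsto_toReal (actionValue_flat_ne_top hM hC hρ ℓ r hs)).comp
    (tendsto_actionValue_box hM hC hρ ℓ r hs)).div ((ENNReal.tendsto_toReal
      (mass_flat_ne_top hC hρ hs)).comp (tendsto_mass_box hC hρ hs)) (by
        rw [mass_flat hC hρ hs, ENNReal.toReal_mul, ENNReal.toReal_ofReal (flatMass_pos hs).le,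
          ENNReal.toReal_ofReal hw.le]
        exact (mul_pos (flatMass_pos hs) hw).ne')
  rw [hv, mass_flat hC hρ hs, toReal_mul_div_toReal_mul (flatMass_pos hs) hx hw.le] at hlim
  refine hlim.congr' ?_
  filter_upwards [eventually_gt_atTop 0] with a ha
  exact (bayesRiskAction_posterior hM hC hρ ha h₁ h₂ hn r ℓ).symm

lemma tendsto_bayesRisk_posterior {M : ℕ} (hM : 0 < M) {C : ℝ} (hC : 0 < C) {ρ : ℝ → ℝ}
    (hρ : IsSymmDensity C ρ) {X₁ X₂ : ℝ} {n₁ n₂ : ℕ} (h₁ : n₁ = 0 → X₁ = 0)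
    (h₂ : n₂ = 0 → X₂ = 0) (hn : 0 < n₁ + n₂) (r : ℕ) {x : ℝ} (hx : 0 ≤ x)
    (hv : value M (cost (boxDensity ρ Set.univ)) (r + 1) (![n₁, n₂], ![X₁, X₂]) =
      ENNReal.ofReal (flatMass (![n₁, n₂], ![X₁, X₂])) * ENNReal.ofReal x) :
    Tendsto (fun a => bayesRisk M (r + 1) C (posterior C (prior ρ a) X₁ n₁ X₂ n₂)) atTop
      (𝓝 (x / weight C ρ (BatchBandit.stat X₁ n₁ X₂ n₂) n₁ n₂)) := by
  set t : State := (![n₁, n₂], ![X₁, X₂]) with ht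
  have hs : 0 < t.1 0 + t.1 1 := by simpa [ht] using hn
  have hw := weight_pos hC hρ t.stat (t.1 0) (t.1 1)
  have hlim := ((ENNReal.tendsto_toReal (value_flat_ne_top hM hC hρ r hs)).comp
    (tendsto_value_box hM hC hρ r hs)).div ((ENNReal.tendsto_toReal
      (mass_flat_ne_top hC hρ hs)).comp (tendsto_mass_box hC hρ hs)) (by
        rw [mass_flat hC hρ hs, ENNReal.toReal_mul, ENNReal.toReal_ofReal (flatMass_pos hs).le,
          ENNReal.toReal_ofReal hw.le]
        exact (mul_pos (flatMass_pos hs) hw).ne')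
  rw [hv, mass_flat hC hρ hs, toReal_mul_div_toReal_mul (flatMass_pos hs) hx hw.le] at hlim
  refine hlim.congr' ?_
  filter_upwards [eventually_gt_atTop 0] with a ha
  exact (bayesRisk_posterior hM hC hρ ha h₁ h₂ hn r).symm

/-! ### The first packet -/

lemma boxDensity_swap {C : ℝ} {ρ : ℝ → ℝ} (hρ : IsSymmDensity C ρ) (B : Set ℝ) (θ : ℝ × ℝ) :
    boxDensity ρ B θ.swap = boxDensity ρ B θ := by
  have h : (θ.2 - θ.1) / 2 = -((θ.1 - θ.2) / 2) := by ring
  simp only [boxDensity, Prod.fst_swap, Prod.snd_swap, h, hρ.symm, add_comm θ.2]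

lemma regret_swap (θ : ℝ × ℝ) (ℓ : Fin 2) : regret θ.swap (Equiv.swap 0 1 ℓ) = regret θ ℓ := by
  fin_cases ℓ <;> simp [regret, mean, max_comm]

lemma lik_swap (θ : ℝ × ℝ) (s : State) : lik θ.swap s.swap = lik θ s := by
  simp [lik, mean, State.swap, Fin.sum_univ_two, add_comm]

lemma cost_boxDensity_swap {C : ℝ} {ρ : ℝ → ℝ} (hρ : IsSymmDensity C ρ) (B : Set ℝ) (ℓ : Fin 2)
    (s : State) :
    cost (boxDensity ρ B) ℓ s = cost (boxDensity ρ B) (Equiv.swap 0 1 ℓ) s.swap := by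
  have h := (Measure.measurePreserving_swap (μ := (volume : Measure ℝ))
    (ν := (volume : Measure ℝ))).lintegral_comp_emb MeasurableEquiv.prodComm.measurableEmbedding
    (fun θ => ENNReal.ofReal (regret θ (Equiv.swap 0 1 ℓ)) * ENNReal.ofReal (lik θ s.swap) *
      boxDensity ρ B θ)
  simp only [regret_swap, lik_swap, boxDensity_swap hρ] at h
  exact h

lemma cost_prior {ρ : ℝ → ℝ} {a : ℝ} (ha : 0 < a) (ℓ : Fin 2) (s : State) :
    cost (fun θ => ENNReal.ofReal (prior ρ a θ)) ℓ s =
      ENNReal.ofReal (2 * a)⁻¹ * cost (boxDensity ρ (Set.Icc (-a) a)) ℓ s := by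
  simp_rw [cost, ofReal_prior ρ ha]
  rw [← lintegral_const_mul' _ _ ENNReal.ofReal_ne_top]
  exact lintegral_congr fun θ => mul_left_comm _ _ _

lemma volume_Icc_mul {a : ℝ} (ha : 0 < a) :
    ENNReal.ofReal (2 * a)⁻¹ * volume (Set.Icc (-a) a) = 1 := by
  rw [Real.volume_Icc, ← ENNReal.ofReal_mul (by positivity), show a - -a = 2 * a by ring,
    inv_mul_cancel₀ (by positivity), ENNReal.ofReal_one]

/-- For the first packet both actions have the same optimal cost. -/
lemma actionValue_prior_eq {M : ℕ} {C : ℝ} {ρ : ℝ → ℝ} (hρ : IsSymmDensity C ρ) {a : ℝ}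
    (ha : 0 < a) (r : ℕ) (ℓ : Fin 2) :
    actionValue M (cost fun θ => ENNReal.ofReal (prior ρ a θ)) ℓ r 0 =
      value M (cost fun θ => ENNReal.ofReal (prior ρ a θ)) (r + 1) 0 := by
  have h := actionValue_zero_of_swap (M := M)
    (measurable_cost (isFiniteDensity_prior hρ ha).measurable.ennreal_ofReal)
    (fun ℓ s => by rw [cost_prior ha, cost_prior ha, cost_boxDensity_swap hρ]) r
  rw [value_succ, h, min_self]
  fin_cases ℓ
  exacts [h, rfl]

lemma cost_prior_zero {C : ℝ} (hC : 0 < C) {ρ : ℝ → ℝ} (hρ : IsSymmDensity C ρ) {a : ℝ}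
    (ha : 0 < a) (ℓ : Fin 2) : cost (fun θ => ENNReal.ofReal (prior ρ a θ)) ℓ 0 =
      ENNReal.ofReal (2 * ∫ v in (0 : ℝ)..C, v * ρ v) := by
  rw [cost_prior ha, cost_boxDensity_zero hC hρ ℓ measurableSet_Icc, ← mul_assoc,
    volume_Icc_mul ha, one_mul, g_zero_of_mul_eq_zero C ρ ℓ (mul_zero 0)]

lemma costToGo_smul {M : ℕ} (σ : Strategy M) {G G' : Fin 2 → State → ℝ≥0∞}
    (hG : ∀ ℓ, Measurable (G ℓ)) (c : ℝ≥0∞) (h : ∀ ℓ s, G' ℓ s = c * G ℓ s) (r k : ℕ)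
    (x : Hist M k) : costToGo σ G' r k x = c * costToGo σ G r k x := by
  induction r generalizing k with
  | zero => simp [costToGo]
  | succ r ih =>
    simp only [costToGo, ih, h, Finset.mul_sum]
    refine Finset.sum_congr rfl fun ℓ _ => ?_
    rw [lintegral_const_mul _ (Measurable.of_uncurry_left
      (f := fun h x => costToGo σ G r (k + 1) (Hist.snoc (h, (ℓ, x))))
      (measurable_comp_snoc (measurable_costToGo σ hG r (k + 1)) ℓ))]
    ring

/-- A narrow box is contained in every translate of a wide box by a small amount. -/
lemma boxDensity_le_shiftDensity {ρ : ℝ → ℝ} {a b c : ℝ} (hc : |c| ≤ a - b) (θ : ℝ × ℝ) :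
    boxDensity ρ (Set.Icc (-b) b) θ ≤ shiftDensity c (boxDensity ρ (Set.Icc (-a) a)) θ := by
  have h1 : ((θ + (c, c)).1 + (θ + (c, c)).2) / 2 = (θ.1 + θ.2) / 2 + c := by simp; ring
  have h2 : ((θ + (c, c)).1 - (θ + (c, c)).2) / 2 = (θ.1 - θ.2) / 2 := by simp
  rw [shiftDensity, boxDensity, boxDensity, h1, h2]
  refine mul_le_mul_left ?_ _
  by_cases h : (θ.1 + θ.2) / 2 ∈ Set.Icc (-b) b
  · rw [abs_le] at hc
    rw [Set.indicator_of_mem h, Set.indicator_of_mem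
      (show (θ.1 + θ.2) / 2 + c ∈ Set.Icc (-a) a from
        ⟨by linarith [h.1, hc.1], by linarith [h.2, hc.2]⟩)]
    rfl
  · rw [Set.indicator_of_notMem h]
    exact zero_le

lemma flatMass_step_zero {M : ℕ} (ℓ : Fin 2) (y : ℝ) :
    flatMass (State.step M ℓ y 0) = √(2 * Real.pi / M) * Real.exp (y ^ 2 / (2 * M)) := by
  have h1 := step_income_sum M ℓ y 0
  have h2 : ((State.step M ℓ y 0).1 0 + (State.step M ℓ y 0).1 1 : ℝ) = M := by
    have := step_count_sum M ℓ y 0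
    simp only [Prod.fst_zero, Pi.zero_apply, zero_add] at this
    exact_mod_cast this
  simp only [Prod.snd_zero, Pi.zero_apply, zero_add] at h1
  rw [flatMass, h1, h2]

lemma shift_step_zero (M : ℕ) (ℓ : Fin 2) (c : ℝ) :
    (State.step M ℓ 0 0).shift c = State.step M ℓ (M * c) 0 := by
  rw [shift_step, zero_add]
  congr 1
  simp [State.shift]
  rfl

/-- The weight in the comparison of different incomes of the first packet. -/
lemma lik_neg_step_zero {M : ℕ} (hM : 0 < M) (ℓ : Fin 2) (c : ℝ) :
    flatMass (State.step M ℓ (M * c) 0) * lik (-c, -c) (State.step M ℓ 0 0) =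
      flatMass (State.step M ℓ 0 0) := by
  have hm : mean (-c, -c) ℓ = -c := by simp [mean]
  have hM' : (M : ℝ) ≠ 0 := by exact_mod_cast hM.ne'
  rw [flatMass_step_zero, flatMass_step_zero, lik_step, lik_zero, hm, one_mul, mul_assoc,
    ← Real.exp_add]
  congr 2
  field_simp
  ring

/-- Comparison of the truncated flat prior, after one packet with total income `y`, with a more
narrowly truncated flat prior after one packet with total income `0`. -/
lemma value_box_step_ge {M : ℕ} (hM : 0 < M) {ρ : ℝ → ℝ} (hρ : Measurable ρ) {a b y : ℝ}
    (hy : |y| ≤ M * (a - b)) (ℓ : Fin 2) (r : ℕ) :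
    ENNReal.ofReal (flatMass (State.step M ℓ y 0)) *
        value M (cost (boxDensity ρ (Set.Icc (-b) b))) r (State.step M ℓ 0 0) ≤
      ENNReal.ofReal (flatMass (State.step M ℓ 0 0)) *
        value M (cost (boxDensity ρ (Set.Icc (-a) a))) r (State.step M ℓ y 0) := by
  have hM' : (0 : ℝ) < M := by exact_mod_cast hM
  obtain ⟨c, rfl⟩ : ∃ c, y = M * c := ⟨y / M, by field_simp⟩
  rw [abs_mul, abs_of_pos hM', mul_le_mul_iff_right₀ hM'] at hy
  have h := value_shiftDensity hM (measurable_boxDensity hρ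
    (measurableSet_Icc (a := -a) (b := a))) c r (State.step M ℓ 0 0)
  rw [shift_step_zero] at h
  calc _ ≤ ENNReal.ofReal (flatMass (State.step M ℓ (M * c) 0)) * value M
        (cost (shiftDensity c (boxDensity ρ (Set.Icc (-a) a)))) r (State.step M ℓ 0 0) :=
        mul_le_mul_right (value_mono (fun i s =>
          cost_mono (boxDensity_le_shiftDensity hy) i s) r _) _
    _ = _ := by
        rw [h, ← mul_assoc, ← ENNReal.ofReal_mul (by rw [flatMass_step_zero]; positivity),
          lik_neg_step_zero hM]

lemma mass_box_step_ge {M : ℕ} (hM : 0 < M) {ρ : ℝ → ℝ} {a b y : ℝ}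
    (hy : |y| ≤ M * (a - b)) (ℓ : Fin 2) :
    ENNReal.ofReal (flatMass (State.step M ℓ y 0)) *
        mass (boxDensity ρ (Set.Icc (-b) b)) (State.step M ℓ 0 0) ≤
      ENNReal.ofReal (flatMass (State.step M ℓ 0 0)) *
        mass (boxDensity ρ (Set.Icc (-a) a)) (State.step M ℓ y 0) := by
  have hM' : (0 : ℝ) < M := by exact_mod_cast hM
  obtain ⟨c, rfl⟩ : ∃ c, y = M * c := ⟨y / M, by field_simp⟩
  rw [abs_mul, abs_of_pos hM', mul_le_mul_iff_right₀ hM'] at hy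
  have h := mass_shiftDensity (lam := boxDensity ρ (Set.Icc (-a) a)) c (State.step M ℓ 0 0)
  rw [shift_step_zero] at h
  calc _ ≤ ENNReal.ofReal (flatMass (State.step M ℓ (M * c) 0)) *
        mass (shiftDensity c (boxDensity ρ (Set.Icc (-a) a))) (State.step M ℓ 0 0) :=
        mul_le_mul_right (mass_mono (boxDensity_le_shiftDensity hy) _) _
    _ = _ := by
        rw [h, ← mul_assoc, ← ENNReal.ofReal_mul (by rw [flatMass_step_zero]; positivity),
          lik_neg_step_zero hM]

/-- For the flat prior the total income of the first packet is uniformly distributed: `flatMass` is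
proportional to the inverse of the normal density. -/
lemma setLIntegral_flatMass {M : ℕ} (hM : 0 < M) (ℓ : Fin 2) {c : ℝ} :
    ∫⁻ y in Set.Icc (-(M * c)) (M * c), ENNReal.ofReal (flatMass (State.step M ℓ y 0))
      ∂gaussianReal 0 M = ENNReal.ofReal (2 * c) := by
  have hM' : (0 : ℝ) < M := by exact_mod_cast hM
  have hM'' : (M : ℝ≥0) ≠ 0 := by exact_mod_cast hM.ne'
  have hconst : ∀ y, gaussianPDFReal 0 M y * flatMass (State.step M ℓ y 0) = (M : ℝ)⁻¹ := by
    intro y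
    have h1 : (√(2 * Real.pi * M))⁻¹ * √(2 * Real.pi / M) = (M : ℝ)⁻¹ := by
      rw [mul_comm, ← div_eq_mul_inv, ← Real.sqrt_div (by positivity)]
      rw [show 2 * Real.pi / M / (2 * Real.pi * M) = ((M : ℝ)⁻¹) ^ 2 by
        field_simp]
      exact Real.sqrt_sq (by positivity)
    rw [flatMass_step_zero, gaussianPDFReal, NNReal.coe_natCast,
      show ∀ a b c d : ℝ, a * b * (c * d) = (a * c) * (b * d) by intros; ring, h1,
      ← Real.exp_add]
    rw [show -(y - 0) ^ 2 / (2 * (M : ℝ)) + y ^ 2 / (2 * M) = 0 by ring, Real.exp_zero, mul_one]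
  have hmeas : Measurable fun y => ENNReal.ofReal (flatMass (State.step M ℓ y 0)) := by
    simp only [flatMass_step_zero]
    fun_prop
  rw [← lintegral_indicator measurableSet_Icc, lintegral_gaussianReal 0 hM''
    (hmeas.indicator measurableSet_Icc)]
  have h : ∀ y, ENNReal.ofReal (gaussianPDFReal 0 M y) * (Set.Icc (-(M * c)) (M * c)).indicator
      (fun y => ENNReal.ofReal (flatMass (State.step M ℓ y 0))) y =
      (Set.Icc (-(M * c)) (M * c)).indicator (fun _ => ENNReal.ofReal (M : ℝ)⁻¹) y := by
    intro y
    by_cases hy : y ∈ Set.Icc (-(M * c)) (M * c)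
    · rw [Set.indicator_of_mem hy, Set.indicator_of_mem hy,
        ← ENNReal.ofReal_mul (gaussianPDFReal_nonneg _ _ _), hconst]
    · rw [Set.indicator_of_notMem hy, Set.indicator_of_notMem hy, mul_zero]
  simp_rw [h]
  rw [lintegral_indicator measurableSet_Icc, setLIntegral_const, Real.volume_Icc,
    ← ENNReal.ofReal_mul (by positivity)]
  congr 1
  field_simp
  ring

/-- If a family of functions of the total income of the first packet dominates, far from the ends of
the box, the predictive density times quantities that tend to `L`, then its average over the box
is asymptotically at least `L`. -/
lemma exists_lower_bound {M : ℕ} (hM : 0 < M) (ℓ : Fin 2) (F : ℝ → ℝ → ℝ≥0∞) (v : ℝ → ℝ≥0∞)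
    (hFv : ∀ a b y : ℝ, |y| ≤ M * (a - b) →
      ENNReal.ofReal (flatMass (State.step M ℓ y 0)) * v b ≤
        ENNReal.ofReal (flatMass (State.step M ℓ 0 0)) * F a y) {L : ℝ≥0∞} (hL : L ≠ ∞)
    (hv : Tendsto v atTop (𝓝 (ENNReal.ofReal (flatMass (State.step M ℓ 0 0)) * L))) :
    ∃ u : ℝ → ℝ≥0∞, Tendsto u atTop (𝓝 L) ∧ ∀ᶠ a in atTop, u a ≤ ENNReal.ofReal (2 * a)⁻¹ *
      ∫⁻ y in Set.Icc (-(M * a)) (M * a), F a y ∂gaussianReal 0 M := by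
  set q := ENNReal.ofReal (flatMass (State.step M ℓ 0 0)) with hq
  have hM' : (0 : ℝ) < M := by exact_mod_cast hM
  have hq0 : q ≠ 0 := by
    rw [hq, Ne, ENNReal.ofReal_eq_zero, not_le, flatMass_step_zero]
    positivity
  have hqt : q ≠ ∞ := ENNReal.ofReal_ne_top
  -- compare the box of half-width `a` with the box of half-width `√a = o(a)`
  refine ⟨fun a => ENNReal.ofReal ((2 * a)⁻¹ * (2 * (a - √a))) * (q⁻¹ * v (√a)), ?_, ?_⟩
  · have h1 : Tendsto (fun a : ℝ => (2 * a)⁻¹ * (2 * (a - √a))) atTop (𝓝 1) := by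
      have h2 : Tendsto (fun a : ℝ => 1 - (√a)⁻¹) atTop (𝓝 (1 - 0)) :=
        tendsto_const_nhds.sub (tendsto_inv_atTop_zero.comp Real.tendsto_sqrt_atTop)
      rw [sub_zero] at h2
      refine h2.congr' ?_
      filter_upwards [eventually_gt_atTop 0] with a ha
      have hs : 0 < √a := Real.sqrt_pos.2 ha
      have hsq : √a * √a = a := Real.mul_self_sqrt ha.le
      field_simp
      nlinarith
    have h3 : Tendsto (fun a => q⁻¹ * v (√a)) atTop (𝓝 (q⁻¹ * (q * L))) :=
      ENNReal.Tendsto.const_mul (hv.comp Real.tendsto_sqrt_atTop)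
        (Or.inr (ENNReal.inv_ne_top.2 hq0))
    rw [← mul_assoc, ENNReal.inv_mul_cancel hq0 hqt, one_mul] at h3
    have h4 := ENNReal.Tendsto.mul (ENNReal.tendsto_ofReal h1) (Or.inr hL) h3 (Or.inr (by simp))
    simpa using h4
  · filter_upwards [eventually_gt_atTop 0] with a ha
    rw [ENNReal.ofReal_mul (by positivity), mul_assoc]
    refine mul_le_mul_right ?_ _
    rw [← setLIntegral_flatMass hM ℓ, ← mul_assoc, mul_comm _ q⁻¹, mul_assoc]
    rw [ENNReal.inv_mul_le_iff hq0 hqt]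
    have hmeas : Measurable fun y => ENNReal.ofReal (flatMass (State.step M ℓ y 0)) := by
      simp only [flatMass_step_zero]
      fun_prop
    rw [← lintegral_mul_const _ hmeas, ← lintegral_const_mul' _ _ hqt]
    have hsub : Set.Icc (-(M * (a - √a))) (M * (a - √a)) ⊆ Set.Icc (-(M * a)) (M * a) := by
      have : M * (a - √a) ≤ M * a := by
        have := Real.sqrt_nonneg a
        nlinarith
      exact Set.Icc_subset_Icc (by linarith) this
    refine (setLIntegral_mono' measurableSet_Icc fun y hy => hFv a (√a) y (abs_le.2 hy)).trans
      (lintegral_mono_set hsub)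

/-! ### Bellman strategies -/

lemma measurable_stat : Measurable State.stat := by
  have hn : ∀ ℓ : Fin 2, Measurable fun s : State => ((s.1 ℓ : ℕ) : ℝ) := fun ℓ =>
    (measurable_from_nat (f := fun n : ℕ => (n : ℝ))).comp
      ((measurable_pi_apply ℓ).comp measurable_fst)
  have hx : ∀ ℓ : Fin 2, Measurable fun s : State => s.2 ℓ := fun ℓ =>
    (measurable_pi_apply ℓ).comp measurable_snd
  exact (((hx 0).mul (hn 1)).sub ((hx 1).mul (hn 0))).div ((hn 0).add (hn 1))

lemma measurable_RAction {M : ℕ} (hM : 0 < M) {C : ℝ} (hC : 0 < C) {ρ : ℝ → ℝ}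
    (hρ : IsSymmDensity C ρ) (N : ℕ) (ℓ : Fin 2) :
    Measurable fun s : State => RAction M N C ρ ℓ s.stat (s.1 0) (s.1 1) := by
  have h : Measurable fun p : (ℕ × ℕ) × ℝ => RAction M N C ρ ℓ p.2 p.1.1 p.1.2 :=
    measurable_from_prod_countable_right fun n =>
      (isExpBounded_RAction hM hC hρ N ℓ n.1 n.2).measurable
  have hn : ∀ ℓ : Fin 2, Measurable fun s : State => s.1 ℓ := fun ℓ =>
    (measurable_pi_apply ℓ).comp measurable_fst
  exact h.comp (((hn 0).prodMk (hn 1)).prodMk measurable_stat)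

/-- The action applied after a history by the strategy that starts with the first action, continues
with the second one, and then minimizes `R_M^{(ℓ)}`. -/
noncomputable def bellmanAction (M K : ℕ) (C : ℝ) (ρ : ℝ → ℝ) : (k : ℕ) → Hist M k → Fin 2
  | 0, _ => 0
  | 1, h => 1 - (h 0).1
  | _ + 2, h => if RAction M (K * M) C ρ 0 h.stat (h.count 0) (h.count 1) ≤
      RAction M (K * M) C ρ 1 h.stat (h.count 0) (h.count 1) then 0 else 1

lemma measurable_bellmanAction {M : ℕ} (hM : 0 < M) (K : ℕ) {C : ℝ} (hC : 0 < C) {ρ : ℝ → ℝ}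
    (hρ : IsSymmDensity C ρ) : ∀ k, Measurable (bellmanAction M K C ρ k)
  | 0 => measurable_const
  | 1 => (measurable_of_countable fun i : Fin 2 => 1 - i).comp
      (measurable_fst.comp (measurable_pi_apply 0))
  | k + 2 => measurable_argmin
      ((measurable_RAction hM hC hρ (K * M) 0).comp (measurable_state M (k + 2)))
      ((measurable_RAction hM hC hρ (K * M) 1).comp (measurable_state M (k + 2)))

theorem exists_isBellmanStrategy {M : ℕ} (hM : 0 < M) (K : ℕ) {C : ℝ} (hC : 0 < C) {ρ : ℝ → ℝ}
    (hρ : IsSymmDensity C ρ) : ∃ σ : Strategy M, IsBellmanStrategy K C ρ σ := by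
  refine ⟨Strategy.ofFun _ (measurable_bellmanAction hM K hC hρ), ⟨fun h => ?_, ?_⟩⟩
  · simp [Strategy.ofFun, Kernel.deterministic_apply, bellmanAction]
  · rintro (_ | _ | k) h2 - h - - ℓ hlt
    · omega
    · omega
    · have hne : bellmanAction M K C ρ (k + 2) h ≠ ℓ := by
        rintro rfl
        simp only [bellmanAction] at hlt
        split_ifs at hlt with hle
        · exact absurd hle (not_le.2 hlt)
        · exact absurd hlt (not_lt.2 (not_le.1 hle).le)
      simp [Strategy.ofFun, Kernel.deterministic_apply, hne]

lemma sum_count {M k : ℕ} (h : Hist M k) : h.count 0 + h.count 1 = k * M := by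
  have hj : ∀ i : Fin 2, ((if i = 0 then M else 0) + if i = 1 then M else 0) = M := by
    intro i
    fin_cases i <;> simp
  simp [Hist.count, ← Finset.sum_add_distrib, hj]

/-- After the first packet, every strategy that satisfies the Bellman rule is optimal for the flat
prior. -/
lemma costToGo_flat_second {M r : ℕ} (hM : 0 < M) {C : ℝ} (hC : 0 < C) {ρ : ℝ → ℝ}
    (hρ : IsSymmDensity C ρ) {σ : Strategy M} (hσ : IsBellmanStrategy (r + 2) C ρ σ) (h : Hist M 0)
    (ℓ : Fin 2) (x : Fin M → ℝ) :
    costToGo σ (cost (boxDensity ρ Set.univ)) (r + 1) 1 (Hist.snoc (h, (ℓ, x))) =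
      ENNReal.ofReal (flatMass (State.step M ℓ (∑ i, x i) 0)) *
        ENNReal.ofReal (secondRisk M (r + 2) C ρ) := by
  have hG : ∀ i, Measurable (cost (boxDensity ρ Set.univ) i) :=
    measurable_cost (measurable_boxDensity hρ.measurable MeasurableSet.univ)
  set h' : Hist M 1 := Hist.snoc (h, (ℓ, x)) with hh'
  have hst : h'.state = State.step M ℓ (∑ i, x i) 0 := by
    rw [hh', state_snoc, state_of_isEmpty]
  have hpol : σ.policy 1 h' = Measure.dirac (1 - ℓ) := by
    rw [hσ.turn_by_turn, hh']
    rfl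
  have hopt : ∀ y, costToGo σ (cost (boxDensity ρ Set.univ)) r 2 (Hist.snoc (h', (1 - ℓ, y))) =
      value M (cost (boxDensity ρ Set.univ)) r (Hist.snoc (h', (1 - ℓ, y))).state := by
    intro y
    refine costToGo_eq_value σ hG (r + 2)
      (fun k h => 2 ≤ k ∧ 0 < h.count 0 ∧ 0 < h.count 1) ?_ ?_ r 2 _ (by omega) ⟨le_rfl, ?_⟩
    · rintro k h i z ⟨h1, h2, h3⟩
      rw [count_snoc]
      exact ⟨by omega, Nat.add_pos_left h2 _, Nat.add_pos_left h3 _⟩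
    · rintro k r' h i hk ⟨h1, h2, h3⟩ hlt
      refine hσ.smallest k h1 (by omega) h h2 h3 i ?_
      have hN : h.state.1 0 + h.state.1 1 + (r' + 1) * M = (r + 2) * M := by
        change h.count 0 + h.count 1 + (r' + 1) * M = (r + 2) * M
        rw [sum_count, ← hk]
        ring
      rw [value_eq_min_other M _ i, min_lt_iff, or_iff_right (lt_irrefl _),
        actionValue_flat hM hC hρ _ r' _ h.state h2 h3 hN,
        actionValue_flat hM hC hρ _ r' _ h.state h2 h3 hN] at hlt
      by_contra hle
      exact absurd (mul_le_mul_right (ENNReal.ofReal_le_ofReal (not_lt.1 hle)) _) (not_le.2 hlt)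
    · rw [count_snoc, hh', count_snoc]
      fin_cases ℓ <;> simp [hM]
  rw [costToGo, hpol, sum_dirac_mul]
  simp_rw [hopt]
  rw [lintegral_value_snoc hG, hst, ← actionValue_flat_second hM hC hρ ℓ]
  rfl

/-! ### Limits of the risks -/

/-- The probability, for the prior truncated to `|m| ≤ a`, that the total income of the first
packet, processed with action `ℓ`, is not between `-M a` and `M a`. -/
noncomputable def tailMass (M : ℕ) (ρ : ℝ → ℝ) (ℓ : Fin 2) (a : ℝ) : ℝ≥0∞ :=
  ENNReal.ofReal (2 * a)⁻¹ * ∫⁻ y in (Set.Icc (-(M * a)) (M * a))ᶜ,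
    mass (boxDensity ρ (Set.Icc (-a) a)) (State.step M ℓ y 0) ∂gaussianReal 0 M

lemma weight_zero_of_mul_eq_zero {C : ℝ} (hC : 0 < C) {ρ : ℝ → ℝ} (hρ : IsSymmDensity C ρ)
    {n₁ n₂ : ℕ} (h : n₁ * n₂ = 0) : weight C ρ 0 n₁ n₂ = 1 := by
  have h' : (n₁ : ℝ) * n₂ = 0 := by exact_mod_cast h
  have hw := ofReal_weight hC hρ 0 n₁ n₂
  simp only [mul_assoc, h', mul_zero, zero_mul, zero_div, sub_zero, Real.exp_zero,
    ENNReal.ofReal_one, one_mul] at hw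
  rw [← ofReal_integral_eq_lintegral_ofReal hρ.integrable (ae_of_all _ hρ.nonneg),
    hρ.integral_eq_one] at hw
  exact (ENNReal.ofReal_eq_ofReal_iff (weight_pos hC hρ _ _ _).le zero_le_one).1 hw

lemma step_zero_count_pos {M : ℕ} (hM : 0 < M) (ℓ : Fin 2) (x : ℝ) :
    0 < (State.step M ℓ x 0).1 0 + (State.step M ℓ x 0).1 1 := by
  rw [step_count_sum]
  simpa using hM

lemma weight_step_zero {M : ℕ} {C : ℝ} (hC : 0 < C) {ρ : ℝ → ℝ} (hρ : IsSymmDensity C ρ)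
    (ℓ : Fin 2) (x : ℝ) : weight C ρ (State.step M ℓ x 0).stat ((State.step M ℓ x 0).1 0)
      ((State.step M ℓ x 0).1 1) = 1 := by
  rw [stat_step_zero]
  refine weight_zero_of_mul_eq_zero hC hρ ?_
  rw [step_zero]
  fin_cases ℓ <;> simp

/-- The probabilities of the two ranges of the income add up to one, and the lower bound for the
range `|y| ≤ M a` tends to one. -/
lemma tendsto_tailMass {M : ℕ} (hM : 0 < M) {C : ℝ} (hC : 0 < C) {ρ : ℝ → ℝ}
    (hρ : IsSymmDensity C ρ) (ℓ : Fin 2) : Tendsto (tailMass M ρ ℓ) atTop (𝓝 0) := by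
  obtain ⟨u, hu, hle⟩ := exists_lower_bound hM ℓ
    (fun a y => mass (boxDensity ρ (Set.Icc (-a) a)) (State.step M ℓ y 0))
    (fun b => mass (boxDensity ρ (Set.Icc (-b) b)) (State.step M ℓ 0 0))
    (fun a b y hy => mass_box_step_ge hM hy ℓ) ENNReal.one_ne_top (by
      have h := tendsto_mass_box hC hρ (step_zero_count_pos hM ℓ 0)
      rwa [mass_flat hC hρ (step_zero_count_pos hM ℓ 0), weight_step_zero hC hρ,
        ENNReal.ofReal_one] at h)
  have hlim : Tendsto (fun a => 1 - u a) atTop (𝓝 (1 - 1)) :=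
    ENNReal.Tendsto.sub tendsto_const_nhds hu (Or.inl ENNReal.one_ne_top)
  rw [tsub_self] at hlim
  refine tendsto_of_tendsto_of_tendsto_of_le_of_le' tendsto_const_nhds hlim
    (Eventually.of_forall fun _ => zero_le) ?_
  filter_upwards [hle, eventually_gt_atTop 0] with a hua ha
  have htot : ENNReal.ofReal (2 * a)⁻¹ * (∫⁻ y in Set.Icc (-(M * a)) (M * a),
      mass (boxDensity ρ (Set.Icc (-a) a)) (State.step M ℓ y 0) ∂gaussianReal 0 M) +
      tailMass M ρ ℓ a = 1 := by
    rw [tailMass, ← mul_add, lintegral_add_compl _ measurableSet_Icc,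
      lintegral_mass_step hM (measurable_boxDensity hρ.measurable measurableSet_Icc),
      mass_boxDensity_zero hρ measurableSet_Icc, volume_Icc_mul ha]
  have hfin := ne_top_of_le_ne_top ENNReal.one_ne_top (le_self_add.trans_eq htot)
  rw [ENNReal.eq_sub_of_add_eq hfin ((add_comm _ _).trans htot)]
  exact tsub_le_tsub_left hua 1

/-- An upper bound of the risk after the first packet. For incomes between `-M a` and `M a` the
truncated prior is replaced by the flat one, for which the Bellman strategy is optimal; for other
incomes the total regret is at most `2 C` times the number of data. -/
lemma lintegral_costToGo_box_le {M r : ℕ} (hM : 0 < M) {C : ℝ} (hC : 0 < C) {ρ : ℝ → ℝ}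
    (hρ : IsSymmDensity C ρ) {σ : Strategy M} (hσ : IsBellmanStrategy (r + 2) C ρ σ) {a : ℝ}
    (ha : 0 < a) (h : Hist M 0) (ℓ : Fin 2) :
    ENNReal.ofReal (2 * a)⁻¹ * ∫⁻ x, costToGo σ (cost (boxDensity ρ (Set.Icc (-a) a))) (r + 1) 1
        (Hist.snoc (h, (ℓ, x))) ∂packetKernel M 0 ℓ ≤
      ENNReal.ofReal (secondRisk M (r + 2) C ρ) +
        (r + 1 : ℕ) * (M * ENNReal.ofReal (2 * C)) * tailMass M ρ ℓ a := by
  set S := Set.Icc (-(M * a)) (M * a) with hS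
  set D : ℝ≥0∞ := (r + 1 : ℕ) * (M * ENNReal.ofReal (2 * C)) with hD
  set f : ℝ → ℝ≥0∞ := fun y => ENNReal.ofReal (flatMass (State.step M ℓ y 0)) *
    ENNReal.ofReal (secondRisk M (r + 2) C ρ) with hf
  set t : ℝ → ℝ≥0∞ := fun y => D * mass (boxDensity ρ (Set.Icc (-a) a)) (State.step M ℓ y 0)
    with ht
  have hbox := measurable_boxDensity hρ.measurable (measurableSet_Icc (a := -a) (b := a))
  have hfm' : Measurable fun y => ENNReal.ofReal (flatMass (State.step M ℓ y 0)) := by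
    simp only [flatMass_step_zero]
    fun_prop
  have hfm : Measurable f := hfm'.mul_const _
  have htm : Measurable t := ((measurable_mass hbox).comp ((measurable_step M ℓ).comp
    (measurable_const.prodMk measurable_id))).const_mul _
  have hbound : ∀ x : Fin M → ℝ, costToGo σ (cost (boxDensity ρ (Set.Icc (-a) a))) (r + 1) 1
      (Hist.snoc (h, (ℓ, x))) ≤ S.indicator f (∑ i, x i) + Sᶜ.indicator t (∑ i, x i) := by
    intro x
    by_cases hx : ∑ i, x i ∈ S
    · rw [Set.indicator_of_mem hx, hf]
      simp only
      rw [← costToGo_flat_second hM hC hρ hσ h]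
      exact (costToGo_mono σ (cost_mono (boxDensity_mono ρ (Set.subset_univ _))) _ _ _).trans
        le_self_add
    · rw [Set.indicator_of_mem (Set.mem_compl hx), ht]
      refine le_trans ?_ le_add_self
      have := costToGo_le_martingale σ (measurable_mass hbox) (ENNReal.ofReal (2 * C))
        (cost_le_mass fun θ hθ => boxDensity_eq_zero hρ _ hθ) (lintegral_mass_step hM hbox)
        (r + 1) 1 (Hist.snoc (h, (ℓ, x)))
      rwa [state_snoc, state_of_isEmpty] at this
  have hD' : D ≠ ∞ :=
    ENNReal.mul_ne_top (by simp) (ENNReal.mul_ne_top (by simp) ENNReal.ofReal_ne_top)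
  calc _ ≤ ENNReal.ofReal (2 * a)⁻¹ * ∫⁻ x, (S.indicator f (∑ i, x i) +
        Sᶜ.indicator t (∑ i, x i)) ∂packetKernel M 0 ℓ :=
        mul_le_mul_right (lintegral_mono hbound) _
    _ = ENNReal.ofReal (2 * a)⁻¹ * ((∫⁻ y in S, f y ∂gaussianReal 0 M) +
        ∫⁻ y in Sᶜ, t y ∂gaussianReal 0 M) := by
        rw [lintegral_packetKernel_zero M ℓ (F := fun y => S.indicator f y + Sᶜ.indicator t y)
          ((hfm.indicator measurableSet_Icc).add (htm.indicator measurableSet_Icc.compl)),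
          lintegral_add_left (hfm.indicator measurableSet_Icc),
          lintegral_indicator measurableSet_Icc, lintegral_indicator measurableSet_Icc.compl]
    _ = _ := by
        rw [hf, ht, lintegral_mul_const _ hfm', setLIntegral_flatMass hM,
          lintegral_const_mul' _ _ hD', mul_add, ← mul_assoc, ← ENNReal.ofReal_mul (by positivity),
          inv_mul_cancel₀ (by positivity), ENNReal.ofReal_one, one_mul, mul_left_comm]
        rfl

/-- The limit of the Bayesian risk, as an extended nonnegative number. -/
noncomputable def limitCost (M K : ℕ) (C : ℝ) (ρ : ℝ → ℝ) : ℝ≥0∞ :=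
  M * ENNReal.ofReal (2 * ∫ v in (0 : ℝ)..C, v * ρ v) + ENNReal.ofReal (secondRisk M K C ρ)

lemma costToGo_prior_le {M r : ℕ} (hM : 0 < M) {C : ℝ} (hC : 0 < C) {ρ : ℝ → ℝ}
    (hρ : IsSymmDensity C ρ) {σ : Strategy M} (hσ : IsBellmanStrategy (r + 2) C ρ σ) {a : ℝ}
    (ha : 0 < a) :
    costToGo σ (cost fun θ => ENNReal.ofReal (prior ρ a θ)) (r + 2) 0 Fin.elim0 ≤
      limitCost M (r + 2) C ρ + (r + 1 : ℕ) * (M * ENNReal.ofReal (2 * C)) *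
        (tailMass M ρ 0 a + tailMass M ρ 1 a) := by
  have hbox := measurable_boxDensity hρ.measurable (measurableSet_Icc (a := -a) (b := a))
  have htail : ∀ ℓ, tailMass M ρ ℓ a ≤ tailMass M ρ 0 a + tailMass M ρ 1 a := by
    intro ℓ
    fin_cases ℓ
    exacts [le_self_add, le_add_self]
  rw [costToGo]
  calc _ ≤ ∑ ℓ, σ.policy 0 Fin.elim0 {ℓ} * (limitCost M (r + 2) C ρ + (r + 1 : ℕ) *
        (M * ENNReal.ofReal (2 * C)) * (tailMass M ρ 0 a + tailMass M ρ 1 a)) := by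
        refine Finset.sum_le_sum fun ℓ _ => mul_le_mul_right ?_ _
        rw [state_of_isEmpty, cost_prior_zero hC hρ ha, limitCost, add_assoc]
        refine add_le_add_right ?_ _
        simp_rw [costToGo_smul σ (measurable_cost hbox) _ (cost_prior ha)]
        rw [lintegral_const_mul' _ _ ENNReal.ofReal_ne_top]
        refine (lintegral_costToGo_box_le hM hC hρ hσ ha Fin.elim0 ℓ).trans ?_
        exact add_le_add_right (mul_le_mul_right (htail ℓ) _) _
    _ = _ := by rw [← Finset.sum_mul, sum_policy, one_mul]

/-- A lower bound of the Bayesian risk that has the right limit. -/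
lemma exists_lower_bound_value_prior {M : ℕ} (hM : 0 < M) {C : ℝ} (hC : 0 < C) {ρ : ℝ → ℝ}
    (hρ : IsSymmDensity C ρ) (r : ℕ) :
    ∃ u : ℝ → ℝ≥0∞, Tendsto u atTop (𝓝 (limitCost M (r + 2) C ρ)) ∧ ∀ᶠ a in atTop,
      u a ≤ value M (cost fun θ => ENNReal.ofReal (prior ρ a θ)) (r + 2) 0 := by
  obtain ⟨u, hu, hle⟩ := exists_lower_bound hM 0
    (fun a y => value M (cost (boxDensity ρ (Set.Icc (-a) a))) (r + 1) (State.step M 0 y 0))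
    (fun b => value M (cost (boxDensity ρ (Set.Icc (-b) b))) (r + 1) (State.step M 0 0 0))
    (fun a b y hy => value_box_step_ge hM hρ.measurable hy 0 (r + 1))
    (ENNReal.ofReal_ne_top (r := secondRisk M (r + 2) C ρ)) (by
      rw [← value_flat_second hM hC hρ]
      exact tendsto_value_box hM hC hρ r (step_zero_count_pos hM 0 0))
  refine ⟨fun a => M * ENNReal.ofReal (2 * ∫ v in (0 : ℝ)..C, v * ρ v) + u a,
    tendsto_const_nhds.add hu, ?_⟩
  filter_upwards [hle, eventually_gt_atTop 0] with a hua ha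
  have hbox := measurable_boxDensity hρ.measurable (measurableSet_Icc (a := -a) (b := a))
  rw [← actionValue_prior_eq hρ ha (r + 1) 0, actionValue, cost_prior_zero hC hρ ha]
  refine add_le_add_right (hua.trans ?_) _
  simp_rw [value_smul (measurable_cost hbox) _ (cost_prior ha)]
  rw [lintegral_const_mul' _ _ ENNReal.ofReal_ne_top]
  exact mul_le_mul_right (setLIntegral_le_lintegral _ _) _

lemma value_prior_le_costToGo {M : ℕ} {C : ℝ} {ρ : ℝ → ℝ}
    (hρ : IsSymmDensity C ρ) (σ : Strategy M) (K : ℕ) {a : ℝ} (ha : 0 < a) :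
    value M (cost fun θ => ENNReal.ofReal (prior ρ a θ)) K 0 ≤
      costToGo σ (cost fun θ => ENNReal.ofReal (prior ρ a θ)) K 0 Fin.elim0 := by
  have h := value_le_costToGo σ
    (measurable_cost (isFiniteDensity_prior hρ ha).measurable.ennreal_ofReal) K 0 Fin.elim0
  rwa [state_of_isEmpty] at h

lemma tendsto_costToGo_prior_bound {M : ℕ} (hM : 0 < M) {C : ℝ} (hC : 0 < C) {ρ : ℝ → ℝ}
    (hρ : IsSymmDensity C ρ) (r : ℕ) :
    Tendsto (fun a => limitCost M (r + 2) C ρ + (r + 1 : ℕ) * (M * ENNReal.ofReal (2 * C)) *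
      (tailMass M ρ 0 a + tailMass M ρ 1 a)) atTop (𝓝 (limitCost M (r + 2) C ρ)) := by
  have h := (tendsto_const_nhds (x := limitCost M (r + 2) C ρ)).add (ENNReal.Tendsto.const_mul
    (a := (r + 1 : ℕ) * (M * ENNReal.ofReal (2 * C)))
    ((tendsto_tailMass hM hC hρ 0).add (tendsto_tailMass hM hC hρ 1)) (Or.inr
      (ENNReal.mul_ne_top (by simp) (ENNReal.mul_ne_top (by simp) ENNReal.ofReal_ne_top))))
  simpa using h

lemma tendsto_costToGo_prior {M r : ℕ} (hM : 0 < M) {C : ℝ} (hC : 0 < C) {ρ : ℝ → ℝ}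
    (hρ : IsSymmDensity C ρ) {σ : Strategy M} (hσ : IsBellmanStrategy (r + 2) C ρ σ) :
    Tendsto (fun a => costToGo σ (cost fun θ => ENNReal.ofReal (prior ρ a θ)) (r + 2) 0 Fin.elim0)
      atTop (𝓝 (limitCost M (r + 2) C ρ)) := by
  obtain ⟨u, hu, hle⟩ := exists_lower_bound_value_prior hM hC hρ r
  refine tendsto_of_tendsto_of_tendsto_of_le_of_le' hu (tendsto_costToGo_prior_bound hM hC hρ r)
    ?_ ?_
  · filter_upwards [hle, eventually_gt_atTop 0] with a hua ha
    exact hua.trans (value_prior_le_costToGo hρ σ _ ha)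
  · filter_upwards [eventually_gt_atTop 0] with a ha
    exact costToGo_prior_le hM hC hρ hσ ha

lemma tendsto_value_prior {M : ℕ} (hM : 0 < M) {C : ℝ} (hC : 0 < C) {ρ : ℝ → ℝ}
    (hρ : IsSymmDensity C ρ) (r : ℕ) :
    Tendsto (fun a => value M (cost fun θ => ENNReal.ofReal (prior ρ a θ)) (r + 2) 0)
      atTop (𝓝 (limitCost M (r + 2) C ρ)) := by
  obtain ⟨u, hu, hle⟩ := exists_lower_bound_value_prior hM hC hρ r
  obtain ⟨σ, hσ⟩ := exists_isBellmanStrategy hM (r + 2) hC hρ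
  refine tendsto_of_tendsto_of_tendsto_of_le_of_le' hu (tendsto_costToGo_prior hM hC hρ hσ) hle ?_
  filter_upwards [eventually_gt_atTop 0] with a ha
  exact value_prior_le_costToGo hρ σ _ ha

lemma integral_mul_nonneg {C : ℝ} (hC : 0 < C) {ρ : ℝ → ℝ} (hρ : IsSymmDensity C ρ) :
    0 ≤ ∫ v in (0 : ℝ)..C, v * ρ v :=
  intervalIntegral.integral_nonneg hC.le fun v hv => mul_nonneg hv.1 (hρ.nonneg v)

lemma secondRisk_nonneg {M : ℕ} (hM : 0 < M) (K : ℕ) {C : ℝ} (hC : 0 < C) {ρ : ℝ → ℝ}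
    (hρ : IsSymmDensity C ρ) : 0 ≤ secondRisk M K C ρ := by
  have h1 := integral_mul_nonneg hC hρ
  have h2 : 0 ≤ ∫ U, R M (K * M) C ρ U M M * gaussianPDFReal 0 ((M : ℝ≥0) / 2) U :=
    integral_nonneg fun U => mul_nonneg ((isExpBounded_R hM hC hρ _ _ _).nonneg U)
      (gaussianPDFReal_nonneg _ _ _)
  unfold secondRisk
  positivity

lemma limitCost_ne_top (M K : ℕ) (C : ℝ) (ρ : ℝ → ℝ) : limitCost M K C ρ ≠ ∞ := by
  simp [limitCost, ENNReal.mul_eq_top]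

lemma toReal_limitCost {M : ℕ} (hM : 0 < M) (K : ℕ) {C : ℝ} (hC : 0 < C) {ρ : ℝ → ℝ}
    (hρ : IsSymmDensity C ρ) : (limitCost M K C ρ).toReal =
      4 * M * (∫ v in (0 : ℝ)..C, v * ρ v) +
        ∫ U, R M (K * M) C ρ U M M * gaussianPDFReal 0 ((M : ℝ≥0) / 2) U := by
  have h1 := integral_mul_nonneg hC hρ
  rw [limitCost, ENNReal.toReal_add (ENNReal.mul_ne_top (by simp) ENNReal.ofReal_ne_top) (by simp),
    ENNReal.toReal_mul, ENNReal.toReal_ofReal (by positivity),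
    ENNReal.toReal_ofReal (secondRisk_nonneg hM K hC hρ), ENNReal.toReal_natCast, secondRisk]
  ring

theorem tendsto_bayesRisk_prior {M : ℕ} (hM : 0 < M) {C : ℝ} (hC : 0 < C) {ρ : ℝ → ℝ}
    (hρ : IsSymmDensity C ρ) (r : ℕ) :
    Tendsto (fun a => bayesRisk M (r + 2) C (prior ρ a)) atTop
      (𝓝 (4 * M * (∫ v in (0 : ℝ)..C, v * ρ v) +
        ∫ U, R M ((r + 2) * M) C ρ U M M * gaussianPDFReal 0 ((M : ℝ≥0) / 2) U)) := by
  rw [← toReal_limitCost hM _ hC hρ]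
  refine ((ENNReal.tendsto_toReal (limitCost_ne_top M (r + 2) C ρ)).comp
    (tendsto_value_prior hM hC hρ r)).congr' ?_
  filter_upwards [eventually_gt_atTop 0] with a ha
  exact (bayesRisk_eq hM (isFiniteDensity_prior hρ ha) (r + 1)).symm

theorem tendsto_avgLoss_prior {M r : ℕ} (hM : 0 < M) {C : ℝ} (hC : 0 < C) {ρ : ℝ → ℝ}
    (hρ : IsSymmDensity C ρ) {σ : Strategy M} (hσ : IsBellmanStrategy (r + 2) C ρ σ) :
    Tendsto (fun a => avgLoss (r + 2) C σ (prior ρ a)) atTop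
      (𝓝 (4 * M * (∫ v in (0 : ℝ)..C, v * ρ v) +
        ∫ U, R M ((r + 2) * M) C ρ U M M * gaussianPDFReal 0 ((M : ℝ≥0) / 2) U)) := by
  rw [← toReal_limitCost hM _ hC hρ]
  refine ((ENNReal.tendsto_toReal (limitCost_ne_top M (r + 2) C ρ)).comp
    (tendsto_costToGo_prior hM hC hρ hσ)).congr' ?_
  filter_upwards [eventually_gt_atTop 0] with a ha
  exact (avgLoss_eq (isFiniteDensity_prior hρ ha) (r + 2) σ).symm

theorem bayesRiskAction_prior_eq {M : ℕ} (hM : 0 < M) {C : ℝ} {ρ : ℝ → ℝ}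
    (hρ : IsSymmDensity C ρ) {a : ℝ} (ha : 0 < a) (r : ℕ) (ℓ : Fin 2) :
    bayesRiskAction M (r + 1) C (prior ρ a) ℓ = bayesRisk M (r + 1) C (prior ρ a) := by
  rw [bayesRiskAction_eq hM (isFiniteDensity_prior hρ ha),
    bayesRisk_eq hM (isFiniteDensity_prior hρ ha), actionValue_prior_eq hρ ha]

/-- After one packet, processed with action `ℓ`, it is asymptotically optimal to apply the other
action. -/
theorem tendsto_risk_posterior_second {M : ℕ} (hM : 0 < M) {C : ℝ} (hC : 0 < C) {ρ : ℝ → ℝ}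
    (hρ : IsSymmDensity C ρ) (r : ℕ) (ℓ : Fin 2) (X : ℝ) {X₁ X₂ : ℝ} {n₁ n₂ : ℕ}
    (hs : (![n₁, n₂], ![X₁, X₂]) = State.step M ℓ X 0) :
    Tendsto (fun a => bayesRisk M (r + 1) C (posterior C (prior ρ a) X₁ n₁ X₂ n₂)) atTop
        (𝓝 (secondRisk M (r + 2) C ρ)) ∧
      Tendsto (fun a => bayesRiskAction M (r + 1) C (posterior C (prior ρ a) X₁ n₁ X₂ n₂) (1 - ℓ))
        atTop (𝓝 (secondRisk M (r + 2) C ρ)) := by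
  have hnn := secondRisk_nonneg hM (r + 2) hC hρ
  have hw : weight C ρ (BatchBandit.stat X₁ n₁ X₂ n₂) n₁ n₂ = 1 := by
    have := weight_step_zero (M := M) hC hρ ℓ X
    rwa [← hs] at this
  have hn : 0 < n₁ + n₂ := by
    have := step_zero_count_pos hM ℓ X
    rwa [← hs] at this
  have hzero : ∀ i, (State.step M ℓ X 0).1 i = 0 → (State.step M ℓ X 0).2 i = 0 := by
    intro i hi
    by_cases h : i = ℓ
    · subst h
      simp [step_zero, hM.ne'] at hi
    · simp [step_zero, h]
  have hv := value_flat_second (r := r) hM hC hρ ℓ X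
  have hva := actionValue_flat_second (r := r) hM hC hρ ℓ X
  rw [← hs] at hzero hv hva
  have h1 := tendsto_bayesRisk_posterior (X₁ := X₁) (X₂ := X₂) (n₁ := n₁) (n₂ := n₂) hM hC hρ
    (hzero 0) (hzero 1) hn r hnn hv
  have h2 := tendsto_bayesRiskAction_posterior (X₁ := X₁) (X₂ := X₂) (n₁ := n₁) (n₂ := n₂) hM hC hρ
    (hzero 0) (hzero 1) hn r (1 - ℓ) hnn hva
  rw [hw, div_one] at h1 h2
  exact ⟨h1, h2⟩

/-- When both actions have been applied, the Bayesian risks for the posterior converge to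
`R_M / w` and `R_M^{(ℓ)} / w`. -/
theorem tendsto_risk_posterior {M : ℕ} (hM : 0 < M) {C : ℝ} (hC : 0 < C) {ρ : ℝ → ℝ}
    (hρ : IsSymmDensity C ρ) {n₁ n₂ r N : ℕ} (h₁ : 0 < n₁) (h₂ : 0 < n₂)
    (hN : n₁ + n₂ + (r + 1) * M = N) (X₁ X₂ : ℝ) :
    Tendsto (fun a => bayesRisk M (r + 1) C (posterior C (prior ρ a) X₁ n₁ X₂ n₂)) atTop
        (𝓝 (R M N C ρ (stat X₁ n₁ X₂ n₂) n₁ n₂ / weight C ρ (stat X₁ n₁ X₂ n₂) n₁ n₂)) ∧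
      ∀ ℓ, Tendsto (fun a => bayesRiskAction M (r + 1) C (posterior C (prior ρ a) X₁ n₁ X₂ n₂) ℓ)
        atTop (𝓝 (RAction M N C ρ ℓ (stat X₁ n₁ X₂ n₂) n₁ n₂ /
          weight C ρ (stat X₁ n₁ X₂ n₂) n₁ n₂)) :=
  ⟨tendsto_bayesRisk_posterior hM hC hρ (by omega) (by omega) (by omega) r
      ((isExpBounded_R hM hC hρ N n₁ n₂).nonneg _)
      (value_flat hM hC hρ N (r + 1) (![n₁, n₂], ![X₁, X₂]) h₁ h₂ hN),
    fun ℓ => tendsto_bayesRiskAction_posterior hM hC hρ (by omega) (by omega) (by omega) r ℓ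
      ((isExpBounded_RAction hM hC hρ N ℓ n₁ n₂).nonneg _)
      (actionValue_flat hM hC hρ N r ℓ (![n₁, n₂], ![X₁, X₂]) h₁ h₂ hN)⟩

end BatchBandit

open BatchBandit in
theorem theorem1 (M K : ℕ) (hM : 0 < M) (hK : 2 ≤ K) (C : ℝ) (hC : 0 < C)
    (ρ : ℝ → ℝ) (hρ : IsSymmDensity C ρ) :
    -- the integrals in the recursive equation and in the formula for the risk converge
    ((∀ n₁ n₂ : ℕ, 0 < n₁ → 0 < n₂ → ∀ (U : ℝ) (D : ℝ≥0),
        Integrable fun x => R M (K * M) C ρ (U - x) n₁ n₂ * gaussianPDFReal 0 D x) ∧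
      Integrable fun U => R M (K * M) C ρ U M M * gaussianPDFReal 0 ((M : ℝ≥0) / 2) U) ∧
    -- the limiting Bayesian risk
    Tendsto (fun a => bayesRisk M K C (prior ρ a)) atTop
      (𝓝 (4 * M * (∫ v in (0 : ℝ)..C, v * ρ v) +
        ∫ U, R M (K * M) C ρ U M M * gaussianPDFReal 0 ((M : ℝ≥0) / 2) U)) ∧
    -- turn-by-turn control followed by the rule of the recursive equation is feasible and
    -- attains the limiting Bayesian risk
    ((∃ σ : Strategy M, IsBellmanStrategy K C ρ σ) ∧
      ∀ σ : Strategy M, IsBellmanStrategy K C ρ σ →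
        Tendsto (fun a => avgLoss K C σ (prior ρ a)) atTop
          (𝓝 (4 * M * (∫ v in (0 : ℝ)..C, v * ρ v) +
            ∫ U, R M (K * M) C ρ U M M * gaussianPDFReal 0 ((M : ℝ≥0) / 2) U))) ∧
    -- the first packet: both actions are optimal
    (∀ ℓ : Fin 2, ∀ a : ℝ, 0 < a →
      bayesRiskAction M K C (prior ρ a) ℓ = bayesRisk M K C (prior ρ a)) ∧
    -- the second packet: the other action is optimal
    (∀ X : ℝ,
      (Tendsto (fun a => bayesRisk M (K - 1) C (posterior C (prior ρ a) X M 0 0)) atTop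
          (𝓝 (2 * M * (∫ v in (0 : ℝ)..C, v * ρ v) +
            ∫ U, R M (K * M) C ρ U M M * gaussianPDFReal 0 ((M : ℝ≥0) / 2) U)) ∧
        Tendsto (fun a => bayesRiskAction M (K - 1) C (posterior C (prior ρ a) X M 0 0) 1) atTop
          (𝓝 (2 * M * (∫ v in (0 : ℝ)..C, v * ρ v) +
            ∫ U, R M (K * M) C ρ U M M * gaussianPDFReal 0 ((M : ℝ≥0) / 2) U))) ∧
      (Tendsto (fun a => bayesRisk M (K - 1) C (posterior C (prior ρ a) 0 0 X M)) atTop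
          (𝓝 (2 * M * (∫ v in (0 : ℝ)..C, v * ρ v) +
            ∫ U, R M (K * M) C ρ U M M * gaussianPDFReal 0 ((M : ℝ≥0) / 2) U)) ∧
        Tendsto (fun a => bayesRiskAction M (K - 1) C (posterior C (prior ρ a) 0 0 X M) 0) atTop
          (𝓝 (2 * M * (∫ v in (0 : ℝ)..C, v * ρ v) +
            ∫ U, R M (K * M) C ρ U M M * gaussianPDFReal 0 ((M : ℝ≥0) / 2) U)))) ∧
    -- the later packets: action `ℓ` is optimal iff `R_M^{(ℓ)}` has the smaller value
    (∀ k₁ k₂ : ℕ, 1 ≤ k₁ → 1 ≤ k₂ → k₁ + k₂ < K → ∀ X₁ X₂ U : ℝ,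
      U = stat X₁ (k₁ * M) X₂ (k₂ * M) →
      0 < weight C ρ U (k₁ * M) (k₂ * M) ∧
      Tendsto (fun a => bayesRisk M (K - (k₁ + k₂)) C
          (posterior C (prior ρ a) X₁ (k₁ * M) X₂ (k₂ * M))) atTop
        (𝓝 (R M (K * M) C ρ U (k₁ * M) (k₂ * M) / weight C ρ U (k₁ * M) (k₂ * M))) ∧
      ∀ ℓ : Fin 2,
        Tendsto (fun a => bayesRiskAction M (K - (k₁ + k₂)) C
            (posterior C (prior ρ a) X₁ (k₁ * M) X₂ (k₂ * M)) ℓ) atTop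
          (𝓝 (RAction M (K * M) C ρ ℓ U (k₁ * M) (k₂ * M) /
            weight C ρ U (k₁ * M) (k₂ * M))) ∧
        (Tendsto (fun a => bayesRiskAction M (K - (k₁ + k₂)) C
              (posterior C (prior ρ a) X₁ (k₁ * M) X₂ (k₂ * M)) ℓ -
            bayesRisk M (K - (k₁ + k₂)) C
              (posterior C (prior ρ a) X₁ (k₁ * M) X₂ (k₂ * M))) atTop (𝓝 0) ↔
          RAction M (K * M) C ρ ℓ U (k₁ * M) (k₂ * M) ≤
            RAction M (K * M) C ρ (1 - ℓ) U (k₁ * M) (k₂ * M))) := by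
  obtain ⟨r, rfl⟩ : ∃ r, K = r + 2 := ⟨K - 2, by omega⟩
  refine ⟨⟨fun n₁ n₂ _ _ U D => (isExpBounded_R hM hC hρ _ n₁ n₂).integrable (by positivity) D U,
    ?_⟩, tendsto_bayesRisk_prior hM hC hρ r, ⟨exists_isBellmanStrategy hM _ hC hρ,
      fun σ hσ => tendsto_avgLoss_prior hM hC hρ hσ⟩,
    fun ℓ a ha => bayesRiskAction_prior_eq hM hρ ha (r + 1) ℓ, fun X => ⟨?_, ?_⟩, ?_⟩
  -- the density is even, so the integral is the convolution at `0`
  · have h := ((isExpBounded_R hM hC hρ ((r + 2) * M) M M).integrable (by positivity)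
      ((M : ℝ≥0) / 2) 0).comp_neg
    refine h.congr (ae_of_all _ fun U => ?_)
    simp [gaussianPDFReal]
  · refine tendsto_risk_posterior_second hM hC hρ r 0 X ?_
    rw [step_zero]
    ext i <;> fin_cases i <;> simp
  · refine tendsto_risk_posterior_second hM hC hρ r 1 X ?_
    rw [step_zero]
    ext i <;> fin_cases i <;> simp
  · rintro k₁ k₂ hk₁ hk₂ hk X₁ X₂ U rfl
    obtain ⟨d, hd⟩ : ∃ d, r + 2 = k₁ + k₂ + (d + 1) := ⟨r + 2 - (k₁ + k₂) - 1, by omega⟩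
    have hw := weight_pos hC hρ (stat X₁ (k₁ * M) X₂ (k₂ * M)) (k₁ * M) (k₂ * M)
    obtain ⟨h, hact⟩ := tendsto_risk_posterior hM hC hρ (r := d) (N := (r + 2) * M)
      (Nat.mul_pos hk₁ hM) (Nat.mul_pos hk₂ hM) (by rw [hd]; ring) X₁ X₂
    rw [show r + 2 - (k₁ + k₂) = d + 1 by omega]
    refine ⟨hw, h, fun ℓ => ⟨hact ℓ, ?_⟩⟩
    have hmin : R M ((r + 2) * M) C ρ (stat X₁ (k₁ * M) X₂ (k₂ * M)) (k₁ * M) (k₂ * M) =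
        min (RAction M ((r + 2) * M) C ρ ℓ (stat X₁ (k₁ * M) X₂ (k₂ * M)) (k₁ * M) (k₂ * M))
          (RAction M ((r + 2) * M) C ρ (1 - ℓ) (stat X₁ (k₁ * M) X₂ (k₂ * M)) (k₁ * M)
            (k₂ * M)) := by
      rw [R_eq_min hM]
      fin_cases ℓ
      exacts [rfl, min_comm _ _]
    have hsub := (hact ℓ).sub h
    -- the difference of the risks tends to `(R_M^{(ℓ)} - R_M) / w`
    rw [← min_eq_left_iff, ← hmin]
    refine ⟨fun h0 => ?_, fun he => ?_⟩
    · have := tendsto_nhds_unique hsub h0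
      rw [← sub_div, div_eq_zero_iff, or_iff_left hw.ne', sub_eq_zero] at this
      exact this.symm
    · rwa [he, sub_self] at hsub
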